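/- Let $d\ge 1$. Let $\mathcal F f(\xi)=\int_{\mathbb R^d} f(x)e^{-ix\cdot\xi}\,dx$ be the Fourier transform, extended to the space $\mathscr S'(\mathbb R^d)$ of tempered distributions. Fix a smooth function $\chi:\mathbb R^d\to\mathbb R$ that vanishes outside $[-3/4,3/4]^d$ and satisfies $\sum_{k\in\mathbb Z^d}\chi(\xi-k)=1$ for all $\xi\in\mathbb R^d$. For $j\in\mathbb Z$ and $k\in\mathbb Z^d$ put $\chi_{j,k}(\xi)=\chi(2^{-j}\xi-k)$ and $\Box_{j,k}=\mathcal F^{-1}\chi_{j,k}\mathcal F$. For $1\le p,q\le\infty$ let $$\|f\|_{M_{p,q}^{[j]}}=\big\|\,\|\Box_{j,k}f\|_{L^p(\mathbb R^d)}\,\big\|_{\ell^q_k(\mathbb Z^d)},\qquad f\in\mathscr S'(\mathbb R^d),$$ and let $M_{p,q}^{[j]}$ be the set of $f\in\mathscr S'(\mathbb R^d)$ for which this is finite. For $\mu\in\mathbb R$ let $\mathscr M_{p,q}^\mu$ be the set of all $f\in\mathscr S'(\mathbb R^d)$ that can be written as $f=\sum_{j\le 0}f_j$ (convergence in $\mathscr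 S'$) with $f_j\in M_{p,q}^{[j]}$ and $\sum_{j\le0}2^{j\mu}\|f_j\|_{M_{p,q}^{[j]}}<\infty$, and let $\|f\|_{\mathscr M_{p,q}^\mu}$ be the infimum of these sums over all such decompositions. Write $\mathscr M_{p,q}^\mu\hookrightarrow L^r$ if $\mathscr M_{p,q}^\mu\subset L^r(\mathbb R^d)$ and there is a constant $C$ such that $\|f\|_{L^r}\le C\|f\|_{\mathscr M_{p,q}^\mu}$ for all $f\in\mathscr M_{p,q}^\mu$. Let $1\le p,q,r\le\infty$, let $q'$ be the dual exponent of $q$ ($1/q+1/q'=1$), and put $$a(p,q)=d\Big(\frac1p+\frac1q-1\Big),\qquad \sigma(p,q)=\min\Big\{0,\;d\Big(\frac1q-\frac1p\Big),\;a(p,q)\Big\}.$$ If $\sigma(p,q)\le\mu\le a(p,q)$ and $\sigma(p,q)<a(p,q)$, then $\mathscr M_{p,q}^\mu\hookrightarrow L^r$ if and only if $$\max\{p,q\}\le r\le q'\quad\text{and}\quad \mu-\frac dp\le-\frac dr .$$ Moreover, for every $\mu>0$, $\mathscr M_{2,1}^\mu$ does not embed into $L^2$. -/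

import Mathlib

open MeasureTheory Filter Topology
open scoped ENNReal NNReal ContDiff SchwartzMap FourierTransform

noncomputable section

namespace ScalingModulation

/-- The Euclidean space `ℝ^d`. -/
abbrev Eu (d : ℕ) : Type := EuclideanSpace ℝ (Fin d)

/-- The lattice point `k ∈ ℤ^d`, seen as a vector of `ℝ^d`. -/
def lattice {d : ℕ} (k : Fin d → ℤ) : Eu d := WithLp.toLp 2 (fun i => (k i : ℝ))

/-- `χ` is a smooth cut-off function adapted to the unit cube: it is smooth, it vanishes outside
the cube `[-3/4, 3/4]^d`, and its integer translates add up to one. -/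
structure IsCubeCutoff {d : ℕ} (χ : Eu d → ℝ) : Prop where
  smooth : ContDiff ℝ ∞ χ
  eq_zero : ∀ ξ : Eu d, (∃ i, 3 / 4 < |ξ i|) → χ ξ = 0
  partition : ∀ ξ : Eu d, HasSum (fun k : Fin d → ℤ => χ (ξ - lattice k)) 1

/-- The dilated and translated cut-off `χ_{j,k}(ξ) = χ(2^{-j} ξ - k)`. -/
def cutoff {d : ℕ} (χ : Eu d → ℝ) (j : ℤ) (k : Fin d → ℤ) (ξ : Eu d) : ℝ :=
  χ (((2 : ℝ) ^ (-j)) • ξ - lattice k)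

/-- The frequency-uniform decomposition operator `□_{j,k} = 𝓕⁻¹ χ_{j,k} 𝓕` on tempered
distributions, for the Fourier transform with kernel `e^{-i x·ξ}`. Mathlib's transform has the
kernel `e^{-2πi x·ξ}`; a multiplier with symbol `m(ξ)` for the former convention has the symbol
`m(2π ξ)` for the latter. -/
def box {d : ℕ} (χ : Eu d → ℝ) (j : ℤ) (k : Fin d → ℤ) : 𝓢'(Eu d, ℂ) →L[ℂ] 𝓢'(Eu d, ℂ) :=
  TemperedDistribution.fourierMultiplierCLM ℂ
    (fun ξ : Eu d => (cutoff χ j k ((2 * Real.pi) • ξ) : ℂ))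

/-- The `L^p(ℝ^d)` norm of a tempered distribution: the norm of the `L^p` function that represents
it, and `∞` if there is none. -/
def distLpNorm {d : ℕ} (p : ℝ≥0∞) [Fact (1 ≤ p)] (T : 𝓢'(Eu d, ℂ)) : ℝ≥0∞ :=
  ⨅ (g : Lp ℂ p (volume : Measure (Eu d))) (_ : Lp.toTemperedDistribution g = T), ‖g‖ₑ

/-- The norm of `M_{p,q}^{[j]}`: the `ℓ^q(ℤ^d)` norm (counting measure) of `k ↦ ‖□_{j,k} T‖_p`. -/
def modNorm {d : ℕ} (χ : Eu d → ℝ) (p q : ℝ≥0∞) [Fact (1 ≤ p)] (j : ℤ) (T : 𝓢'(Eu d, ℂ)) : ℝ≥0∞ :=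
  eLpNorm (fun k : Fin d → ℤ => distLpNorm p (box χ j k T)) q Measure.count

/-- `T = ∑_{j ≤ 0} f_j` in the space of tempered distributions, where `F n` stands for `f_{-n}`. -/
def IsDecomposition {d : ℕ} (T : 𝓢'(Eu d, ℂ)) (F : ℕ → 𝓢'(Eu d, ℂ)) : Prop :=
  Tendsto (fun N : ℕ => ∑ n ∈ Finset.range N, F n) atTop (𝓝 T)

/-- `∑_{j ≤ 0} 2^{jμ} ‖f_j‖_{M_{p,q}^{[j]}}`, where `F n` stands for `f_{-n}`. -/
def cost {d : ℕ} (χ : Eu d → ℝ) (p q : ℝ≥0∞) [Fact (1 ≤ p)] (μ : ℝ)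
    (F : ℕ → 𝓢'(Eu d, ℂ)) : ℝ≥0∞ :=
  ∑' n : ℕ, ENNReal.ofReal ((2 : ℝ) ^ (-(n : ℝ) * μ)) * modNorm χ p q (-(n : ℤ)) (F n)

/-- The scaling limit `𝓜_{p,q}^μ` of modulation spaces, as a set of tempered distributions. -/
def scalingSpace {d : ℕ} (χ : Eu d → ℝ) (p q : ℝ≥0∞) [Fact (1 ≤ p)] (μ : ℝ) :
    Set 𝓢'(Eu d, ℂ) :=
  {T | ∃ F : ℕ → 𝓢'(Eu d, ℂ), IsDecomposition T F ∧ cost χ p q μ F < ⊤}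

/-- The norm of `𝓜_{p,q}^μ`. -/
def scalingNorm {d : ℕ} (χ : Eu d → ℝ) (p q : ℝ≥0∞) [Fact (1 ≤ p)] (μ : ℝ)
    (T : 𝓢'(Eu d, ℂ)) : ℝ≥0∞ :=
  ⨅ (F : ℕ → 𝓢'(Eu d, ℂ)) (_ : IsDecomposition T F), cost χ p q μ F

/-- `𝓜_{p,q}^μ ↪ L^r`: every element of `𝓜_{p,q}^μ` is (given by) a function in `L^r`, and this
inclusion is bounded. -/
def EmbedsInLp {d : ℕ} (χ : Eu d → ℝ) (p q : ℝ≥0∞) [Fact (1 ≤ p)] (μ : ℝ)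
    (r : ℝ≥0∞) [Fact (1 ≤ r)] : Prop :=
  ∃ C : ℝ≥0, ∀ T ∈ scalingSpace χ p q μ,
    distLpNorm r T < ⊤ ∧ distLpNorm r T ≤ C * scalingNorm χ p q μ T

/-- `a(p,q) = d(1/p + 1/q - 1)`. -/
def aExp (d : ℕ) (p q : ℝ≥0∞) : ℝ := d * (p⁻¹.toReal + q⁻¹.toReal - 1)

/-- `σ(p,q) = 0 ∧ d(1/q - 1/p) ∧ a(p,q)`. -/
def sigmaExp (d : ℕ) (p q : ℝ≥0∞) : ℝ := min (min 0 (d * (q⁻¹.toReal - p⁻¹.toReal))) (aExp d p q)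

end ScalingModulation

end

/-! Sufficiency is proved level by level. A dilation reduces level `j` to level `0` at the price of
the factor `2^{j(d/p - d/r)}`. Since `j ≤ 0` and `μ ≤ d/p - d/r`, this factor is at most `2^{jμ}`,
so a decomposition of finite cost converges absolutely in `L^r`.

At unit scale each piece `g_k = □_k f` is reproduced by convolution with `e^{2πi c_k·x} K(x)`, where
`K` is a fixed Schwartz function of compact spectrum. Multiplying by `K(x - y)` localizes near `y`.
The localized pieces still have spectrum in a fixed ball around `c_k`, so they are almost orthogonal
in `L²`, and they are bounded pointwise by an average of `|g_k|` around `y` (`weightConv`). Put `s =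
min(r, r')`. Then the `L^r` norm near `y` is controlled by the `ℓ^s` norm of these averages: for `r
≤ 2` by Hölder and `ℓ^r ⊂ ℓ²` (`exists_local_le_of_le_two`), for `r > 2` by interpolation between
`ℓ² → L²` and `ℓ¹ → L^∞` (`exists_local_le_of_two_lt`). The hypothesis `q ≤ r ≤ q'` says exactly
that `q ≤ s`. Integrating in `y`, Minkowski's inequality and Young's inequality, which needs `p ≤
r`, give `exists_eLpNorm_sum_modConv_le`.

Necessity is tested on wave packets whose spectrum lies where one cutoff equals one, so that their
modulation norm is a mere count. One packet stretched at level `0` forces `p ≤ r`. One packet at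
level `-n` forces `μ - d/p ≤ -d/r`. Many modulated packets piled up at one point force `r ≤ q'`, and
the same packets moved far apart force `q ≤ r`.

The final claim is the case `p = r = 2`, `q = 1`, where the scaling inequality reads `μ ≤ 0`. -/

noncomputable section

set_option linter.unusedSectionVars false

namespace ScalingModulation

/-! ### Density of test functions with compact spectrum. -/

section

section Truncation

variable {E : Type*} [NormedAddCommGroup E] [InnerProductSpace ℝ E] [FiniteDimensional ℝ E]

/-- The function `x ↦ η (x / N)` for the standard bump function `η`. -/
def dilatedBump (E : Type*) [NormedAddCommGroup E] [InnerProductSpace ℝ E] [FiniteDimensional ℝ E]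
    (n : ℕ) (x : E) : ℝ :=
  (⟨1, 2, one_pos, one_lt_two⟩ : ContDiffBump (0 : E)) (((n : ℝ) + 1)⁻¹ • x)

lemma dilatedBump_contDiff (n : ℕ) : ContDiff ℝ ∞ (dilatedBump E n) :=
  (ContDiffBump.contDiff _).comp (contDiff_const_smul _)

lemma dilatedBump_hasCompactSupport (n : ℕ) : HasCompactSupport (dilatedBump E n) := by
  have h := (ContDiffBump.hasCompactSupport (⟨1, 2, one_pos, one_lt_two⟩ : ContDiffBump (0 : E)))
  have := h.comp_homeomorph (Homeomorph.smulOfNeZero (((n : ℝ) + 1)⁻¹) (by positivity))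
  exact this

lemma dilatedBump_eq_one {n : ℕ} {x : E} (hx : ‖x‖ ≤ n + 1) : dilatedBump E n x = 1 := by
  apply ContDiffBump.one_of_mem_closedBall
  rw [mem_closedBall_zero_iff, norm_smul, norm_inv, Real.norm_of_nonneg (by positivity)]
  rw [inv_mul_le_iff₀ (by positivity)]
  simpa using hx

/-- The bound is uniform in `n` because the dilation factor `1/(n+1)` is at most one and each
derivative brings out one such factor. -/
lemma norm_iteratedFDeriv_one_sub_dilatedBump_le (i : ℕ) :
    ∃ B : ℝ, 0 ≤ B ∧ ∀ (n : ℕ) (x : E),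
      ‖iteratedFDeriv ℝ i (fun x => 1 - dilatedBump E n x) x‖ ≤ B := by
  set η : ContDiffBump (0 : E) := ⟨1, 2, one_pos, one_lt_two⟩
  have hη : ContDiff ℝ ∞ (η : E → ℝ) := η.contDiff
  set S : 𝓢(E, ℝ) := η.hasCompactSupport.toSchwartzMap hη
  refine ⟨1 + SchwartzMap.seminorm ℝ 0 i S, by positivity, fun n x => ?_⟩
  have h1 : (fun x : E => 1 - dilatedBump E n x) =
      (fun y : E => 1 - η y) ∘ ((((n : ℝ) + 1)⁻¹ • ContinuousLinearMap.id ℝ E : E →L[ℝ] E)) := by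
    ext x; rfl
  have hc : ContDiff ℝ ∞ (fun y : E => 1 - η y) := contDiff_const.sub hη
  rw [h1, ContinuousLinearMap.iteratedFDeriv_comp_right _ hc _ (by exact_mod_cast le_top)]
  refine (ContinuousMultilinearMap.norm_compContinuousLinearMap_le _ _).trans ?_
  have h2 : ‖(((n : ℝ) + 1)⁻¹ • ContinuousLinearMap.id ℝ E : E →L[ℝ] E)‖ ≤ 1 := by
    rw [norm_smul, norm_inv, Real.norm_of_nonneg (by positivity)]
    exact mul_le_one₀ (inv_le_one_of_one_le₀ (by linarith [Nat.cast_nonneg (α := ℝ) n]))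
      (norm_nonneg _) ContinuousLinearMap.norm_id_le
  have h3 : ∀ y : E, ‖iteratedFDeriv ℝ i (fun y : E => 1 - η y) y‖ ≤
      1 + SchwartzMap.seminorm ℝ 0 i S := by
    intro y
    have : (fun y : E => 1 - η y) =
        (fun _ : E => (1 : ℝ)) - (S : E → ℝ) := rfl
    rw [this, iteratedFDeriv_sub_apply (contDiff_const.contDiffAt) (S.smooth i).contDiffAt]
    refine (norm_sub_le _ _).trans (add_le_add ?_ (S.norm_iteratedFDeriv_le_seminorm ℝ i y))
    rcases eq_or_ne i 0 with rfl | hi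
    · simp
    · simp [iteratedFDeriv_const_of_ne hi]
  calc _ ≤ (1 + SchwartzMap.seminorm ℝ 0 i S) * 1 := by
        gcongr
        · exact h3 _
        · exact Finset.prod_le_one (fun _ _ => norm_nonneg _) (fun _ _ => h2)
    _ = _ := mul_one _

/-- The truncation of a Schwartz function by a dilated bump function. -/
def truncate (f : 𝓢(E, ℂ)) (n : ℕ) : 𝓢(E, ℂ) :=
  SchwartzMap.smulLeftCLM ℂ (dilatedBump E n) f

lemma truncate_apply (f : 𝓢(E, ℂ)) (n : ℕ) (x : E) :
    truncate f n x = dilatedBump E n x • f x :=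
  SchwartzMap.smulLeftCLM_apply_apply
    ((dilatedBump_hasCompactSupport n).hasTemperateGrowth (dilatedBump_contDiff n)) f x

lemma truncate_hasCompactSupport (f : 𝓢(E, ℂ)) (n : ℕ) : HasCompactSupport (truncate f n) := by
  have : (truncate f n : E → ℂ) = dilatedBump E n • (f : E → ℂ) := by
    ext x; exact truncate_apply f n x
  rw [this]
  exact (dilatedBump_hasCompactSupport n).smul_right

/-- The error lives where `‖x‖ ≥ n + 1`. There one extra power of `‖x‖`, paid for by the seminorm of
order `k + 1`, gains the factor `1/(n+1)`; Leibniz' rule does the rest. -/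
lemma tendsto_truncate (f : 𝓢(E, ℂ)) : Tendsto (truncate f) atTop (𝓝 f) := by
  rw [(schwartz_withSeminorms ℝ E ℂ).tendsto_nhds]
  rintro ⟨k, m⟩ ε hε
  choose B hB0 hB using fun i => norm_iteratedFDeriv_one_sub_dilatedBump_le (E := E) i
  set C : ℝ := ∑ i ∈ Finset.range (m + 1),
    (m.choose i : ℝ) * B i * SchwartzMap.seminorm ℝ (k + 1) (m - i) f
  have hC : 0 ≤ C := Finset.sum_nonneg fun i _ =>
    mul_nonneg (mul_nonneg (by positivity) (hB0 i)) (apply_nonneg _ _)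
  have key : ∀ n : ℕ, SchwartzMap.seminorm ℝ k m (truncate f n - f) ≤ C / (n + 1) := by
    intro n
    refine SchwartzMap.seminorm_le_bound ℝ k m _ (by positivity) fun x => ?_
    have hfun : ((truncate f n - f : 𝓢(E, ℂ)) : E → ℂ) =
        -fun x => (1 - dilatedBump E n x) • f x := by
      ext x
      simp [truncate_apply, sub_mul]
    rw [hfun, iteratedFDeriv_neg_apply, norm_neg]
    rcases lt_or_ge ‖x‖ (n + 1) with hx | hx
    · have : (fun x => (1 - dilatedBump E n x) • f x) =ᶠ[𝓝 x] fun _ => (0 : ℂ) := by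
        filter_upwards [(isOpen_lt continuous_norm continuous_const).mem_nhds hx] with y hy
        rw [dilatedBump_eq_one (le_of_lt hy)]; simp
      rw [(EventuallyEq.iteratedFDeriv ℝ this m).eq_of_nhds]
      simp only [iteratedFDeriv_fun_zero, Pi.zero_apply, norm_zero, mul_zero]
      positivity
    · have h1 := norm_iteratedFDeriv_smul_le (𝕜 := ℝ) (N := ∞)
        ((contDiff_const (c := (1 : ℝ))).sub (dilatedBump_contDiff (E := E) n)) (f.smooth ⊤) x
        (n := m) (by exact_mod_cast le_top)
      calc _ ≤ ‖x‖ ^ k * _ := mul_le_mul_of_nonneg_left h1 (by positivity)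
        _ ≤ C / (n + 1) := by
          rw [Finset.mul_sum, Finset.sum_div]
          refine Finset.sum_le_sum fun i _ => ?_
          have h2 := f.le_seminorm ℝ (k + 1) (m - i) x
          have h3 : ‖x‖ ^ k * ‖iteratedFDeriv ℝ (m - i) f x‖ ≤
              SchwartzMap.seminorm ℝ (k + 1) (m - i) f / (n + 1) := by
            rw [le_div_iff₀ (by positivity)]
            refine le_trans ?_ h2
            rw [pow_succ]
            have : 0 ≤ ‖x‖ ^ k * ‖iteratedFDeriv ℝ (m - i) f x‖ := by positivity
            nlinarith
          calc _ = (m.choose i : ℝ) * ‖iteratedFDeriv ℝ i (fun x => 1 - dilatedBump E n x) x‖ *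
                (‖x‖ ^ k * ‖iteratedFDeriv ℝ (m - i) f x‖) := by ring
            _ ≤ (m.choose i : ℝ) * B i *
                (SchwartzMap.seminorm ℝ (k + 1) (m - i) f / (n + 1)) := by
              have := hB0 i
              gcongr
              exact hB i n x
            _ = _ := by ring
  have hlim : Tendsto (fun n : ℕ => C / ((n : ℝ) + 1)) atTop (𝓝 0) :=
    tendsto_const_div_atTop_nhds_zero_nat C |>.comp (tendsto_add_atTop_nat 1) |>.congr
      (by intro n; simp)
  filter_upwards [hlim.eventually_lt_const hε] with n hn
  exact (key n).trans_lt hn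

end Truncation

section Determination

variable {E : Type*} [NormedAddCommGroup E] [InnerProductSpace ℝ E] [FiniteDimensional ℝ E]
  [MeasurableSpace E] [BorelSpace E]

/-- A tempered distribution is determined by its values on the test functions whose inverse Fourier
transform has compact support. -/
lemma eq_of_forall_hasCompactSupport {T S : 𝓢'(E, ℂ)}
    (h : ∀ ψ : 𝓢(E, ℂ), HasCompactSupport (𝓕⁻ ψ : 𝓢(E, ℂ)) → T ψ = S ψ) : T = S := by
  ext ψ
  -- The truncation takes place on the Fourier side; continuity of `𝓕` on Schwartz space carries the
  -- convergence over.
  have hlim : Tendsto (fun n => 𝓕 (truncate (𝓕⁻ ψ) n)) atTop (𝓝 ψ) := by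
    have := ((FourierTransform.fourierCLM ℂ 𝓢(E, ℂ)).continuous.tendsto _).comp
      (tendsto_truncate (𝓕⁻ ψ))
    simpa [Function.comp_def] using this
  have hT := (T.continuous.tendsto ψ).comp hlim
  have hS := (S.continuous.tendsto ψ).comp hlim
  refine tendsto_nhds_unique (hT.congr fun n => ?_) hS
  apply h
  simpa using truncate_hasCompactSupport (𝓕⁻ ψ) n

end Determination

end

/-! ### Inequalities for sums and a Marcinkiewicz argument. -/

section

section Inequalities

lemma sum_rpow_le_rpow_sum {ι : Type*} (A : Finset ι) (c : ι → ℝ≥0∞) {s : ℝ} (hs : 1 ≤ s) :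
    ∑ k ∈ A, c k ^ s ≤ (∑ k ∈ A, c k) ^ s := by
  have key : ∀ x : ℝ≥0∞, x ^ s = x * x ^ (s - 1) := fun x => by
    have h := ENNReal.rpow_add_of_nonneg (x := x) 1 (s - 1) zero_le_one (by linarith)
    rwa [ENNReal.rpow_one, add_sub_cancel] at h
  calc ∑ k ∈ A, c k ^ s ≤ ∑ k ∈ A, c k * (∑ k ∈ A, c k) ^ (s - 1) := by
        refine Finset.sum_le_sum fun k hk => ?_
        rw [key (c k)]
        gcongr
        exact Finset.single_le_sum (f := c) (fun _ _ => zero_le) hk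
    _ = _ := by rw [← Finset.sum_mul, ← key]

lemma sum_rpow_rpow_le {ι : Type*} (A : Finset ι) (c : ι → ℝ≥0∞) {p q : ℝ} (hp : 0 < p)
    (hpq : p ≤ q) : (∑ k ∈ A, c k ^ q) ^ (1 / q) ≤ (∑ k ∈ A, c k ^ p) ^ (1 / p) := by
  have hq : 0 < q := hp.trans_le hpq
  have h := sum_rpow_le_rpow_sum A (fun k => c k ^ p) (s := q / p) (by rwa [one_le_div hp])
  simp_rw [← ENNReal.rpow_mul, mul_div_cancel₀ q hp.ne'] at h
  calc _ ≤ ((∑ k ∈ A, c k ^ p) ^ (q / p)) ^ (1 / q) := by gcongr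
    _ = _ := by rw [← ENNReal.rpow_mul]; congr 1; field_simp

lemma lintegral_Lp_finset_sum_le {X ι : Type*} [MeasurableSpace X] {μ : Measure X}
    (A : Finset ι) {f : ι → X → ℝ≥0∞} (hf : ∀ k, AEMeasurable (f k) μ) {p : ℝ} (hp : 1 ≤ p) :
    (∫⁻ x, (∑ k ∈ A, f k x) ^ p ∂μ) ^ (1 / p) ≤ ∑ k ∈ A, (∫⁻ x, f k x ^ p ∂μ) ^ (1 / p) := by
  classical
  induction A using Finset.induction_on with
  | empty =>
    have : 0 < p := by linarith
    simp [ENNReal.zero_rpow_of_pos, this]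
  | insert a s ha ih =>
    simp_rw [Finset.sum_insert ha]
    have := ENNReal.lintegral_Lp_add_le (hf a) (Finset.aemeasurable_fun_sum s fun k _ => hf k) hp
    simp only [Pi.add_apply] at this
    exact this.trans (by gcongr)

end Inequalities

section WeakType

variable {X ι : Type*} [MeasurableSpace X] {μ : Measure X}

/-- The contribution of one index to the layer-cake integral. The truncation restricts `t` to `(0,
τ]` with `τ = 2B b^{1-q}`, the condition `r > 2` makes `t^{r-3}` integrable at `0`, and the powers
of `b` combine through `2 + (1-q)(r-2) = q`. -/
lemma lintegral_truncated_rpow_le {b B r q : ℝ} (hb : 0 ≤ b) (hB : 0 < B) (hr : 2 < r)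
    (hrq : r.HolderConjugate q) :
    ∫⁻ t in Set.Ioi (0 : ℝ), {t : ℝ | t * b ^ (q - 1) ≤ 2 * B}.indicator
      (fun t => ENNReal.ofReal (b ^ 2) * ENNReal.ofReal (t ^ (r - 3))) t ≤
      ENNReal.ofReal ((2 * B) ^ (r - 2) / (r - 2) * b ^ q) := by
  rcases hb.eq_or_lt with rfl | hb
  · simp
  set τ : ℝ := 2 * B * b ^ (1 - q)
  have hτ : 0 ≤ τ := by positivity
  have hset : ∀ t : ℝ, t * b ^ (q - 1) ≤ 2 * B ↔ t ≤ τ := by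
    intro t
    have h1 : b ^ (1 - q) = (b ^ (q - 1))⁻¹ := by rw [← Real.rpow_neg hb.le]; ring_nf
    simp only [τ, h1]
    rw [← div_eq_mul_inv, le_div_iff₀ (by positivity)]
  have hmeas : MeasurableSet {t : ℝ | t * b ^ (q - 1) ≤ 2 * B} :=
    measurableSet_le (by fun_prop) measurable_const
  have hval : ∫ t in (0 : ℝ)..τ, t ^ (r - 3) = τ ^ (r - 2) / (r - 2) := by
    rw [integral_rpow (Or.inl (by linarith)), Real.zero_rpow (by linarith)]
    ring_nf
  have hint : IntegrableOn (fun t : ℝ => t ^ (r - 3)) (Set.Ioc 0 τ) :=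
    (intervalIntegrable_iff_integrableOn_Ioc_of_le hτ).1
      (intervalIntegral.intervalIntegrable_rpow' (by linarith))
  have hsets : {t : ℝ | t * b ^ (q - 1) ≤ 2 * B} ∩ Set.Ioi 0 = Set.Ioc 0 τ := by
    ext t
    simp only [Set.mem_inter_iff, Set.mem_ofPred_eq, Set.mem_Ioi, Set.mem_Ioc, hset, and_comm]
  rw [lintegral_indicator hmeas, Measure.restrict_restrict hmeas, hsets,
    lintegral_const_mul' _ _ ENNReal.ofReal_ne_top,
    ← ofReal_integral_eq_lintegral_ofReal hint, ← intervalIntegral.integral_of_le hτ, hval,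
    ← ENNReal.ofReal_mul (by positivity)]
  · apply ENNReal.ofReal_le_ofReal
    have h2 : b ^ (2 : ℕ) * b ^ ((1 - q) * (r - 2)) = b ^ q := by
      rw [← Real.rpow_natCast, ← Real.rpow_add hb]
      congr 1
      have := hrq.sub_one_mul_conj
      push_cast
      nlinarith [hrq.sub_one_mul_conj, hrq.mul_eq_add]
    simp only [τ]
    rw [Real.mul_rpow (by positivity) (by positivity), ← Real.rpow_mul hb.le, ← h2]
    apply le_of_eq
    ring
  · filter_upwards [ae_restrict_mem measurableSet_Ioc] with t ht
    exact Real.rpow_nonneg ht.1.le _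

/-- A discrete form of the Marcinkiewicz interpolation between `ℓ¹ → L^∞` and `ℓ² → L²`. -/
lemma lintegral_rpow_sum_le {A : Finset ι} {v : ι → X → ℂ}
    (hv : ∀ k, AEMeasurable (v k) μ) {b : ι → ℝ} (hb : ∀ k, 0 ≤ b k)
    (hvb : ∀ k ∈ A, ∀ x, ‖v k x‖ ≤ b k) {C : ℝ≥0∞}
    (hL2 : ∀ S ⊆ A, ∫⁻ x, ‖∑ k ∈ S, v k x‖ₑ ^ 2 ∂μ ≤ C * ∑ k ∈ S, ENNReal.ofReal (b k ^ 2))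
    {r q : ℝ} (hr : 2 < r) (hrq : r.HolderConjugate q) :
    ∫⁻ x, ‖∑ k ∈ A, v k x‖ₑ ^ r ∂μ ≤
      ENNReal.ofReal (4 * r * 2 ^ (r - 2) / (r - 2)) * C *
        ENNReal.ofReal ((∑ k ∈ A, b k ^ q) ^ (r - 1)) := by
  classical
  set B : ℝ := ∑ k ∈ A, b k ^ q with hBdef
  have hbq : ∀ k, 0 ≤ b k ^ q := fun k => Real.rpow_nonneg (hb k) q
  have hB0 : 0 ≤ B := Finset.sum_nonneg fun k _ => hbq k
  have hq : 0 < q := hrq.symm.pos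
  rcases hB0.eq_or_lt with hB | hB
  · have hz : ∀ k ∈ A, b k = 0 := by
      intro k hk
      have := (Finset.sum_eq_zero_iff_of_nonneg (fun k _ => hbq k)).1 hB.symm k hk
      exact ((Real.rpow_eq_zero_iff_of_nonneg (hb k)).1 this).1
    have : ∀ x, ∑ k ∈ A, v k x = 0 := fun x => Finset.sum_eq_zero fun k hk =>
      norm_le_zero_iff.1 ((hvb k hk x).trans (hz k hk).le)
    simp [this, show 0 < r by linarith]
  have hV : AEMeasurable (fun x => ‖∑ k ∈ A, v k x‖) μ :=
    (Finset.aemeasurable_fun_sum A fun k _ => hv k).norm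
  have hstart : ∫⁻ x, ‖∑ k ∈ A, v k x‖ₑ ^ r ∂μ =
      ∫⁻ x, ENNReal.ofReal (‖∑ k ∈ A, v k x‖ ^ r) ∂μ := by
    refine lintegral_congr fun x => ?_
    rw [← ofReal_norm, ENNReal.ofReal_rpow_of_nonneg (norm_nonneg _) (by linarith)]
  rw [hstart, lintegral_rpow_eq_lintegral_meas_lt_mul μ (ae_of_all _ fun x => norm_nonneg _) hV
    (by linarith)]
  set F : ι → ℝ → ℝ≥0∞ := fun k => {t : ℝ | t * b k ^ (q - 1) ≤ 2 * B}.indicator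
      (fun t => ENNReal.ofReal (b k ^ 2) * ENNReal.ofReal (t ^ (r - 3))) with hF
  have hFm : ∀ k, Measurable (F k) := fun k =>
    Measurable.indicator (by fun_prop) (measurableSet_le (by fun_prop) measurable_const)
  have hpt : ∀ t : ℝ, 0 < t → μ {x | t < ‖∑ k ∈ A, v k x‖} * ENNReal.ofReal (t ^ (r - 1)) ≤
      4 * C * ∑ k ∈ A, F k t := by
    intro t ht
    -- At height `t`, the indices with small `b k` go to the `L²` bound. The others satisfy `2B b_k
    -- < t b_k^q`, so they sum to at most `t/2` uniformly and cannot account for the level set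
    -- alone.
    set S := A.filter fun k => t * b k ^ (q - 1) ≤ 2 * B with hS
    have hrest : ∑ k ∈ A.filter (fun k => ¬ t * b k ^ (q - 1) ≤ 2 * B), b k ≤ t / 2 := by
      have h1 : 2 * B * ∑ k ∈ A.filter (fun k => ¬ t * b k ^ (q - 1) ≤ 2 * B), b k ≤ t * B := by
        have htB : t * B = ∑ k ∈ A, t * b k ^ q := by rw [hBdef, Finset.mul_sum]
        rw [Finset.mul_sum, htB]
        refine (Finset.sum_le_sum fun k hk => ?_).trans
          (Finset.sum_le_sum_of_subset_of_nonneg (Finset.filter_subset _ A)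
            fun k _ _ => mul_nonneg ht.le (hbq k))
        have h2 := (Finset.mem_filter.1 hk).2
        have h3 : b k ^ q = b k ^ (q - 1) * b k := by
          rcases (hb k).eq_or_lt with h0 | h0
          · rw [← h0, mul_zero, Real.zero_rpow hq.ne']
          · rw [← Real.rpow_add_one h0.ne']; ring_nf
        rw [h3, ← mul_assoc]
        exact mul_le_mul_of_nonneg_right (not_le.1 h2).le (hb k)
      by_contra hcon
      rw [not_le] at hcon
      nlinarith
    have hsub : {x | t < ‖∑ k ∈ A, v k x‖} ⊆
        {x | ENNReal.ofReal (t ^ 2 / 4) ≤ ‖∑ k ∈ S, v k x‖ₑ ^ 2} := by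
      intro x hx
      simp only [Set.mem_ofPred_eq] at hx ⊢
      have h1 : ‖∑ k ∈ A, v k x‖ ≤ ‖∑ k ∈ S, v k x‖ + t / 2 := by
        rw [← Finset.sum_filter_add_sum_filter_not A (fun k => t * b k ^ (q - 1) ≤ 2 * B)]
        refine (norm_add_le _ _).trans (add_le_add le_rfl ?_)
        exact (norm_sum_le_of_le _ fun k hk => hvb k (Finset.mem_filter.1 hk).1 x).trans hrest
      have h2 : t / 2 ≤ ‖∑ k ∈ S, v k x‖ := by linarith
      rw [← ofReal_norm, ← ENNReal.ofReal_pow (norm_nonneg _)]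
      apply ENNReal.ofReal_le_ofReal
      nlinarith
    have hSm : AEMeasurable (fun x => ‖∑ k ∈ S, v k x‖ₑ ^ 2) μ :=
      ((Finset.aemeasurable_fun_sum S fun k _ => hv k).enorm).pow_const 2
    -- Chebyshev in `L²` at height `t/2`. The quotient `t^{r-1} / (t²/4) = 4 t^{r-3}` is the power
    -- in `F`.
    have hmeas := (measure_mono hsub).trans (meas_ge_le_lintegral_div hSm
      (ENNReal.ofReal_pos.2 (by positivity : 0 < t ^ 2 / 4)).ne' ENNReal.ofReal_ne_top)
    have hsumF : ∑ k ∈ A, F k t =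
        (∑ k ∈ S, ENNReal.ofReal (b k ^ 2)) * ENNReal.ofReal (t ^ (r - 3)) := by
      rw [hS, Finset.sum_filter, Finset.sum_mul]
      refine Finset.sum_congr rfl fun k _ => ?_
      simp only [F, Set.indicator_apply, Set.mem_ofPred_eq]
      split_ifs <;> simp
    calc _ ≤ (C * ∑ k ∈ S, ENNReal.ofReal (b k ^ 2)) / ENNReal.ofReal (t ^ 2 / 4) *
          ENNReal.ofReal (t ^ (r - 1)) := by
          gcongr
          exact hmeas.trans (by gcongr; exact hL2 S (Finset.filter_subset _ A))
      _ = C * (∑ k ∈ S, ENNReal.ofReal (b k ^ 2)) *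
          (ENNReal.ofReal (t ^ (r - 1)) / ENNReal.ofReal (t ^ 2 / 4)) := by
          rw [← mul_div_assoc]; exact ENNReal.mul_div_right_comm.symm
      _ = C * (∑ k ∈ S, ENNReal.ofReal (b k ^ 2)) * (4 * ENNReal.ofReal (t ^ (r - 3))) := by
          congr 1
          rw [← ENNReal.ofReal_div_of_pos (by positivity),
            show (4 : ℝ≥0∞) = ENNReal.ofReal 4 by simp, ← ENNReal.ofReal_mul (by norm_num)]
          congr 1
          rw [show r - 1 = (r - 3) + (2 : ℕ) by push_cast; ring, Real.rpow_add_natCast ht.ne']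
          field_simp
      _ = _ := by rw [hsumF]; ring
  have hint : ∫⁻ t in Set.Ioi (0 : ℝ), μ {x | t < ‖∑ k ∈ A, v k x‖} * ENNReal.ofReal (t ^ (r - 1)) ≤
      4 * C * ∑ k ∈ A, ENNReal.ofReal ((2 * B) ^ (r - 2) / (r - 2) * b k ^ q) := by
    calc _ ≤ ∫⁻ t in Set.Ioi (0 : ℝ), 4 * C * ∑ k ∈ A, F k t :=
          setLIntegral_mono' measurableSet_Ioi fun t ht => hpt t ht
      _ = 4 * C * ∑ k ∈ A, ∫⁻ t in Set.Ioi (0 : ℝ), F k t := by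
          rw [lintegral_const_mul _ (Finset.measurable_fun_sum A fun k _ => hFm k),
            lintegral_finsetSum _ fun k _ => hFm k]
      _ ≤ _ := by
          gcongr with k hk
          exact lintegral_truncated_rpow_le (hb k) hB hr hrq
  refine (mul_le_mul_right hint _).trans (le_of_eq ?_)
  have hr2 : 0 < r - 2 := by linarith
  rw [← ENNReal.ofReal_sum_of_nonneg fun k _ => mul_nonneg (by positivity) (hbq k),
    ← Finset.mul_sum, ← hBdef]
  have e1 : 4 * r * 2 ^ (r - 2) / (r - 2) * B ^ (r - 1) =
      r * 4 * ((2 * B) ^ (r - 2) / (r - 2) * B) := by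
    rw [Real.mul_rpow two_pos.le hB0, show r - 1 = (r - 2) + 1 by ring, Real.rpow_add_one hB.ne']
    ring
  calc _ = C * ENNReal.ofReal (r * 4 * ((2 * B) ^ (r - 2) / (r - 2) * B)) := by
        rw [mul_assoc r, ENNReal.ofReal_mul (p := r) (by linarith),
          ENNReal.ofReal_mul (p := 4) (by norm_num), show ENNReal.ofReal 4 = 4 by simp]
        ring
    _ = _ := by
        rw [← e1, ENNReal.ofReal_mul (div_nonneg (by positivity) hr2.le)]
        ring

end WeakType

end

/-! ### Polynomial weights, functions of compact spectrum, almost orthogonality. -/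

section

section Weight

variable {E : Type*} [NormedAddCommGroup E] [NormedSpace ℝ E] [FiniteDimensional ℝ E]

/-- The weight `(1 + |x|) ^ (-(n + 1))`, where `n` is the dimension. -/
def weight (x : E) : ℝ := (1 + ‖x‖) ^ (-((Module.finrank ℝ E : ℝ) + 1))

lemma weight_pos (x : E) : 0 < weight x := by unfold weight; positivity

lemma weight_le_one (x : E) : weight x ≤ 1 :=
  Real.rpow_le_one_of_one_le_of_nonpos (by linarith [norm_nonneg x])
    (by linarith [Nat.cast_nonneg (α := ℝ) (Module.finrank ℝ E)])

lemma continuous_weight : Continuous (weight : E → ℝ) := by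
  unfold weight
  exact Continuous.rpow_const (by fun_prop) fun x => Or.inl (by positivity)

/-- This is `1 + ‖y - z‖ ≤ (1 + ‖x - y‖)(1 + ‖x - z‖)` raised to a negative power. -/
lemma weight_sub_mul_weight_sub_le (x y z : E) :
    weight (x - y) * weight (x - z) ≤ weight (y - z) := by
  unfold weight
  rw [← Real.mul_rpow (by positivity) (by positivity)]
  apply Real.rpow_le_rpow_of_nonpos (by positivity)
  · have : ‖y - z‖ ≤ ‖x - y‖ + ‖x - z‖ := by
      have := norm_sub_le (x - z) (x - y)
      rw [sub_sub_sub_cancel_left] at this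
      linarith
    nlinarith [norm_nonneg (x - y), norm_nonneg (x - z)]
  · linarith [Nat.cast_nonneg (α := ℝ) (Module.finrank ℝ E)]

lemma integrable_weight [MeasurableSpace E] [BorelSpace E] (μ : Measure E) [μ.IsAddHaarMeasure] :
    Integrable (weight : E → ℝ) μ :=
  integrable_one_add_norm (by linarith)

/-- The square is deliberate: one factor will be spent on moving the base point from `x` to `y`, the
other on integrability in `x`. -/
lemma exists_norm_le_weight_sq (f : 𝓢(E, ℂ)) : ∃ C : ℝ, 0 ≤ C ∧ ∀ x, ‖f x‖ ≤ C * weight x ^ 2 := by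
  set n := Module.finrank ℝ E
  set C : ℝ := 2 ^ (2 * (n + 1)) *
    ((Finset.Iic ((2 * (n + 1), 0) : ℕ × ℕ)).sup fun m => SchwartzMap.seminorm ℝ m.1 m.2) f
  refine ⟨C, by positivity, fun x => ?_⟩
  have h := SchwartzMap.one_add_le_sup_seminorm_apply (𝕜 := ℝ) (m := (2 * (n + 1), 0))
    (k := 2 * (n + 1)) (n := 0) le_rfl le_rfl f x
  rw [norm_iteratedFDeriv_zero] at h
  have hw : weight x ^ 2 = ((1 + ‖x‖) ^ (2 * (n + 1)))⁻¹ := by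
    unfold weight
    rw [Real.rpow_neg (by positivity), inv_pow, ← Real.rpow_natCast, ← Real.rpow_mul (by positivity),
      ← Real.rpow_natCast]
    congr 2
    push_cast
    ring
  rw [hw, ← div_eq_mul_inv, le_div_iff₀ (by positivity), mul_comm]
  exact h

end Weight

section BandLimited

variable {E : Type*} [NormedAddCommGroup E] [InnerProductSpace ℝ E] [FiniteDimensional ℝ E]
  [MeasurableSpace E] [BorelSpace E]

/-- The inverse Fourier transform of `f` vanishes outside the ball of radius `R`. -/
def BandLimited (R : ℝ) (f : 𝓢(E, ℂ)) : Prop := ∀ ξ, R ≤ ‖ξ‖ → (𝓕⁻ f : 𝓢(E, ℂ)) ξ = 0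

/-- The product of two Schwartz functions. -/
def schwartzMul (f g : 𝓢(E, ℂ)) : 𝓢(E, ℂ) := SchwartzMap.pairing (ContinuousLinearMap.mul ℂ ℂ) f g

@[simp] lemma schwartzMul_apply (f g : 𝓢(E, ℂ)) (x : E) : schwartzMul f g x = f x * g x := rfl

/-- The complex conjugate of a Schwartz function. -/
def schwartzConj (f : 𝓢(E, ℂ)) : 𝓢(E, ℂ) :=
  SchwartzMap.postcompCLM (𝕜 := ℝ) (Complex.conjCLE : ℂ →L[ℝ] ℂ) f

@[simp] lemma schwartzConj_apply (f : 𝓢(E, ℂ)) (x : E) :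
    schwartzConj f x = (starRingEnd ℂ) (f x) := rfl

/-- The transform of a product is a convolution, so the radii of the spectra add. -/
lemma BandLimited.mul {R S : ℝ} {f g : 𝓢(E, ℂ)} (hf : BandLimited R f) (hg : BandLimited S g) :
    BandLimited (R + S) (schwartzMul f g) := by
  intro ξ hξ
  have h1 : (𝓕⁻ (schwartzMul f g) : 𝓢(E, ℂ)) =
      SchwartzMap.convolution (ContinuousLinearMap.mul ℂ ℂ) (𝓕⁻ f) (𝓕⁻ g) := by
    simp [SchwartzMap.convolution, schwartzMul]
  rw [h1, SchwartzMap.convolution_apply, convolution_def]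
  refine integral_eq_zero_of_ae (ae_of_all _ fun t => ?_)
  rcases le_or_gt R ‖t‖ with ht | ht
  · simp [hf t ht]
  · have : S ≤ ‖ξ - t‖ := by linarith [norm_sub_norm_le ξ t]
    simp [hg _ this]

lemma BandLimited.translate {R : ℝ} {f : 𝓢(E, ℂ)} (hf : BandLimited R f) (a : E) :
    BandLimited R (SchwartzMap.compSubConstCLM ℂ a f) := by
  intro ξ hξ
  have h := hf ξ hξ
  rw [SchwartzMap.fourierInv_coe, Real.fourierInv_eq] at h ⊢
  rw [← integral_add_right_eq_self _ a]
  have : ∀ v : E, Real.fourierChar (inner ℝ (v + a) ξ) •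
      (SchwartzMap.compSubConstCLM ℂ a f) (v + a) =
      Real.fourierChar (inner ℝ a ξ) • (Real.fourierChar (inner ℝ v ξ) • f v) := by
    intro v
    rw [SchwartzMap.compSubConstCLM_apply, add_sub_cancel_right, smul_smul, ← AddChar.map_add_eq_mul,
      inner_add_left, add_comm (inner ℝ a ξ)]
  simp_rw [this, Circle.smul_def, integral_smul] at h ⊢
  rw [h, smul_zero]

lemma BandLimited.conj {R : ℝ} {f : 𝓢(E, ℂ)} (hf : BandLimited R f) :
    BandLimited R (schwartzConj f) := by
  intro ξ hξ
  have h := hf (-ξ) (by rwa [norm_neg])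
  rw [SchwartzMap.fourierInv_coe, Real.fourierInv_eq] at h ⊢
  have : ∀ v : E, Real.fourierChar (inner ℝ v ξ) • schwartzConj f v =
      (starRingEnd ℂ) (Real.fourierChar (inner ℝ v (-ξ)) • f v) := by
    intro v
    rw [inner_neg_right, AddChar.map_neg_eq_inv, Circle.smul_def, Circle.smul_def, Circle.coe_inv_eq_conj,
      smul_eq_mul, smul_eq_mul, map_mul, Complex.conj_conj, schwartzConj_apply]
  simp_rw [this]
  rw [integral_conj, h, map_zero]

lemma BandLimited.integral_eq_zero {R : ℝ} {f : 𝓢(E, ℂ)} (hf : BandLimited R f) {c : E}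
    (hc : R ≤ ‖c‖) : ∫ x, Real.fourierChar (inner ℝ c x) • f x = 0 := by
  have h := hf c hc
  rw [SchwartzMap.fourierInv_coe, Real.fourierInv_eq] at h
  simpa only [real_inner_comm] using h

end BandLimited

section AlmostOrthogonal

/-- Expand the square. Only near pairs survive, each is at most `(‖v k‖² + ‖v l‖²)/2`, and every
index has at most `N` near ones. -/
lemma norm_sum_sq_le_of_almost_orthogonal {ι H : Type*} [NormedAddCommGroup H]
    [InnerProductSpace ℂ H] (S : Finset ι) (v : ι → H) (near : ι → ι → Prop)
    [DecidableRel near] (hsymm : ∀ k l, near k l → near l k) {N : ℕ}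
    (hN : ∀ k ∈ S, (S.filter (near k)).card ≤ N)
    (h : ∀ k ∈ S, ∀ l ∈ S, ¬ near k l → inner ℂ (v k) (v l) = 0) :
    ‖∑ k ∈ S, v k‖ ^ 2 ≤ N * ∑ k ∈ S, ‖v k‖ ^ 2 := by
  have h1 : ‖∑ k ∈ S, v k‖ ^ 2 ≤ ∑ k ∈ S, ∑ l ∈ S, ‖inner ℂ (v k) (v l)‖ := by
    rw [← inner_self_eq_norm_sq (𝕜 := ℂ)]
    refine (RCLike.re_le_norm _).trans ?_
    rw [sum_inner]
    simp_rw [inner_sum]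
    exact (norm_sum_le _ _).trans (Finset.sum_le_sum fun k _ => norm_sum_le _ _)
  have h2 : ∀ k ∈ S, ∀ l ∈ S, ‖inner ℂ (v k) (v l)‖ ≤
      (if near k l then ‖v k‖ ^ 2 / 2 else (0 : ℝ)) + (if near l k then ‖v l‖ ^ 2 / 2 else 0) := by
    intro k hk l hl
    by_cases hkl : near k l
    · rw [if_pos hkl, if_pos (hsymm k l hkl)]
      have := norm_inner_le_norm (𝕜 := ℂ) (v k) (v l)
      nlinarith [sq_nonneg (‖v k‖ - ‖v l‖)]
    · rw [h k hk l hl hkl, norm_zero]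
      positivity
  have h3 : ∑ k ∈ S, ∑ l ∈ S, (if near k l then ‖v k‖ ^ 2 / 2 else (0 : ℝ)) ≤
      (N : ℝ) * ∑ k ∈ S, ‖v k‖ ^ 2 / 2 := by
    rw [Finset.mul_sum]
    refine Finset.sum_le_sum fun k hk => ?_
    rw [← Finset.sum_filter, Finset.sum_const, nsmul_eq_mul]
    gcongr
    exact hN k hk
  calc _ ≤ _ := h1
    _ ≤ ∑ k ∈ S, ∑ l ∈ S, ((if near k l then ‖v k‖ ^ 2 / 2 else (0 : ℝ)) +
          (if near l k then ‖v l‖ ^ 2 / 2 else 0)) :=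
        Finset.sum_le_sum fun k hk => Finset.sum_le_sum fun l hl => h2 k hk l hl
    _ = ∑ k ∈ S, ∑ l ∈ S, (if near k l then ‖v k‖ ^ 2 / 2 else (0 : ℝ)) +
          ∑ l ∈ S, ∑ k ∈ S, (if near l k then ‖v l‖ ^ 2 / 2 else 0) := by
        simp_rw [Finset.sum_add_distrib]
        congr 1
        exact Finset.sum_comm
    _ ≤ (N : ℝ) * ∑ k ∈ S, ‖v k‖ ^ 2 / 2 + (N : ℝ) * ∑ k ∈ S, ‖v k‖ ^ 2 / 2 := add_le_add h3 h3
    _ = _ := by rw [← Finset.sum_div]; ring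

lemma lintegral_norm_sum_sq_le {ι X : Type*} [MeasurableSpace X] {μ : Measure X}
    (S : Finset ι) (v : ι → X → ℂ) (hv : ∀ k, MemLp (v k) 2 μ) (near : ι → ι → Prop)
    [DecidableRel near] (hsymm : ∀ k l, near k l → near l k) {N : ℕ}
    (hN : ∀ k ∈ S, (S.filter (near k)).card ≤ N)
    (h : ∀ k ∈ S, ∀ l ∈ S, ¬ near k l → ∫ x, v k x * (starRingEnd ℂ) (v l x) ∂μ = 0) :
    ∫⁻ x, ‖∑ k ∈ S, v k x‖ₑ ^ 2 ∂μ ≤ N * ∑ k ∈ S, ∫⁻ x, ‖v k x‖ₑ ^ 2 ∂μ := by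
  have hL : ∀ f : X → ℂ, ∀ hf : MemLp f 2 μ,
      ∫⁻ x, ‖f x‖ₑ ^ 2 ∂μ = ENNReal.ofReal (‖hf.toLp f‖ ^ 2) := by
    intro f hf
    rw [ENNReal.ofReal_pow (norm_nonneg _), ofReal_norm, Lp.enorm_toLp,
      eLpNorm_eq_lintegral_rpow_enorm_toReal (by norm_num) (by norm_num)]
    rw [← ENNReal.rpow_natCast, ← ENNReal.rpow_mul]
    simp
  have hsum : ∀ S : Finset ι, (memLp_finsetSum S fun k _ => hv k).toLp _ =
      ∑ k ∈ S, (hv k).toLp (v k) := by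
    classical
    intro S
    induction S using Finset.induction_on with
    | empty => exact MemLp.toLp_zero _
    | insert a s ha ih =>
      rw [Finset.sum_insert ha, ← ih, ← MemLp.toLp_add]
      exact MemLp.toLp_congr _ _ (ae_of_all _ fun x => Finset.sum_insert ha)
  have key := norm_sum_sq_le_of_almost_orthogonal S (fun k => (hv k).toLp (v k)) near hsymm hN
    (by
      intro k hk l hl hkl
      rw [L2.inner_def, ← h l hl k hk fun h' => hkl (hsymm _ _ h')]
      refine integral_congr_ae ?_
      filter_upwards [(hv k).coeFn_toLp, (hv l).coeFn_toLp] with x hx hy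
      rw [hx, hy]
      simp)
  rw [hL _ (memLp_finsetSum S fun k _ => hv k)]
  simp_rw [fun k => hL _ (hv k)]
  rw [hsum, ← ENNReal.ofReal_sum_of_nonneg fun _ _ => by positivity,
    show (N : ℝ≥0∞) = ENNReal.ofReal N by simp, ← ENNReal.ofReal_mul (by positivity)]
  exact ENNReal.ofReal_le_ofReal key

end AlmostOrthogonal

end

/-! ### Averages against the weight, and modulated convolutions. -/

section

section WeightConv

variable {E : Type*} [NormedAddCommGroup E] [InnerProductSpace ℝ E] [FiniteDimensional ℝ E]
  [MeasurableSpace E] [BorelSpace E]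

/-- The convolution of `|g|` with the weight. -/
def weightConv (g : E → ℂ) (y : E) : ℝ≥0∞ := ∫⁻ z, ENNReal.ofReal (weight (y - z)) * ‖g z‖ₑ

lemma measurable_ofReal_weight_sub :
    Measurable (fun p : E × E => ENNReal.ofReal (weight (p.1 - p.2))) :=
  (ENNReal.continuous_ofReal.comp
    (continuous_weight.comp (continuous_fst.sub continuous_snd))).measurable

lemma measurable_ofReal_weight_sub_left (y : E) :
    Measurable (fun z : E => ENNReal.ofReal (weight (y - z))) :=
  (ENNReal.continuous_ofReal.comp
    (continuous_weight.comp (continuous_const.sub continuous_id))).measurable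

lemma measurable_ofReal_weight_sub_right (z : E) :
    Measurable (fun y : E => ENNReal.ofReal (weight (y - z))) :=
  (ENNReal.continuous_ofReal.comp
    (continuous_weight.comp (continuous_id.sub continuous_const))).measurable

lemma measurable_weightConv {g : E → ℂ} (hg : Measurable g) : Measurable (weightConv g) := by
  refine Measurable.lintegral_prod_right' (f := fun p : E × E =>
    ENNReal.ofReal (weight (p.1 - p.2)) * ‖g p.2‖ₑ) ?_
  exact measurable_ofReal_weight_sub.mul (hg.comp measurable_snd).enorm

lemma lintegral_weight_sub (y : E) :
    ∫⁻ z, ENNReal.ofReal (weight (y - z)) = ∫⁻ z : E, ENNReal.ofReal (weight z) :=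
  lintegral_sub_left_eq_self (fun z => ENNReal.ofReal (weight z)) y

lemma lintegral_weight_ne_top : ∫⁻ z : E, ENNReal.ofReal (weight z) ≠ ⊤ :=
  ((integrable_weight (volume : Measure E)).lintegral_lt_top).ne

/-- Hölder with respect to the finite measure `weight (y - z) dz`, whose mass does not depend on
`y`. -/
lemma weightConv_rpow_le {g : E → ℂ} (hg : Measurable g) {p : ℝ} (hp : 1 ≤ p) (y : E) :
    weightConv g y ^ p ≤ (∫⁻ z : E, ENNReal.ofReal (weight z)) ^ (p - 1) *
      ∫⁻ z, ENNReal.ofReal (weight (y - z)) * ‖g z‖ₑ ^ p := by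
  have hp0 : 0 < p := by linarith
  have hWm := measurable_ofReal_weight_sub_left (E := E) y
  have h := ENNReal.lintegral_mul_norm_pow_le (μ := (volume : Measure E))
    (f := fun z => ENNReal.ofReal (weight (y - z)) * ‖g z‖ₑ ^ p)
    (g := fun z => ENNReal.ofReal (weight (y - z)))
    (hWm.mul (hg.enorm.pow_const p)).aemeasurable hWm.aemeasurable
    (p := 1 / p) (q := 1 - 1 / p) (by positivity)
    (by rw [sub_nonneg, div_le_one hp0]; exact hp) (by ring)
  have hpt : ∀ z, (ENNReal.ofReal (weight (y - z)) * ‖g z‖ₑ ^ p) ^ (1 / p) *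
      ENNReal.ofReal (weight (y - z)) ^ (1 - 1 / p) = ENNReal.ofReal (weight (y - z)) * ‖g z‖ₑ := by
    intro z
    rw [ENNReal.mul_rpow_of_nonneg _ _ (by positivity), ← ENNReal.rpow_mul,
      mul_one_div_cancel hp0.ne', ENNReal.rpow_one, mul_right_comm,
      ← ENNReal.rpow_add _ _ (ENNReal.ofReal_pos.2 (weight_pos _)).ne' ENNReal.ofReal_ne_top]
    simp
  simp_rw [hpt, lintegral_weight_sub] at h
  calc weightConv g y ^ p ≤ _ := ENNReal.rpow_le_rpow h hp0.le
    _ = _ := by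
      rw [ENNReal.mul_rpow_of_nonneg _ _ hp0.le, ← ENNReal.rpow_mul, ← ENNReal.rpow_mul,
        one_div_mul_cancel hp0.ne', ENNReal.rpow_one, mul_comm, sub_mul, one_div_mul_cancel hp0.ne',
        one_mul]

lemma lintegral_weight_mul_rpow_le (g : E → ℂ) (p : ℝ) (y : E) :
    ∫⁻ z, ENNReal.ofReal (weight (y - z)) * ‖g z‖ₑ ^ p ≤ ∫⁻ z, ‖g z‖ₑ ^ p := by
  refine lintegral_mono fun z => ?_
  calc _ ≤ 1 * ‖g z‖ₑ ^ p := by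
        gcongr
        exact ENNReal.ofReal_le_one.2 (weight_le_one _)
    _ = _ := one_mul _

lemma exists_weightConv_le (E : Type*) [NormedAddCommGroup E] [InnerProductSpace ℝ E]
    [FiniteDimensional ℝ E] [MeasurableSpace E] [BorelSpace E] {p : ℝ≥0∞} (hp : 1 ≤ p) :
    ∃ C : ℝ≥0∞, C ≠ ⊤ ∧ ∀ g : E → ℂ, Measurable g → ∀ y,
      weightConv g y ≤ C * eLpNorm g p volume := by
  set w := ∫⁻ z : E, ENNReal.ofReal (weight z) with hw
  have hwt : w ≠ ⊤ := lintegral_weight_ne_top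
  rcases eq_or_ne p ⊤ with rfl | hpt
  · refine ⟨w, hwt, fun g hg y => ?_⟩
    calc weightConv g y ≤ ∫⁻ z, ENNReal.ofReal (weight (y - z)) * eLpNorm g ⊤ volume := by
          refine lintegral_mono_ae ?_
          filter_upwards [enorm_ae_le_eLpNormEssSup g volume] with z hz
          rw [eLpNorm_exponent_top]
          gcongr
      _ = _ := by
          rw [lintegral_mul_const _ (measurable_ofReal_weight_sub_left y), lintegral_weight_sub]
  · have hp1 : 1 ≤ p.toReal := by
      rw [← ENNReal.toReal_one]
      exact (ENNReal.toReal_le_toReal ENNReal.one_ne_top hpt).2 hp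
    have hp0 : 0 < p.toReal := by linarith
    refine ⟨w ^ ((p.toReal - 1) * (1 / p.toReal)), ENNReal.rpow_ne_top_of_nonneg
      (mul_nonneg (by linarith) (by positivity)) hwt, fun g hg y => ?_⟩
    have h := (weightConv_rpow_le hg hp1 y).trans
      (mul_le_mul_right (lintegral_weight_mul_rpow_le g p.toReal y) _)
    have h2 := ENNReal.rpow_le_rpow h (z := 1 / p.toReal) (by positivity)
    rw [← ENNReal.rpow_mul, mul_one_div_cancel hp0.ne', ENNReal.rpow_one,
      ENNReal.mul_rpow_of_nonneg _ _ (by positivity), ← ENNReal.rpow_mul] at h2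
    rwa [eLpNorm_eq_lintegral_rpow_enorm_toReal (by positivity) hpt]

/-- Young's inequality for the weight. -/
lemma exists_lintegral_weightConv_rpow_le (E : Type*) [NormedAddCommGroup E] [InnerProductSpace ℝ E]
    [FiniteDimensional ℝ E] [MeasurableSpace E] [BorelSpace E] {p : ℝ≥0∞} {r : ℝ} (hp : 1 ≤ p)
    (hpr : p ≤ ENNReal.ofReal r) :
    ∃ C : ℝ≥0∞, C ≠ ⊤ ∧ ∀ g : E → ℂ, MemLp g p volume → Measurable g →
      (∫⁻ y, weightConv g y ^ r) ^ (1 / r) ≤ C * eLpNorm g p volume := by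
  set w := ∫⁻ z : E, ENNReal.ofReal (weight z) with hw
  have hwt : w ≠ ⊤ := lintegral_weight_ne_top
  have hpt : p ≠ ⊤ := (hpr.trans_lt ENNReal.ofReal_lt_top).ne
  obtain ⟨s, rfl⟩ : ∃ s, p.toReal = s := ⟨_, rfl⟩
  set s := p.toReal with hs
  have hs1 : 1 ≤ s := by
    rw [← ENNReal.toReal_one]
    exact (ENNReal.toReal_le_toReal ENNReal.one_ne_top hpt).2 hp
  have hs0 : 0 < s := by linarith
  have hr0 : 0 < r := by
    by_contra! h
    rw [ENNReal.ofReal_of_nonpos h] at hpr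
    exact absurd (hp.trans hpr) (by simp)
  have hsr : s ≤ r := by
    have := ENNReal.toReal_mono ENNReal.ofReal_ne_top hpr
    rwa [ENNReal.toReal_ofReal hr0.le] at this
  refine ⟨(w ^ ((s - 1) * (r / s)) * w) ^ (1 / r), ?_, fun g hgp hg => ?_⟩
  · refine ENNReal.rpow_ne_top_of_nonneg (by positivity) (ENNReal.mul_ne_top ?_ hwt)
    exact ENNReal.rpow_ne_top_of_nonneg (mul_nonneg (by linarith) (by positivity)) hwt
  set Γ := ∫⁻ z, ‖g z‖ₑ ^ s with hΓ
  have hnorm : eLpNorm g p volume = Γ ^ (1 / s) :=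
    eLpNorm_eq_lintegral_rpow_enorm_toReal (by positivity) hpt
  have hΓt : Γ ≠ ⊤ := by
    have := hgp.2
    rw [hnorm] at this
    intro h
    rw [h, ENNReal.top_rpow_of_pos (by positivity)] at this
    exact this.ne rfl
  set G : E → ℝ≥0∞ := fun y => ∫⁻ z, ENNReal.ofReal (weight (y - z)) * ‖g z‖ₑ ^ s with hG
  have hGm : Measurable G := by
    refine Measurable.lintegral_prod_right' (f := fun p : E × E =>
      ENNReal.ofReal (weight (p.1 - p.2)) * ‖g p.2‖ₑ ^ s) ?_
    exact measurable_ofReal_weight_sub.mul ((hg.comp measurable_snd).enorm.pow_const s)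
  have hGint : ∫⁻ y, G y = w * Γ := by
    simp only [hG]
    rw [lintegral_lintegral_swap]
    · have : ∀ z : E, ∫⁻ y, ENNReal.ofReal (weight (y - z)) * ‖g z‖ₑ ^ s = w * ‖g z‖ₑ ^ s := by
        intro z
        rw [lintegral_mul_const _ (measurable_ofReal_weight_sub_right z)]
        congr 1
        exact lintegral_sub_right_eq_self (fun y => ENNReal.ofReal (weight y)) z
      simp_rw [this]
      rw [lintegral_const_mul _ (hg.enorm.pow_const s)]
    · exact (measurable_ofReal_weight_sub.mul
        ((hg.comp measurable_snd).enorm.pow_const s)).aemeasurable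
  have hGle : ∀ y, G y ≤ Γ := lintegral_weight_mul_rpow_le g s
  -- `G` is both bounded by `Γ` and of integral `w Γ`, so `G^{r/s} ≤ Γ^{r/s-1} G` can be integrated.
  -- This interpolates the gain from `L^p` to `L^r`.
  have hpt : ∀ y, weightConv g y ^ r ≤ w ^ ((s - 1) * (r / s)) * (Γ ^ (r / s - 1) * G y) := by
    intro y
    have h := ENNReal.rpow_le_rpow (weightConv_rpow_le hg hs1 y) (z := r / s) (by positivity)
    rw [← ENNReal.rpow_mul, mul_div_cancel₀ r hs0.ne',
      ENNReal.mul_rpow_of_nonneg _ _ (by positivity), ← ENNReal.rpow_mul] at h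
    refine h.trans (mul_le_mul_right ?_ _)
    have h1 : 1 ≤ r / s := by rwa [one_le_div hs0]
    calc G y ^ (r / s) = G y ^ (r / s - 1) * G y := by
          nth_rw 3 [← ENNReal.rpow_one (G y)]
          rw [← ENNReal.rpow_add_of_nonneg _ _ (by linarith) zero_le_one, sub_add_cancel]
      _ ≤ _ := by
          gcongr
          exact hGle y
  have htot : ∫⁻ y, weightConv g y ^ r ≤ w ^ ((s - 1) * (r / s)) * w * Γ ^ (r / s) := by
    calc _ ≤ _ := lintegral_mono hpt
      _ = w ^ ((s - 1) * (r / s)) * (Γ ^ (r / s - 1) * (w * Γ)) := by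
          rw [lintegral_const_mul _ (hGm.const_mul _), lintegral_const_mul _ hGm, hGint]
      _ = w ^ ((s - 1) * (r / s)) * w * (Γ ^ (r / s - 1) * Γ) := by ring
      _ = _ := by
          congr 1
          nth_rw 2 [← ENNReal.rpow_one Γ]
          rw [← ENNReal.rpow_add_of_nonneg _ _ (by rw [sub_nonneg, one_le_div hs0]; exact hsr)
            zero_le_one, sub_add_cancel]
  calc _ ≤ (w ^ ((s - 1) * (r / s)) * w * Γ ^ (r / s)) ^ (1 / r) := by gcongr
    _ = _ := by
      rw [ENNReal.mul_rpow_of_nonneg _ _ (by positivity), ← ENNReal.rpow_mul, hnorm]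
      congr 2
      field_simp

end WeightConv

section ModConv

variable {E : Type*} [NormedAddCommGroup E] [InnerProductSpace ℝ E] [FiniteDimensional ℝ E]
  [MeasurableSpace E] [BorelSpace E]

/-- The integrand of the convolution of `g` with the kernel `x ↦ e^{2 π i c·x} K x`. -/
def modIntegrand (K : 𝓢(E, ℂ)) (c : E) (g : E → ℂ) (x z : E) : ℂ :=
  Real.fourierChar (inner ℝ c (x - z)) • (K (x - z) * g z)

/-- The convolution of `g` with the kernel `x ↦ e^{2 π i c·x} K x`. -/
def modConv (K : 𝓢(E, ℂ)) (c : E) (g : E → ℂ) (x : E) : ℂ := ∫ z, modIntegrand K c g x z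

lemma norm_modIntegrand (K : 𝓢(E, ℂ)) (c : E) (g : E → ℂ) (x z : E) :
    ‖modIntegrand K c g x z‖ = ‖K (x - z)‖ * ‖g z‖ := by
  rw [modIntegrand, Circle.smul_def, smul_eq_mul, norm_mul, norm_mul, Circle.norm_coe, one_mul]

lemma enorm_modIntegrand (K : 𝓢(E, ℂ)) (c : E) (g : E → ℂ) (x z : E) :
    ‖modIntegrand K c g x z‖ₑ = ‖K (x - z)‖ₑ * ‖g z‖ₑ := by
  rw [← ofReal_norm, norm_modIntegrand, ENNReal.ofReal_mul (norm_nonneg _), ofReal_norm, ofReal_norm]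

lemma measurable_modIntegrand (K : 𝓢(E, ℂ)) (c : E) {g : E → ℂ} (hg : Measurable g) :
    Measurable (fun p : E × E => modIntegrand K c g p.1 p.2) := by
  have h1 : Continuous (fun p : E × E => (Real.fourierChar (inner ℝ c (p.1 - p.2)) : ℂ)) :=
    continuous_induced_dom.comp (Real.continuous_fourierChar.comp (by fun_prop))
  have h2 : Continuous (fun p : E × E => K (p.1 - p.2)) := K.continuous.comp (by fun_prop)
  simp_rw [modIntegrand, Circle.smul_def, smul_eq_mul]
  exact h1.measurable.mul (h2.measurable.mul (hg.comp measurable_snd))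

lemma measurable_modConv (K : 𝓢(E, ℂ)) (c : E) {g : E → ℂ} (hg : Measurable g) :
    Measurable (modConv K c g) :=
  ((measurable_modIntegrand K c hg).stronglyMeasurable.integral_prod_right').measurable

lemma enorm_modConv_le {K : 𝓢(E, ℂ)} {D : ℝ} (hD : 0 ≤ D) (hK : ∀ x, ‖K x‖ ≤ D * weight x ^ 2)
    (c : E) (g : E → ℂ) (x : E) :
    ‖modConv K c g x‖ₑ ≤ ENNReal.ofReal D * weightConv g x := by
  refine (enorm_integral_le_lintegral_enorm _).trans ?_
  rw [weightConv, ← lintegral_const_mul' _ _ ENNReal.ofReal_ne_top]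
  refine lintegral_mono fun z => ?_
  rw [enorm_modIntegrand, ← mul_assoc, ← ENNReal.ofReal_mul hD]
  gcongr
  rw [← ofReal_norm]
  apply ENNReal.ofReal_le_ofReal
  refine (hK _).trans ?_
  have := weight_pos (x - z)
  have := weight_le_one (x - z)
  gcongr
  nlinarith

/-- The base point of the second kernel moves from `x` to `y`; what remains of the dependence on `x`
is an integrable factor. -/
lemma norm_kernel_mul_kernel_le {K : 𝓢(E, ℂ)} {D : ℝ} (hD : 0 ≤ D)
    (hK : ∀ x, ‖K x‖ ≤ D * weight x ^ 2) (x y z : E) :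
    ‖K (x - y)‖ * ‖K (x - z)‖ ≤ D ^ 2 * weight (x - y) * weight (y - z) := by
  have h1 := weight_sub_mul_weight_sub_le x y z
  have p1 := weight_pos (x - y)
  have p2 := weight_pos (x - z)
  have p3 := weight_pos (y - z)
  have l2 := weight_le_one (x - z)
  calc _ ≤ (D * weight (x - y) ^ 2) * (D * weight (x - z) ^ 2) := by
        gcongr <;> exact hK _
    _ = D ^ 2 * weight (x - y) * (weight (x - y) * weight (x - z)) * weight (x - z) := by ring
    _ ≤ D ^ 2 * weight (x - y) * weight (y - z) * 1 := by gcongr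
    _ = _ := mul_one _

lemma norm_kernel_mul_modConv_le {K : 𝓢(E, ℂ)} {D : ℝ} (hD : 0 ≤ D)
    (hK : ∀ x, ‖K x‖ ≤ D * weight x ^ 2) (c : E) {g : E → ℂ} {y : E} (hg : weightConv g y ≠ ⊤)
    (x : E) :
    ‖K (x - y) * modConv K c g x‖ ≤ D ^ 2 * weight (x - y) * (weightConv g y).toReal := by
  have h : ‖K (x - y) * modConv K c g x‖ₑ ≤
      ENNReal.ofReal (D ^ 2 * weight (x - y)) * weightConv g y := by
    rw [enorm_mul]
    refine (mul_le_mul_right (enorm_integral_le_lintegral_enorm _) _).trans ?_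
    rw [weightConv, ← lintegral_const_mul' _ _ ENNReal.ofReal_ne_top,
      ← lintegral_const_mul' _ _ enorm_ne_top]
    refine lintegral_mono fun z => ?_
    rw [enorm_modIntegrand, ← mul_assoc, ← mul_assoc, ← ENNReal.ofReal_mul
      (mul_nonneg (by positivity) (weight_pos _).le)]
    gcongr
    rw [← enorm_mul, ← ofReal_norm]
    apply ENNReal.ofReal_le_ofReal
    rw [norm_mul]
    exact norm_kernel_mul_kernel_le hD hK x y z
  have h2 := ENNReal.toReal_mono (ENNReal.mul_ne_top ENNReal.ofReal_ne_top hg) h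
  rwa [toReal_enorm, ENNReal.toReal_mul, ENNReal.toReal_ofReal
    (mul_nonneg (by positivity) (weight_pos _).le)] at h2

lemma integrable_weight_sub_mul_norm {g : E → ℂ} (hgm : Measurable g) {y : E}
    (hg : weightConv g y ≠ ⊤) : Integrable (fun z => weight (y - z) * ‖g z‖) := by
  refine ⟨((continuous_weight.comp (continuous_const.sub continuous_id)).measurable.mul
    hgm.norm).aestronglyMeasurable, ?_⟩
  rw [HasFiniteIntegral]
  refine lt_of_eq_of_lt (lintegral_congr fun z => ?_) hg.lt_top
  rw [enorm_mul, enorm_norm, Real.enorm_of_nonneg (weight_pos _).le]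

/-- Four factors of spectral radius `R` multiply to one of radius `4R`, and the modulations combine
to the frequency `c - c'`. The integral is a value of the inverse transform outside its support. -/
lemma integral_kernel_quadruple_eq_zero {K : 𝓢(E, ℂ)} {R : ℝ} (hK : BandLimited R K) {c c' : E}
    (hc : 4 * R ≤ ‖c - c'‖) (y z z' : E) :
    ∫ x, (K (x - y) * (Real.fourierChar (inner ℝ c (x - z)) • K (x - z))) *
      (starRingEnd ℂ) (K (x - y) * (Real.fourierChar (inner ℝ c' (x - z')) • K (x - z'))) = 0 := by
  set T := fun a : E => SchwartzMap.compSubConstCLM ℂ a K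
  set P := schwartzMul (schwartzMul (T y) (T z)) (schwartzConj (schwartzMul (T y) (T z'))) with hP
  have hPb : BandLimited (4 * R) P := by
    have := ((hK.translate y).mul (hK.translate z)).mul
      ((hK.translate y).mul (hK.translate z')).conj
    convert this using 1
    ring
  have h0 := hPb.integral_eq_zero hc
  have hpt : ∀ x, (K (x - y) * (Real.fourierChar (inner ℝ c (x - z)) • K (x - z))) *
      (starRingEnd ℂ) (K (x - y) * (Real.fourierChar (inner ℝ c' (x - z')) • K (x - z'))) =
      ((Real.fourierChar (-inner ℝ c z) : ℂ) * (Real.fourierChar (inner ℝ c' z') : ℂ)) *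
        (Real.fourierChar (inner ℝ (c - c') x) • P x) := by
    intro x
    have e1 : (Real.fourierChar (inner ℝ c (x - z)) : ℂ) =
        Real.fourierChar (inner ℝ c x) * Real.fourierChar (-inner ℝ c z) := by
      rw [inner_sub_right, sub_eq_add_neg, AddChar.map_add_eq_mul, Circle.coe_mul]
    have e2 : (starRingEnd ℂ) (Real.fourierChar (inner ℝ c' (x - z')) : ℂ) =
        Real.fourierChar (-inner ℝ c' x) * Real.fourierChar (inner ℝ c' z') := by
      rw [← Circle.coe_inv_eq_conj, ← AddChar.map_neg_eq_inv, inner_sub_right, neg_sub,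
        sub_eq_add_neg, AddChar.map_add_eq_mul, Circle.coe_mul, mul_comm]
    have e3 : (Real.fourierChar (inner ℝ (c - c') x) : ℂ) =
        Real.fourierChar (inner ℝ c x) * Real.fourierChar (-inner ℝ c' x) := by
      rw [inner_sub_left, sub_eq_add_neg, AddChar.map_add_eq_mul, Circle.coe_mul]
    simp only [Circle.smul_def, smul_eq_mul, map_mul, e1, e2, e3, hP, schwartzMul_apply,
      schwartzConj_apply, T, SchwartzMap.compSubConstCLM_apply]
    ring
  simp_rw [hpt]
  rw [integral_const_mul, h0, mul_zero]

/-- Orthogonality of the localized pieces. Fubini moves the `x`-integral inside, where only the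
kernels depend on `x`, so no Fourier transform of `g` or `h` is needed. -/
lemma integral_kernel_mul_modConv_eq_zero {K : 𝓢(E, ℂ)} {R : ℝ} (hK : BandLimited R K) {c c' : E}
    (hc : 4 * R ≤ ‖c - c'‖) {g h : E → ℂ} (hgm : Measurable g) (hhm : Measurable h) {y : E}
    (hg : weightConv g y ≠ ⊤) (hh : weightConv h y ≠ ⊤) :
    ∫ x, (K (x - y) * modConv K c g x) * (starRingEnd ℂ) (K (x - y) * modConv K c' h x) = 0 := by
  obtain ⟨D, hD, hKD⟩ := exists_norm_le_weight_sq K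
  set F : E → E × E → ℂ := fun x p =>
    (K (x - y) * modIntegrand K c g x p.1) *
      (starRingEnd ℂ) (K (x - y) * modIntegrand K c' h x p.2) with hF
  have h1 : ∀ x, (K (x - y) * modConv K c g x) * (starRingEnd ℂ) (K (x - y) * modConv K c' h x) =
      ∫ p, F x p ∂(volume.prod volume) := by
    intro x
    simp only [hF]
    rw [integral_prod_mul (fun z => K (x - y) * modIntegrand K c g x z)
      (fun z => (starRingEnd ℂ) (K (x - y) * modIntegrand K c' h x z)),
      integral_conj, integral_const_mul, integral_const_mul, modConv, modConv]
  have hKc : Continuous (fun q : E × (E × E) => K (q.1 - y)) := K.continuous.comp (by fun_prop)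
  have hFm : Measurable (Function.uncurry F) := by
    have π1 : Measurable (fun q : E × (E × E) => (q.1, q.2.1)) := by fun_prop
    have π2 : Measurable (fun q : E × (E × E) => (q.1, q.2.2)) := by fun_prop
    have m1 := (measurable_modIntegrand K c hgm).comp π1
    have m2 := (measurable_modIntegrand K c' hhm).comp π2
    exact (hKc.measurable.mul m1).mul
      (Complex.continuous_conj.measurable.comp (hKc.measurable.mul m2))
  -- The dominating function splits as a product in `x`, `z`, `z'`; finiteness of `weightConv` at
  -- `y` is integrability in `z` and `z'`.
  have hdom : Integrable (fun q : E × (E × E) => (D ^ 4 * weight (q.1 - y)) *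
      ((weight (y - q.2.1) * ‖g q.2.1‖) * (weight (y - q.2.2) * ‖h q.2.2‖)))
      (volume.prod (volume.prod volume)) := by
    refine Integrable.mul_prod (f := fun x => D ^ 4 * weight (x - y)) (g := fun p : E × E =>
      (weight (y - p.1) * ‖g p.1‖) * (weight (y - p.2) * ‖h p.2‖)) ?_ ?_
    · exact ((integrable_weight (volume : Measure E)).comp_sub_right y).const_mul _
    · exact (integrable_weight_sub_mul_norm hgm hg).mul_prod (integrable_weight_sub_mul_norm hhm hh)
  have hint : Integrable (Function.uncurry F) (volume.prod (volume.prod volume)) := by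
    refine hdom.mono' hFm.aestronglyMeasurable (ae_of_all _ fun ⟨x, z, z'⟩ => ?_)
    simp only [Function.uncurry_apply_pair, hF, norm_mul, RCLike.norm_conj, norm_modIntegrand]
    have b1 := norm_kernel_mul_kernel_le hD hKD x y z
    have b2 := norm_kernel_mul_kernel_le hD hKD x y z'
    have w0 := weight_pos (x - y)
    have w1 := weight_pos (y - z)
    have w2 := weight_pos (y - z')
    have l0 := weight_le_one (x - y)
    calc _ = (‖K (x - y)‖ * ‖K (x - z)‖) * (‖K (x - y)‖ * ‖K (x - z')‖) * (‖g z‖ * ‖h z'‖) := by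
          ring
      _ ≤ (D ^ 2 * weight (x - y) * weight (y - z)) * (D ^ 2 * weight (x - y) * weight (y - z')) *
          (‖g z‖ * ‖h z'‖) := by gcongr
      _ = weight (x - y) * ((D ^ 4 * weight (x - y)) *
          ((weight (y - z) * ‖g z‖) * (weight (y - z') * ‖h z'‖))) := by ring
      _ ≤ _ := mul_le_of_le_one_left (by positivity) l0
  simp_rw [h1]
  rw [integral_integral_swap hint]
  refine integral_eq_zero_of_ae (ae_of_all _ fun p => ?_)
  have h2 := integral_kernel_quadruple_eq_zero hK hc y p.1 p.2
  have h3 : ∀ x, F x p = (g p.1 * (starRingEnd ℂ) (h p.2)) *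
      ((K (x - y) * (Real.fourierChar (inner ℝ c (x - p.1)) • K (x - p.1))) *
      (starRingEnd ℂ)
        (K (x - y) * (Real.fourierChar (inner ℝ c' (x - p.2)) • K (x - p.2)))) := by
    intro x
    simp only [hF, modIntegrand, Circle.smul_def, smul_eq_mul, map_mul]
    ring
  simp only [h3, Pi.zero_apply]
  rw [integral_const_mul, h2, mul_zero]

end ModConv

end

/-! ### The `L^r` estimate at unit scale: local bounds, then integration over the centre. -/

section

section Exponents

lemma toReal_inv_le_toReal_inv_iff {p r : ℝ≥0∞} (hp : 1 ≤ p) (hr : 1 ≤ r) :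
    r⁻¹.toReal ≤ p⁻¹.toReal ↔ p ≤ r := by
  rw [ENNReal.toReal_le_toReal, ENNReal.inv_le_inv]
  · exact ENNReal.inv_ne_top.2 (zero_lt_one.trans_le hr).ne'
  · exact ENNReal.inv_ne_top.2 (zero_lt_one.trans_le hp).ne'

lemma one_le_conjExponent (q : ℝ≥0∞) : 1 ≤ ENNReal.conjExponent q := by
  simp [ENNReal.conjExponent]

lemma le_conjExponent_iff {q r : ℝ≥0∞} (hq : 1 ≤ q) (hr : 1 ≤ r) :
    r ≤ ENNReal.conjExponent q ↔ 1 ≤ q⁻¹.toReal + r⁻¹.toReal := by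
  have hconj : q.HolderConjugate (ENNReal.conjExponent q) := .conjExponent hq
  have h1 : q⁻¹.toReal + (ENNReal.conjExponent q)⁻¹.toReal = 1 := by
    rw [← ENNReal.toReal_add, hconj.inv_add_inv_eq_one, ENNReal.toReal_one]
    · exact ENNReal.inv_ne_top.2 (zero_lt_one.trans_le hq).ne'
    · exact ENNReal.inv_ne_top.2 (zero_lt_one.trans_le (one_le_conjExponent q)).ne'
  rw [← toReal_inv_le_toReal_inv_iff hr (one_le_conjExponent q)]
  constructor <;> intro h <;> linarith

end Exponents

section Local

variable {E : Type*} [NormedAddCommGroup E] [InnerProductSpace ℝ E] [FiniteDimensional ℝ E]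
  [MeasurableSpace E] [BorelSpace E]

lemma lintegral_kernel_mul_modConv_sq_le {K : 𝓢(E, ℂ)} {D : ℝ} (hD : 0 ≤ D)
    (hK : ∀ x, ‖K x‖ ≤ D * weight x ^ 2) (c : E) {g : E → ℂ} {y : E} (hg : weightConv g y ≠ ⊤) :
    ∫⁻ x, ‖K (x - y) * modConv K c g x‖ₑ ^ 2 ≤
      (∫⁻ z : E, ENNReal.ofReal (weight z)) *
        ENNReal.ofReal ((D ^ 2 * (weightConv g y).toReal) ^ 2) := by
  rw [← lintegral_sub_right_eq_self (fun x : E => ENNReal.ofReal (weight x)) y,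
    ← lintegral_mul_const _ (measurable_ofReal_weight_sub_right y)]
  refine lintegral_mono fun x => ?_
  rw [← ofReal_norm, ← ENNReal.ofReal_pow (norm_nonneg _),
    ← ENNReal.ofReal_mul (weight_pos _).le]
  apply ENNReal.ofReal_le_ofReal
  have h := norm_kernel_mul_modConv_le hD hK c hg x
  have w0 := weight_pos (x - y)
  have w1 := weight_le_one (x - y)
  have hb : 0 ≤ (weightConv g y).toReal := ENNReal.toReal_nonneg
  calc _ ≤ (D ^ 2 * weight (x - y) * (weightConv g y).toReal) ^ 2 := by gcongr
    _ = weight (x - y) * weight (x - y) * (D ^ 2 * (weightConv g y).toReal) ^ 2 := by ring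
    _ ≤ weight (x - y) * 1 * (D ^ 2 * (weightConv g y).toReal) ^ 2 := by gcongr
    _ = _ := by rw [mul_one]

lemma measurable_kernel_mul_modConv (K : 𝓢(E, ℂ)) (c : E) {g : E → ℂ} (hg : Measurable g) (y : E) :
    Measurable (fun x => K (x - y) * modConv K c g x) :=
  (K.continuous.comp (continuous_id.sub continuous_const)).measurable.mul (measurable_modConv K c hg)

/-- The `ℓ² → L²` bound near `y`, with the averages `weightConv (g k) y` as coefficients. It comes
from almost orthogonality, as at most `N` frequencies lie within `4R` of a given one. -/
lemma lintegral_sum_kernel_mul_modConv_sq_le {ι : Type*} {K : 𝓢(E, ℂ)} {R : ℝ}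
    (hKR : BandLimited R K) {D : ℝ} (hD : 0 ≤ D) (hK : ∀ x, ‖K x‖ ≤ D * weight x ^ 2)
    {c : ι → E} {N : ℕ}
    (hN : ∀ (S : Finset ι) (k : ι), (S.filter fun l => ‖c k - c l‖ < 4 * R).card ≤ N)
    {g : ι → E → ℂ} (hgm : ∀ k, Measurable (g k)) {y : E} (hg : ∀ k, weightConv (g k) y ≠ ⊤)
    (S : Finset ι) :
    ∫⁻ x, ‖∑ k ∈ S, K (x - y) * modConv K (c k) (g k) x‖ₑ ^ 2 ≤
      (N * ∫⁻ z : E, ENNReal.ofReal (weight z)) *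
        ∑ k ∈ S, ENNReal.ofReal ((D ^ 2 * (weightConv (g k) y).toReal) ^ 2) := by
  classical
  have hL2 : ∀ k, MemLp (fun x => K (x - y) * modConv K (c k) (g k) x) 2 volume := by
    intro k
    refine ⟨(measurable_kernel_mul_modConv K (c k) (hgm k) y).aestronglyMeasurable, ?_⟩
    rw [eLpNorm_lt_top_iff_lintegral_rpow_enorm_lt_top (by norm_num) (by norm_num)]
    have := lintegral_kernel_mul_modConv_sq_le hD hK (c k) (hg k)
    simp only [ENNReal.toReal_ofNat, ENNReal.rpow_ofNat]
    exact this.trans_lt (ENNReal.mul_lt_top lintegral_weight_ne_top.lt_top ENNReal.ofReal_lt_top)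
  have h := lintegral_norm_sum_sq_le S _ hL2 (fun k l => ‖c k - c l‖ < 4 * R)
    (fun k l h => by rwa [norm_sub_rev]) (fun k _ => hN S k)
    (fun k _ l _ hkl => integral_kernel_mul_modConv_eq_zero hKR (not_lt.1 hkl) (hgm k) (hgm l)
      (hg k) (hg l))
  refine h.trans ?_
  rw [mul_assoc]
  refine mul_le_mul_right ?_ _
  rw [Finset.mul_sum]
  exact Finset.sum_le_sum fun k _ => lintegral_kernel_mul_modConv_sq_le hD hK (c k) (hg k)

/-- The localized estimate for sums of band-limited functions, for `r ≤ 2`. -/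
lemma exists_local_le_of_le_two {ι : Type*} {K : 𝓢(E, ℂ)} {R : ℝ} (hKR : BandLimited R K)
    {c : ι → E} {N : ℕ}
    (hN : ∀ (S : Finset ι) (k : ι), (S.filter fun l => ‖c k - c l‖ < 4 * R).card ≤ N)
    {r : ℝ} (hr1 : 1 ≤ r) (hr2 : r ≤ 2) :
    ∃ C : ℝ≥0∞, C ≠ ⊤ ∧ ∀ (A : Finset ι) (g : ι → E → ℂ) (y : E), (∀ k, Measurable (g k)) →
      (∀ k, weightConv (g k) y ≠ ⊤) →
      ∫⁻ x, ENNReal.ofReal (weight (x - y)) * ‖∑ k ∈ A, K (x - y) * modConv K (c k) (g k) x‖ₑ ^ r ≤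
        C * ∑ k ∈ A, weightConv (g k) y ^ r := by
  obtain ⟨D, hD, hK⟩ := exists_norm_le_weight_sq K
  set w := ∫⁻ z : E, ENNReal.ofReal (weight z) with hw
  have hwt : w ≠ ⊤ := lintegral_weight_ne_top
  have hr0 : 0 < r := by linarith
  refine ⟨(N * w) ^ (r / 2) * w ^ (1 - r / 2) * ENNReal.ofReal (D ^ 2) ^ r, ?_,
    fun A g y hgm hg => ?_⟩
  · refine ENNReal.mul_ne_top (ENNReal.mul_ne_top ?_ ?_) ?_
    · exact ENNReal.rpow_ne_top_of_nonneg (by positivity)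
        (ENNReal.mul_ne_top (ENNReal.natCast_ne_top N) hwt)
    · exact ENNReal.rpow_ne_top_of_nonneg (by linarith) hwt
    · exact ENNReal.rpow_ne_top_of_nonneg hr0.le ENNReal.ofReal_ne_top
  set V : E → ℂ := fun x => ∑ k ∈ A, K (x - y) * modConv K (c k) (g k) x with hV
  have hVm : Measurable V :=
    Finset.measurable_fun_sum A fun k _ => measurable_kernel_mul_modConv K (c k) (hgm k) y
  have hWm := measurable_ofReal_weight_sub_right (E := E) y
  -- Write `w |V|^r = (w |V|²)^{r/2} w^{1 - r/2}`, with `w` the weight centred at `y`: the finite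
  -- mass of the weight lets `L²` control `L^r` for `r ≤ 2`.
  have hHolder := ENNReal.lintegral_mul_norm_pow_le (μ := (volume : Measure E))
    (f := fun x => ENNReal.ofReal (weight (x - y)) * ‖V x‖ₑ ^ 2)
    (g := fun x => ENNReal.ofReal (weight (x - y)))
    (hWm.mul (hVm.enorm.pow_const 2)).aemeasurable hWm.aemeasurable
    (p := r / 2) (q := 1 - r / 2) (by positivity) (by linarith) (by ring)
  have hpt : ∀ x, (ENNReal.ofReal (weight (x - y)) * ‖V x‖ₑ ^ 2) ^ (r / 2) *
      ENNReal.ofReal (weight (x - y)) ^ (1 - r / 2) =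
      ENNReal.ofReal (weight (x - y)) * ‖V x‖ₑ ^ r := by
    intro x
    rw [ENNReal.mul_rpow_of_nonneg _ _ (by positivity), ← ENNReal.rpow_natCast, ← ENNReal.rpow_mul,
      mul_right_comm,
      ← ENNReal.rpow_add _ _ (ENNReal.ofReal_pos.2 (weight_pos _)).ne' ENNReal.ofReal_ne_top]
    congr 2
    · rw [add_sub_cancel, ENNReal.rpow_one]
    · push_cast; ring
  simp_rw [hpt] at hHolder
  rw [lintegral_sub_right_eq_self (fun x : E => ENNReal.ofReal (weight x)) y] at hHolder
  have hL2 : ∫⁻ x, ENNReal.ofReal (weight (x - y)) * ‖V x‖ₑ ^ 2 ≤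
      (N * w) * ∑ k ∈ A, ENNReal.ofReal ((D ^ 2 * (weightConv (g k) y).toReal) ^ 2) := by
    refine le_trans (lintegral_mono fun x => ?_)
      (lintegral_sum_kernel_mul_modConv_sq_le hKR hD hK hN hgm hg A)
    exact mul_le_of_le_one_left' (ENNReal.ofReal_le_one.2 (weight_le_one _))
  -- This is `ℓ^r ⊂ ℓ²`.
  have hsum : (∑ k ∈ A, ENNReal.ofReal ((D ^ 2 * (weightConv (g k) y).toReal) ^ 2)) ^ (r / 2) ≤
      ENNReal.ofReal (D ^ 2) ^ r * ∑ k ∈ A, weightConv (g k) y ^ r := by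
    have h1 : ∀ k, ENNReal.ofReal ((D ^ 2 * (weightConv (g k) y).toReal) ^ 2) =
        (ENNReal.ofReal (D ^ 2) * weightConv (g k) y) ^ (2 : ℝ) := by
      intro k
      rw [ENNReal.ofReal_pow (by positivity), ENNReal.ofReal_mul (by positivity),
        ENNReal.ofReal_toReal (hg k)]
      simp
    have h2 := sum_rpow_rpow_le A (fun k => ENNReal.ofReal (D ^ 2) * weightConv (g k) y) hr0 hr2
    have h3 := ENNReal.rpow_le_rpow h2 hr0.le
    rw [← ENNReal.rpow_mul, ← ENNReal.rpow_mul, one_div_mul_cancel hr0.ne', ENNReal.rpow_one] at h3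
    simp_rw [h1]
    rw [show r / 2 = 1 / 2 * r by ring, Finset.mul_sum]
    refine h3.trans (le_of_eq (Finset.sum_congr rfl fun k _ => ?_))
    rw [ENNReal.mul_rpow_of_nonneg _ _ hr0.le]
  calc _ ≤ _ := hHolder
    _ ≤ ((N * w) * ∑ k ∈ A, ENNReal.ofReal ((D ^ 2 * (weightConv (g k) y).toReal) ^ 2)) ^ (r / 2) *
          w ^ (1 - r / 2) := by gcongr
    _ = (N * w) ^ (r / 2) * w ^ (1 - r / 2) *
          (∑ k ∈ A, ENNReal.ofReal ((D ^ 2 * (weightConv (g k) y).toReal) ^ 2)) ^ (r / 2) := by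
        rw [ENNReal.mul_rpow_of_nonneg _ _ (by positivity)]; ring
    _ ≤ (N * w) ^ (r / 2) * w ^ (1 - r / 2) *
          (ENNReal.ofReal (D ^ 2) ^ r * ∑ k ∈ A, weightConv (g k) y ^ r) := by gcongr
    _ = _ := by ring

/-- The localized estimate for sums of band-limited functions, for `r > 2`. -/
lemma exists_local_le_of_two_lt {ι : Type*} {K : 𝓢(E, ℂ)} {R : ℝ} (hKR : BandLimited R K)
    {c : ι → E} {N : ℕ}
    (hN : ∀ (S : Finset ι) (k : ι), (S.filter fun l => ‖c k - c l‖ < 4 * R).card ≤ N)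
    {r q : ℝ} (hr2 : 2 < r) (hrq : r.HolderConjugate q) :
    ∃ C : ℝ≥0∞, C ≠ ⊤ ∧ ∀ (A : Finset ι) (g : ι → E → ℂ) (y : E), (∀ k, Measurable (g k)) →
      (∀ k, weightConv (g k) y ≠ ⊤) →
      ∫⁻ x, ENNReal.ofReal (weight (x - y)) * ‖∑ k ∈ A, K (x - y) * modConv K (c k) (g k) x‖ₑ ^ r ≤
        C * (∑ k ∈ A, weightConv (g k) y ^ q) ^ (r / q) := by
  obtain ⟨D, hD, hK⟩ := exists_norm_le_weight_sq K
  set w := ∫⁻ z : E, ENNReal.ofReal (weight z) with hw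
  have hwt : w ≠ ⊤ := lintegral_weight_ne_top
  have hr0 : 0 < r := by linarith
  have hq0 : 0 < q := hrq.symm.pos
  have hrq1 : r / q = r - 1 := hrq.div_conj_eq_sub_one
  refine ⟨ENNReal.ofReal (4 * r * 2 ^ (r - 2) / (r - 2)) * (N * w) *
    (ENNReal.ofReal (D ^ 2) ^ q) ^ (r / q), ?_, fun A g y hgm hg => ?_⟩
  · refine ENNReal.mul_ne_top (ENNReal.mul_ne_top ENNReal.ofReal_ne_top
      (ENNReal.mul_ne_top (ENNReal.natCast_ne_top N) hwt)) ?_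
    exact ENNReal.rpow_ne_top_of_nonneg (by positivity)
      (ENNReal.rpow_ne_top_of_nonneg hq0.le ENNReal.ofReal_ne_top)
  have hβ : ∀ k, 0 ≤ D ^ 2 * (weightConv (g k) y).toReal := fun k =>
    mul_nonneg (by positivity) ENNReal.toReal_nonneg
  -- The sup bound of each localized piece serves as `b k`, and the same numbers appear in the `L²`
  -- bound, as the interpolation requires.
  have h := lintegral_rpow_sum_le (μ := (volume : Measure E)) (A := A)
    (v := fun k x => K (x - y) * modConv K (c k) (g k) x)
    (fun k => (measurable_kernel_mul_modConv K (c k) (hgm k) y).aemeasurable)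
    (b := fun k => D ^ 2 * (weightConv (g k) y).toReal) hβ
    (fun k _ x => (norm_kernel_mul_modConv_le hD hK (c k) (hg k) x).trans (by
      have := weight_le_one (x - y)
      have hb : 0 ≤ (weightConv (g k) y).toReal := ENNReal.toReal_nonneg
      calc _ ≤ D ^ 2 * 1 * (weightConv (g k) y).toReal := by gcongr
        _ = _ := by rw [mul_one]))
    (fun S _ => lintegral_sum_kernel_mul_modConv_sq_le hKR hD hK hN hgm hg S) hr2 hrq
  have hsum : ENNReal.ofReal ((∑ k ∈ A, (D ^ 2 * (weightConv (g k) y).toReal) ^ q) ^ (r - 1)) =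
      (ENNReal.ofReal (D ^ 2) ^ q) ^ (r / q) * (∑ k ∈ A, weightConv (g k) y ^ q) ^ (r / q) := by
    rw [hrq1, ← ENNReal.ofReal_rpow_of_nonneg
      (Finset.sum_nonneg fun k _ => Real.rpow_nonneg (hβ k) q) (by linarith),
      ← ENNReal.mul_rpow_of_nonneg _ _ (by linarith : 0 ≤ r - 1),
      ENNReal.ofReal_sum_of_nonneg fun k _ => Real.rpow_nonneg (hβ k) q, Finset.mul_sum]
    congr 1
    refine Finset.sum_congr rfl fun k _ => ?_
    rw [← ENNReal.ofReal_rpow_of_nonneg (hβ k) hq0.le, ENNReal.ofReal_mul (by positivity),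
      ENNReal.ofReal_toReal (hg k), ENNReal.mul_rpow_of_nonneg _ _ hq0.le]
  refine (lintegral_mono fun x => ?_).trans (h.trans (le_of_eq ?_))
  · exact mul_le_of_le_one_left' (ENNReal.ofReal_le_one.2 (weight_le_one _))
  · simp only [hsum]
    ring

end Local

section Global

variable {E : Type*} [NormedAddCommGroup E] [InnerProductSpace ℝ E] [FiniteDimensional ℝ E]
  [MeasurableSpace E] [BorelSpace E]

/-- Undoing the localization divides by this constant. -/
lemma lintegral_weight_mul_kernel_rpow_ne_zero {K : 𝓢(E, ℂ)} (hK0 : K ≠ 0) (r : ℝ) :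
    ∫⁻ x, ENNReal.ofReal (weight x) * ‖K x‖ₑ ^ r ≠ 0 := by
  have hm : Measurable (fun x : E => ENNReal.ofReal (weight x) * ‖K x‖ₑ ^ r) :=
    (ENNReal.continuous_ofReal.comp continuous_weight).measurable.mul
      (K.continuous.measurable.enorm.pow_const r)
  intro h
  rw [lintegral_eq_zero_iff hm] at h
  apply hK0
  have : (K : E → ℂ) = 0 := by
    refine (Continuous.ae_eq_iff_eq (volume : Measure E) K.continuous continuous_zero).1 ?_
    filter_upwards [h] with x hx
    simp only [Pi.zero_apply, mul_eq_zero, ENNReal.rpow_eq_zero_iff, enorm_eq_zero] at hx ⊢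
    rcases hx with hx | hx | hx
    · exact absurd hx (ENNReal.ofReal_pos.2 (weight_pos x)).ne'
    · exact hx.1
    · exact absurd hx.1 enorm_ne_top
  ext x
  exact congrFun this x

lemma lintegral_weight_mul_kernel_rpow_ne_top (K : 𝓢(E, ℂ)) {r : ℝ} (hr : 0 ≤ r) :
    ∫⁻ x, ENNReal.ofReal (weight x) * ‖K x‖ₑ ^ r ≠ ⊤ := by
  obtain ⟨D, hD, hK⟩ := exists_norm_le_weight_sq K
  have : ∫⁻ x, ENNReal.ofReal (weight x) * ‖K x‖ₑ ^ r ≤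
      ∫⁻ x : E, ENNReal.ofReal (weight x) * ENNReal.ofReal D ^ r := by
    refine lintegral_mono fun x => ?_
    gcongr
    rw [← ofReal_norm]
    refine ENNReal.ofReal_le_ofReal ((hK x).trans ?_)
    have := weight_pos x
    have := weight_le_one x
    nlinarith [mul_le_one₀ (weight_le_one x) (weight_pos x).le (weight_le_one x)]
  refine (this.trans_lt ?_).ne
  rw [lintegral_mul_const' _ _ (ENNReal.rpow_ne_top_of_nonneg hr ENNReal.ofReal_ne_top)]
  exact ENNReal.mul_lt_top lintegral_weight_ne_top.lt_top
    (ENNReal.rpow_ne_top_of_nonneg hr ENNReal.ofReal_ne_top).lt_top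

/-- Averaging the localizations over all centres `y` recovers the global norm, by Tonelli and
translation invariance. -/
lemma lintegral_lintegral_weight_kernel (K : 𝓢(E, ℂ)) {u : E → ℂ} (hu : Measurable u) {r : ℝ}
    (hr : 0 ≤ r) :
    ∫⁻ y, ∫⁻ x, ENNReal.ofReal (weight (x - y)) * ‖K (x - y) * u x‖ₑ ^ r =
      (∫⁻ x, ENNReal.ofReal (weight x) * ‖K x‖ₑ ^ r) * ∫⁻ x, ‖u x‖ₑ ^ r := by
  have hKm : Measurable (fun p : E × E => K (p.2 - p.1)) :=
    (K.continuous.comp (continuous_snd.sub continuous_fst)).measurable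
  have hWm : Measurable (fun p : E × E => ENNReal.ofReal (weight (p.2 - p.1))) :=
    (ENNReal.continuous_ofReal.comp
      (continuous_weight.comp (continuous_snd.sub continuous_fst))).measurable
  rw [lintegral_lintegral_swap]
  · rw [← lintegral_const_mul _ (hu.enorm.pow_const r)]
    refine lintegral_congr fun x => ?_
    have : ∀ y, ENNReal.ofReal (weight (x - y)) * ‖K (x - y) * u x‖ₑ ^ r =
        ENNReal.ofReal (weight (x - y)) * ‖K (x - y)‖ₑ ^ r * ‖u x‖ₑ ^ r := by
      intro y
      rw [enorm_mul, ENNReal.mul_rpow_of_nonneg _ _ hr, mul_assoc]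
    simp_rw [this]
    rw [lintegral_mul_const' _ _ (ENNReal.rpow_ne_top_of_nonneg hr enorm_ne_top)]
    congr 1
    exact lintegral_sub_left_eq_self (fun y => ENNReal.ofReal (weight y) * ‖K y‖ₑ ^ r) x
  · exact (hWm.mul ((hKm.mul (hu.comp measurable_snd)).enorm.pow_const r)).aemeasurable

lemma exists_eLpNorm_sum_modConv_le_of_ne_top {ι : Type*} {K : 𝓢(E, ℂ)} (hK0 : K ≠ 0) {R : ℝ}
    (hKR : BandLimited R K) {c : ι → E} {N : ℕ}
    (hN : ∀ (S : Finset ι) (k : ι), (S.filter fun l => ‖c k - c l‖ < 4 * R).card ≤ N)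
    {p : ℝ≥0∞} (hp : 1 ≤ p) {q r : ℝ} (hq : 1 ≤ q) (hr : 1 ≤ r) (hpr : p ≤ ENNReal.ofReal r)
    (hqr : q ≤ r) (hqr' : 1 ≤ 1 / q + 1 / r) :
    ∃ C : ℝ≥0∞, C ≠ ⊤ ∧ ∀ (A : Finset ι) (g : ι → E → ℂ), (∀ k, Measurable (g k)) →
      (∀ k, MemLp (g k) p volume) →
      (∫⁻ x, ‖∑ k ∈ A, modConv K (c k) (g k) x‖ₑ ^ r) ^ (1 / r) ≤
        C * (∑ k ∈ A, eLpNorm (g k) p volume ^ q) ^ (1 / q) := by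
  have hr0 : 0 < r := by linarith
  have hq0 : 0 < q := by linarith
  -- The exponent is `s = r` for `r ≤ 2` and the dual exponent of `r` for `r > 2`. The bound `q ≤ s`
  -- uses `q ≤ r` in the first case and `1 ≤ 1/q + 1/r` in the second.
  obtain ⟨s, hqs, hsr, hs0, C₁, hC₁, hloc⟩ : ∃ s : ℝ, q ≤ s ∧ s ≤ r ∧ 0 < s ∧
      ∃ C : ℝ≥0∞, C ≠ ⊤ ∧ ∀ (A : Finset ι) (g : ι → E → ℂ) (y : E), (∀ k, Measurable (g k)) →
      (∀ k, weightConv (g k) y ≠ ⊤) →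
      ∫⁻ x, ENNReal.ofReal (weight (x - y)) * ‖∑ k ∈ A, K (x - y) * modConv K (c k) (g k) x‖ₑ ^ r ≤
        C * (∑ k ∈ A, weightConv (g k) y ^ s) ^ (r / s) := by
    rcases le_or_gt r 2 with h2 | h2
    · obtain ⟨C, hC, h⟩ := exists_local_le_of_le_two hKR hN hr h2
      refine ⟨r, hqr, le_rfl, hr0, C, hC, fun A g y hgm hg => ?_⟩
      rw [div_self hr0.ne', ENNReal.rpow_one]
      exact h A g y hgm hg
    · have hconj : r.HolderConjugate (r / (r - 1)) := Real.HolderConjugate.conjExponent (by linarith)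
      obtain ⟨C, hC, h⟩ := exists_local_le_of_two_lt hKR hN h2 hconj
      refine ⟨r / (r - 1), ?_, ?_, hconj.symm.pos, C, hC, h⟩
      · have := hconj.inv_add_inv_eq_one
        rw [← inv_le_inv₀ hconj.symm.pos hq0]
        simp only [one_div] at hqr'
        linarith
      · rw [div_le_iff₀ (by linarith)]
        nlinarith
  obtain ⟨C₂, hC₂, hYoung⟩ := exists_lintegral_weightConv_rpow_le E hp hpr
  obtain ⟨C₃, hC₃, hsup⟩ := exists_weightConv_le E hp
  set κ := ∫⁻ x, ENNReal.ofReal (weight x) * ‖K x‖ₑ ^ r with hκ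
  have hκ0 : κ ≠ 0 := lintegral_weight_mul_kernel_rpow_ne_zero hK0 r
  have hκt : κ ≠ ⊤ := lintegral_weight_mul_kernel_rpow_ne_top K hr0.le
  refine ⟨(C₁ / κ) ^ (1 / r) * C₂, ENNReal.mul_ne_top (ENNReal.rpow_ne_top_of_nonneg
    (by positivity) (ENNReal.div_ne_top hC₁ hκ0)) hC₂, fun A g hgm hg => ?_⟩
  have hfin : ∀ y k, weightConv (g k) y ≠ ⊤ := fun y k =>
    ((hsup (g k) (hgm k) y).trans_lt (ENNReal.mul_lt_top hC₃.lt_top (hg k).2)).ne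
  set u : E → ℂ := fun x => ∑ k ∈ A, modConv K (c k) (g k) x with hu
  have hum : Measurable u := Finset.measurable_fun_sum A fun k _ => measurable_modConv K (c k) (hgm k)
  have h1 : κ * ∫⁻ x, ‖u x‖ₑ ^ r ≤ C₁ * ∫⁻ y, (∑ k ∈ A, weightConv (g k) y ^ s) ^ (r / s) := by
    rw [← lintegral_lintegral_weight_kernel K hum hr0.le, ← lintegral_const_mul' _ _ hC₁]
    refine lintegral_mono fun y => ?_
    have := hloc A g y hgm (hfin y)
    simpa only [hu, Finset.mul_sum] using this
  -- Minkowski in `L^{r/s}`, which is why `s ≤ r` was recorded; it takes the sum over `k` out of the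
  -- integral so that Young applies to each `g k`.
  have hmink := lintegral_Lp_finset_sum_le (μ := (volume : Measure E)) A
    (f := fun k y => weightConv (g k) y ^ s)
    (fun k => ((measurable_weightConv (hgm k)).pow_const s).aemeasurable) (p := r / s)
    (by rwa [one_le_div hs0])
  have h2 : ∀ k, (∫⁻ y, (weightConv (g k) y ^ s) ^ (r / s)) ^ (1 / (r / s)) ≤
      (C₂ * eLpNorm (g k) p volume) ^ s := by
    intro k
    have := ENNReal.rpow_le_rpow (hYoung (g k) (hg k) (hgm k)) hs0.le
    simp_rw [← ENNReal.rpow_mul, mul_div_cancel₀ r hs0.ne']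
    rw [← ENNReal.rpow_mul] at this
    convert this using 2
    field_simp
  have h3 : (∫⁻ y, (∑ k ∈ A, weightConv (g k) y ^ s) ^ (r / s)) ^ (1 / r) ≤
      C₂ * (∑ k ∈ A, eLpNorm (g k) p volume ^ s) ^ (1 / s) := by
    have h := ENNReal.rpow_le_rpow (hmink.trans (Finset.sum_le_sum fun k _ => h2 k))
      (z := 1 / s) (by positivity)
    rw [← ENNReal.rpow_mul, show 1 / (r / s) * (1 / s) = 1 / r by field_simp] at h
    refine h.trans (le_of_eq ?_)
    simp_rw [ENNReal.mul_rpow_of_nonneg _ _ hs0.le]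
    rw [← Finset.mul_sum, ENNReal.mul_rpow_of_nonneg _ _ (by positivity), ← ENNReal.rpow_mul,
      mul_one_div_cancel hs0.ne', ENNReal.rpow_one]
  have h4 : ∫⁻ x, ‖u x‖ₑ ^ r ≤
      C₁ / κ * ∫⁻ y, (∑ k ∈ A, weightConv (g k) y ^ s) ^ (r / s) := by
    rw [mul_comm, ← mul_comm (C₁ / κ), ← ENNReal.mul_div_right_comm,
      ENNReal.le_div_iff_mul_le (Or.inl hκ0) (Or.inl hκt), mul_comm]
    exact h1
  calc _ ≤ (C₁ / κ * ∫⁻ y, (∑ k ∈ A, weightConv (g k) y ^ s) ^ (r / s)) ^ (1 / r) := by gcongr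
    _ = (C₁ / κ) ^ (1 / r) * (∫⁻ y, (∑ k ∈ A, weightConv (g k) y ^ s) ^ (r / s)) ^ (1 / r) :=
        ENNReal.mul_rpow_of_nonneg _ _ (by positivity)
    _ ≤ (C₁ / κ) ^ (1 / r) * (C₂ * (∑ k ∈ A, eLpNorm (g k) p volume ^ q) ^ (1 / q)) := by
        gcongr
        exact h3.trans (mul_le_mul_right (sum_rpow_rpow_le A _ hq0 hqs) _)
    _ = _ := by rw [mul_assoc]

lemma exists_eLpNorm_top_sum_modConv_le {ι : Type*} (K : 𝓢(E, ℂ)) (c : ι → E)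
    {p : ℝ≥0∞} (hp : 1 ≤ p) :
    ∃ C : ℝ≥0∞, C ≠ ⊤ ∧ ∀ (A : Finset ι) (g : ι → E → ℂ), (∀ k, Measurable (g k)) →
      eLpNorm (fun x => ∑ k ∈ A, modConv K (c k) (g k) x) ⊤ volume ≤
        C * ∑ k ∈ A, eLpNorm (g k) p volume := by
  obtain ⟨D, hD, hK⟩ := exists_norm_le_weight_sq K
  obtain ⟨C, hC, hsup⟩ := exists_weightConv_le E hp
  refine ⟨ENNReal.ofReal D * C, ENNReal.mul_ne_top ENNReal.ofReal_ne_top hC, fun A g hgm => ?_⟩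
  rw [eLpNorm_exponent_top]
  refine eLpNormEssSup_le_of_ae_enorm_bound (ae_of_all _ fun x => ?_)
  refine (enorm_sum_le _ _).trans ?_
  rw [Finset.mul_sum]
  refine Finset.sum_le_sum fun k _ => (enorm_modConv_le hD hK (c k) (g k) x).trans ?_
  rw [mul_assoc]
  gcongr
  exact hsup (g k) (hgm k) x

/-- The embedding of sums of band-limited pieces into `L^r`. -/
theorem exists_eLpNorm_sum_modConv_le {ι : Type*} {K : 𝓢(E, ℂ)} (hK0 : K ≠ 0) {R : ℝ}
    (hKR : BandLimited R K) {c : ι → E} {N : ℕ}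
    (hN : ∀ (S : Finset ι) (k : ι), (S.filter fun l => ‖c k - c l‖ < 4 * R).card ≤ N)
    {p q r : ℝ≥0∞} (hp : 1 ≤ p) (hq : 1 ≤ q) (hr : 1 ≤ r) (hpr : p ≤ r) (hqr : q ≤ r)
    (hqr' : r ≤ ENNReal.conjExponent q) :
    ∃ C : ℝ≥0∞, C ≠ ⊤ ∧ ∀ (A : Finset ι) (g : ι → E → ℂ), (∀ k, Measurable (g k)) →
      (∀ k, MemLp (g k) p volume) →
      eLpNorm (fun x => ∑ k ∈ A, modConv K (c k) (g k) x) r volume ≤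
        C * (∑ k ∈ A, eLpNorm (g k) p volume ^ q.toReal) ^ (1 / q.toReal) := by
  rw [le_conjExponent_iff hq hr] at hqr'
  rcases eq_or_ne r ⊤ with rfl | hrt
  -- For `r = ∞` the dual condition leaves only `q = 1`, and the triangle inequality suffices.
  · have hq1 : q = 1 := by
      refine le_antisymm ?_ hq
      rw [← toReal_inv_le_toReal_inv_iff hq le_rfl]
      simpa using hqr'
    subst hq1
    obtain ⟨C, hC, h⟩ := exists_eLpNorm_top_sum_modConv_le K c hp
    exact ⟨C, hC, fun A g hgm _ => by simpa using h A g hgm⟩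
  · have hqt : q ≠ ⊤ := (hqr.trans_lt hrt.lt_top).ne
    have hr1 : 1 ≤ r.toReal := by
      rw [← ENNReal.toReal_one]
      exact (ENNReal.toReal_le_toReal ENNReal.one_ne_top hrt).2 hr
    have hq1 : 1 ≤ q.toReal := by
      rw [← ENNReal.toReal_one]
      exact (ENNReal.toReal_le_toReal ENNReal.one_ne_top hqt).2 hq
    obtain ⟨C, hC, h⟩ := exists_eLpNorm_sum_modConv_le_of_ne_top hK0 hKR hN hp hq1 hr1
      (by rwa [ENNReal.ofReal_toReal hrt]) ((ENNReal.toReal_le_toReal hqt hrt).2 hqr)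
      (by simpa [ENNReal.toReal_inv] using hqr')
    refine ⟨C, hC, fun A g hgm hg => ?_⟩
    rw [eLpNorm_eq_lintegral_rpow_enorm_toReal (by positivity) hrt]
    exact h A g hgm hg

end Global

end

/-! ### Fourier multipliers as convolutions, and their scaling. -/

section

section Multiplier

variable {E : Type*} [NormedAddCommGroup E] [InnerProductSpace ℝ E] [FiniteDimensional ℝ E]
  [MeasurableSpace E] [BorelSpace E]

lemma eLpNorm_comp_smul {f : E → ℂ} (hf : Measurable f) (p : ℝ≥0∞) {l : ℝ} (hl : 0 < l) :
    eLpNorm (fun x => f (l • x)) p volume =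
      ENNReal.ofReal (l ^ (-(Module.finrank ℝ E * p⁻¹.toReal))) * eLpNorm f p volume := by
  have hm : AEMeasurable (fun x : E => l • x) volume := (measurable_const_smul l).aemeasurable
  have h1 : eLpNorm (fun x => f (l • x)) p volume =
      eLpNorm f p (Measure.map (fun x : E => l • x) volume) := by
    rw [eLpNorm_map_measure hf.aestronglyMeasurable hm]
    rfl
  have hc : ENNReal.ofReal |(l ^ Module.finrank ℝ E)⁻¹| ≠ 0 := by
    rw [Ne, ENNReal.ofReal_eq_zero, not_le]
    positivity
  rw [h1, Measure.map_addHaar_smul _ hl.ne', eLpNorm_smul_measure_of_ne_zero hc, smul_eq_mul]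
  congr 1
  rw [abs_of_pos (by positivity), ENNReal.ofReal_rpow_of_nonneg (by positivity) (by positivity)]
  congr 1
  rw [← Real.rpow_natCast, ← Real.rpow_neg hl.le, ← Real.rpow_mul hl.le, ENNReal.toReal_inv]
  congr 1
  simp

lemma fourier_compSubConst (f : 𝓢(E, ℂ)) (a ξ : E) :
    𝓕 (SchwartzMap.compSubConstCLM ℂ a f) ξ = Real.fourierChar (-inner ℝ a ξ) • 𝓕 f ξ := by
  rw [SchwartzMap.fourier_coe, SchwartzMap.fourier_coe, Real.fourier_eq, Real.fourier_eq]
  rw [← integral_add_right_eq_self _ a]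
  have : ∀ v : E, Real.fourierChar (-inner ℝ (v + a) ξ) •
      (SchwartzMap.compSubConstCLM ℂ a f) (v + a) =
      Real.fourierChar (-inner ℝ a ξ) • (Real.fourierChar (-inner ℝ v ξ) • f v) := by
    intro v
    rw [SchwartzMap.compSubConstCLM_apply, add_sub_cancel_right, smul_smul, ← AddChar.map_add_eq_mul,
      inner_add_left, neg_add, add_comm (-inner ℝ a ξ)]
  simp_rw [this, Circle.smul_def, integral_smul]

/-- Parseval for `ψ` against the translate of `𝓕⁻ m` by `z`, whose transform is `m` times a phase.
This is the transpose of the multiplier acting on test functions. -/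
lemma fourier_smulLeft_fourierInv (m ψ : 𝓢(E, ℂ)) (z : E) :
    𝓕 (SchwartzMap.smulLeftCLM ℂ (m : E → ℂ) (𝓕⁻ ψ)) z =
      ∫ x, ψ x * (𝓕⁻ m : 𝓢(E, ℂ)) (x - z) := by
  have h := SchwartzMap.integral_fourierInv_mul_eq ψ
    (𝓕 (SchwartzMap.compSubConstCLM ℂ z (𝓕⁻ m)))
  simp only [FourierTransform.fourierInv_fourier_eq, fourier_compSubConst,
    FourierTransform.fourier_fourierInv_eq, SchwartzMap.compSubConstCLM_apply] at h
  rw [SchwartzMap.fourier_coe, Real.fourier_eq]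
  rw [← h]
  refine integral_congr_ae (ae_of_all _ fun ξ => ?_)
  simp only [SchwartzMap.smulLeftCLM_apply_apply m.hasTemperateGrowth, Circle.smul_def, smul_eq_mul,
    real_inner_comm]
  ring

/-- The dilated and translated symbol `ξ ↦ m (l⁻¹ ξ - c)`. -/
def dilateSymbol (m : 𝓢(E, ℂ)) {l : ℝ} (hl : l ≠ 0) (c : E) : 𝓢(E, ℂ) :=
  SchwartzMap.compCLMOfContinuousLinearEquiv ℂ
    (ContinuousLinearEquiv.smulLeft (Units.mk0 l⁻¹ (inv_ne_zero hl)))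
    (SchwartzMap.compSubConstCLM ℂ c m)

lemma dilateSymbol_apply (m : 𝓢(E, ℂ)) {l : ℝ} (hl : l ≠ 0) (c ξ : E) :
    dilateSymbol m hl c ξ = m (l⁻¹ • ξ - c) := by
  simp [dilateSymbol, Units.smul_def]

lemma fourierInv_dilateSymbol (m : 𝓢(E, ℂ)) {l : ℝ} (hl : 0 < l) (c x : E) :
    (𝓕⁻ (dilateSymbol m hl.ne' c) : 𝓢(E, ℂ)) x =
      (l ^ Module.finrank ℝ E : ℝ) •
        (Real.fourierChar (inner ℝ c (l • x)) • (𝓕⁻ m : 𝓢(E, ℂ)) (l • x)) := by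
  rw [SchwartzMap.fourierInv_coe, SchwartzMap.fourierInv_coe, Real.fourierInv_eq,
    Real.fourierInv_eq]
  obtain ⟨Φ, hΦ⟩ : ∃ Φ : E → ℂ, Φ = fun η : E =>
    Real.fourierChar (inner ℝ η (l • x)) • m (η - c) := ⟨_, rfl⟩
  have h1 : ∀ ξ : E, Real.fourierChar (inner ℝ ξ x) • dilateSymbol m hl.ne' c ξ =
      Φ (l⁻¹ • ξ) := by
    intro ξ
    simp only [hΦ, dilateSymbol_apply, inner_smul_left, inner_smul_right]
    congr 3
    simp [hl.ne']
  simp_rw [h1]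
  rw [Measure.integral_comp_inv_smul, abs_of_pos (by positivity), hΦ]
  congr 1
  rw [← integral_add_right_eq_self _ c]
  have h2 : ∀ η : E, Real.fourierChar (inner ℝ (η + c) (l • x)) • m (η + c - c) =
      Real.fourierChar (inner ℝ c (l • x)) • (Real.fourierChar (inner ℝ η (l • x)) • m η) := by
    intro η
    rw [add_sub_cancel_right, smul_smul, ← AddChar.map_add_eq_mul, inner_add_left,
      add_comm (inner ℝ c _)]
  simp_rw [h2, Circle.smul_def, integral_smul]

/-- Reduction of level `l = 2^j` to unit scale: the Jacobian `l^{-d}` cancels the amplitude `l^d` of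
the dilated kernel. -/
lemma modConv_fourierInv_dilateSymbol (m : 𝓢(E, ℂ)) {l : ℝ} (hl : 0 < l) (c : E) (g : E → ℂ)
    (x : E) :
    modConv (𝓕⁻ (dilateSymbol m hl.ne' c)) 0 g x =
      modConv (𝓕⁻ m) c (fun z => g (l⁻¹ • z)) (l • x) := by
  have h : ∀ z, modIntegrand (𝓕⁻ (dilateSymbol m hl.ne' c)) 0 g x z =
      (l ^ Module.finrank ℝ E : ℝ) •
        (fun w => modIntegrand (𝓕⁻ m) c (fun z => g (l⁻¹ • z)) (l • x) w) (l • z) := by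
    intro z
    simp only [modIntegrand, fourierInv_dilateSymbol m hl, inner_zero_left, AddChar.map_zero_eq_one,
      one_smul, smul_sub, inv_smul_smul₀ hl.ne', Circle.smul_def, smul_eq_mul, Complex.real_smul]
    ring
  rw [modConv, modConv]
  simp_rw [h]
  rw [integral_smul, Measure.integral_comp_smul, smul_smul, abs_of_pos (by positivity),
    mul_inv_cancel₀ (by positivity), one_smul]

lemma modIntegrand_zero (K : 𝓢(E, ℂ)) (g : E → ℂ) (x z : E) :
    modIntegrand K 0 g x z = K (x - z) * g z := by
  simp [modIntegrand]

lemma integrable_mul_modIntegrand (K ψ : 𝓢(E, ℂ)) {p : ℝ≥0∞} (hp : 1 ≤ p) {g : E → ℂ}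
    (hgm : Measurable g) (hg : MemLp g p volume) :
    Integrable (fun q : E × E => ψ q.1 * modIntegrand K 0 g q.1 q.2) (volume.prod volume) := by
  obtain ⟨D, hD, hK⟩ := exists_norm_le_weight_sq K
  obtain ⟨C, hC, hsup⟩ := exists_weightConv_le E hp
  have hψ : Measurable (fun q : E × E => ψ q.1) := (ψ.continuous.comp continuous_fst).measurable
  have hm : Measurable (fun q : E × E => ψ q.1 * modIntegrand K 0 g q.1 q.2) :=
    hψ.mul (measurable_modIntegrand K 0 hgm)
  refine ⟨hm.aestronglyMeasurable, ?_⟩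
  rw [HasFiniteIntegral, lintegral_prod _ hm.enorm.aemeasurable]
  have h1 : ∀ x, ∫⁻ z, ‖ψ x * modIntegrand K 0 g x z‖ₑ ≤
      ‖ψ x‖ₑ * (ENNReal.ofReal D * (C * eLpNorm g p volume)) := by
    intro x
    simp_rw [enorm_mul]
    rw [lintegral_const_mul' _ _ enorm_ne_top]
    refine mul_le_mul_right ?_ _
    refine le_trans ?_ (mul_le_mul_right (hsup g hgm x) _)
    rw [weightConv, ← lintegral_const_mul' _ _ ENNReal.ofReal_ne_top]
    refine lintegral_mono fun z => ?_
    rw [enorm_modIntegrand, ← mul_assoc, ← ENNReal.ofReal_mul hD]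
    gcongr
    rw [← ofReal_norm]
    refine ENNReal.ofReal_le_ofReal ((hK _).trans ?_)
    have := weight_pos (x - z)
    have := weight_le_one (x - z)
    gcongr
    nlinarith
  have hfin : ENNReal.ofReal D * (C * eLpNorm g p volume) ≠ ⊤ :=
    ENNReal.mul_ne_top ENNReal.ofReal_ne_top (ENNReal.mul_ne_top hC hg.2.ne)
  refine (lintegral_mono h1).trans_lt ?_
  rw [lintegral_mul_const' _ _ hfin]
  exact ENNReal.mul_lt_top ψ.integrable.2 hfin.lt_top

/-- A Fourier multiplier with Schwartz symbol acts on `L^p` as a convolution. -/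
lemma fourierMultiplierCLM_toTemperedDistribution_apply (m ψ : 𝓢(E, ℂ)) {p : ℝ≥0∞} [Fact (1 ≤ p)]
    (g : Lp ℂ p (volume : Measure E)) :
    TemperedDistribution.fourierMultiplierCLM ℂ (m : E → ℂ) (Lp.toTemperedDistribution g) ψ =
      ∫ x, ψ x * modConv (𝓕⁻ m) 0 g x := by
  have hgm : Measurable g := (Lp.stronglyMeasurable g).measurable
  have hint := integrable_mul_modIntegrand (𝓕⁻ m) ψ Fact.out hgm (Lp.memLp g)
  rw [TemperedDistribution.fourierMultiplierCLM_apply_apply, Lp.toTemperedDistribution_apply]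
  simp_rw [fourier_smulLeft_fourierInv, smul_eq_mul, ← integral_mul_const]
  rw [integral_integral_swap]
  · refine integral_congr_ae (ae_of_all _ fun x => ?_)
    simp only [modConv]
    rw [← integral_const_mul]
    simp_rw [modIntegrand_zero, mul_assoc]
  · refine hint.swap.congr (ae_of_all _ fun q => ?_)
    simp only [Function.comp_apply, Prod.fst_swap, Prod.snd_swap, modIntegrand_zero,
      Function.uncurry, mul_assoc]

/-- The two exponents matter: a piece known in `L^p` is identified, after convolution, as an element
of `L^r`. -/
lemma toTemperedDistribution_eq_fourierMultiplierCLM (m : 𝓢(E, ℂ)) {p r : ℝ≥0∞} [Fact (1 ≤ p)]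
    [Fact (1 ≤ r)] (g : Lp ℂ p (volume : Measure E))
    (hu : MemLp (modConv (𝓕⁻ m) 0 g) r volume) :
    Lp.toTemperedDistribution (hu.toLp _) =
      TemperedDistribution.fourierMultiplierCLM ℂ (m : E → ℂ) (Lp.toTemperedDistribution g) := by
  ext ψ
  rw [fourierMultiplierCLM_toTemperedDistribution_apply, Lp.toTemperedDistribution_apply]
  refine integral_congr_ae ?_
  filter_upwards [hu.coeFn_toLp] with x hx
  rw [hx, smul_eq_mul]

end Multiplier

section DistLpNorm

variable {d : ℕ}

/-- Hence the infimum in `distLpNorm` runs over at most one function. -/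
lemma toTemperedDistribution_injective (p : ℝ≥0∞) [Fact (1 ≤ p)] :
    Function.Injective (Lp.toTemperedDistribution : Lp ℂ p (volume : Measure (Eu d)) → 𝓢'(Eu d, ℂ)) :=
  LinearMap.ker_eq_bot.1 (Lp.ker_toTemperedDistributionCLM_eq_bot (F := ℂ) (p := p)
    (μ := (volume : Measure (Eu d))))

lemma distLpNorm_toTemperedDistribution {p : ℝ≥0∞} [Fact (1 ≤ p)]
    (g : Lp ℂ p (volume : Measure (Eu d))) :
    distLpNorm p (Lp.toTemperedDistribution g) = ‖g‖ₑ := by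
  refine le_antisymm (iInf₂_le (f := fun (g' : Lp ℂ p (volume : Measure (Eu d)))
    (_ : Lp.toTemperedDistribution g' = Lp.toTemperedDistribution g) => ‖g'‖ₑ) g rfl) (le_iInf₂ fun g' h => ?_)
  rw [toTemperedDistribution_injective p h]

lemma exists_toTemperedDistribution_eq {p : ℝ≥0∞} [Fact (1 ≤ p)] {T : 𝓢'(Eu d, ℂ)}
    (h : distLpNorm p T < ⊤) :
    ∃ g : Lp ℂ p (volume : Measure (Eu d)), Lp.toTemperedDistribution g = T := by
  simp only [distLpNorm, iInf_lt_iff] at h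
  obtain ⟨g, hg, -⟩ := h
  exact ⟨g, hg⟩

end DistLpNorm

end

/-! ### Lattice counting, the box operators and their fattened symbols. -/

section

variable {d : ℕ}

section Lattice

lemma lattice_sub (k l : Fin d → ℤ) : lattice (k - l) = lattice k - lattice l := by
  ext i; simp [lattice]

lemma abs_le_norm_lattice (k : Fin d → ℤ) (i : Fin d) : |(k i : ℝ)| ≤ ‖lattice k‖ :=
  PiLp.norm_apply_le (lattice k) i

lemma finite_norm_lattice_le (B : ℝ) : {k : Fin d → ℤ | ‖lattice k‖ ≤ B}.Finite := by
  refine (Set.finite_Icc (fun _ => -⌈B⌉) (fun _ => ⌈B⌉)).subset fun k hk => ?_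
  have h : ∀ i, |(k i : ℝ)| ≤ ⌈B⌉ := fun i =>
    ((abs_le_norm_lattice k i).trans hk).trans (Int.le_ceil B)
  refine Set.mem_Icc.2 ⟨fun i => ?_, fun i => ?_⟩
  · have := (abs_le.1 (h i)).1
    exact_mod_cast this
  · have := (abs_le.1 (h i)).2
    exact_mod_cast this

/-- The map `l ↦ k - l` sends the neighbours of `k` into one fixed ball of lattice points, so the
count is uniform in `k`. -/
lemma exists_card_filter_lattice_le (c B : ℝ) (hc : 0 < c) :
    ∃ N : ℕ, ∀ (S : Finset (Fin d → ℤ)) (k : Fin d → ℤ),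
      (S.filter fun l => ‖c • lattice k - c • lattice l‖ < B).card ≤ N := by
  have hfin := finite_norm_lattice_le (d := d) (B / c)
  refine ⟨hfin.toFinset.card, fun S k => Finset.card_le_card_of_injOn (fun l => k - l) ?_ ?_⟩
  · intro l hl
    have h := (Finset.mem_filter.1 hl).2
    rw [← smul_sub, ← lattice_sub, norm_smul, Real.norm_of_nonneg hc.le] at h
    simp only [Set.Finite.coe_toFinset, Set.mem_ofPred_eq]
    rw [le_div_iff₀ hc, mul_comm]
    exact h.le
  · intro l _ l' _ h
    exact sub_right_injective h

end Lattice

section Cutoff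

variable {χ : Eu d → ℝ}

lemma IsCubeCutoff.eq_zero_of_lt_norm (hχ : IsCubeCutoff χ) {ξ : Eu d} (h : d + 1 < ‖ξ‖) :
    χ ξ = 0 := by
  by_contra h0
  have hle : ∀ i, |ξ i| ≤ 3 / 4 := by
    intro i
    by_contra hi
    exact h0 (hχ.eq_zero ξ ⟨i, not_le.1 hi⟩)
  have h1 : ‖ξ‖ ^ 2 ≤ d := by
    rw [EuclideanSpace.norm_sq_eq]
    calc ∑ i, ‖ξ i‖ ^ 2 ≤ ∑ _i : Fin d, (1 : ℝ) := by
          refine Finset.sum_le_sum fun i _ => ?_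
          have := hle i
          rw [Real.norm_eq_abs]
          nlinarith [abs_nonneg (ξ i)]
      _ = d := by simp
  nlinarith [Nat.cast_nonneg (α := ℝ) d]

/-- The symbol of `□_{j,k}` for Mathlib's normalization of the Fourier transform. -/
def boxSymbol (χ : Eu d → ℝ) (j : ℤ) (k : Fin d → ℤ) (ξ : Eu d) : ℂ :=
  (cutoff χ j k ((2 * Real.pi) • ξ) : ℂ)

lemma IsCubeCutoff.boxSymbol_eq_zero (hχ : IsCubeCutoff χ) {j : ℤ} {k : Fin d → ℤ} {ξ : Eu d}
    (h : d + 1 < ‖(2 : ℝ) ^ (-j) • (2 * Real.pi) • ξ - lattice k‖) : boxSymbol χ j k ξ = 0 := by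
  rw [boxSymbol, cutoff, hχ.eq_zero_of_lt_norm h, Complex.ofReal_zero]

lemma norm_dilate (j : ℤ) (ξ : Eu d) :
    ‖(2 : ℝ) ^ (-j) • (2 * Real.pi) • ξ‖ = 2 ^ (-j) * (2 * Real.pi) * ‖ξ‖ := by
  rw [norm_smul, norm_smul, Real.norm_of_nonneg (by positivity), Real.norm_of_nonneg (by positivity)]
  ring

lemma IsCubeCutoff.boxSymbol_contDiff (hχ : IsCubeCutoff χ) (j : ℤ) (k : Fin d → ℤ) :
    ContDiff ℝ ∞ (boxSymbol χ j k) := by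
  refine Complex.ofRealCLM.contDiff.comp (hχ.smooth.comp ?_)
  exact ((contDiff_id.const_smul (2 * Real.pi)).const_smul ((2 : ℝ) ^ (-j))).sub contDiff_const

lemma IsCubeCutoff.boxSymbol_hasCompactSupport (hχ : IsCubeCutoff χ) (j : ℤ) (k : Fin d → ℤ) :
    HasCompactSupport (boxSymbol χ j k) := by
  refine HasCompactSupport.of_support_subset_isCompact (isCompact_closedBall (0 : Eu d)
    ((d + 1 + ‖lattice k‖) / (2 ^ (-j) * (2 * Real.pi)))) fun ξ hξ => ?_
  by_contra h
  refine hξ (hχ.boxSymbol_eq_zero ?_)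
  rw [mem_closedBall_zero_iff, not_le, div_lt_iff₀ (by positivity), mul_comm, ← norm_dilate] at h
  have := norm_sub_norm_le ((2 : ℝ) ^ (-j) • (2 * Real.pi) • ξ) (lattice k)
  linarith

lemma IsCubeCutoff.boxSymbol_hasTemperateGrowth (hχ : IsCubeCutoff χ) (j : ℤ) (k : Fin d → ℤ) :
    (boxSymbol χ j k).HasTemperateGrowth :=
  (hχ.boxSymbol_hasCompactSupport j k).hasTemperateGrowth (hχ.boxSymbol_contDiff j k)

/-- Only finitely many cubes of level `j` meet the compact support of `𝓕⁻ ψ`, so the sum is finite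
and the partition of unity applies under `T`. -/
lemma IsCubeCutoff.hasSum_box_apply (hχ : IsCubeCutoff χ) (j : ℤ) (T : 𝓢'(Eu d, ℂ))
    {ψ : 𝓢(Eu d, ℂ)} (hψ : HasCompactSupport (𝓕⁻ ψ : 𝓢(Eu d, ℂ))) :
    HasSum (fun k => box χ j k T ψ) (T ψ) := by
  obtain ⟨B, hB⟩ := hψ.isCompact.isBounded.subset_closedBall (0 : Eu d)
  have hfin := finite_norm_lattice_le (d := d) (d + 1 + 2 ^ (-j) * (2 * Real.pi) * B)
  set S := hfin.toFinset
  have hzero : ∀ k ∉ S, ∀ ξ, (𝓕⁻ ψ : 𝓢(Eu d, ℂ)) ξ ≠ 0 → boxSymbol χ j k ξ = 0 := by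
    intro k hk ξ hξ
    have h1 : ‖ξ‖ ≤ B := by
      rw [← mem_closedBall_zero_iff]
      exact hB (subset_tsupport _ hξ)
    have h2 : d + 1 + 2 ^ (-j) * (2 * Real.pi) * B < ‖lattice k‖ := by
      rw [← not_le]
      intro h
      exact hk (hfin.mem_toFinset.2 h)
    apply hχ.boxSymbol_eq_zero
    have h3 : 2 ^ (-j) * (2 * Real.pi) * ‖ξ‖ ≤ 2 ^ (-j) * (2 * Real.pi) * B := by gcongr
    have h4 := norm_sub_norm_le (lattice k) ((2 : ℝ) ^ (-j) • (2 * Real.pi) • ξ)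
    rw [norm_dilate, norm_sub_rev] at h4
    linarith
  have hbox : ∀ k, box χ j k T ψ =
      T (𝓕 (SchwartzMap.smulLeftCLM ℂ (boxSymbol χ j k) (𝓕⁻ ψ))) := fun k =>
    TemperedDistribution.fourierMultiplierCLM_apply_apply _ _ _
  have hout : ∀ k ∉ S, box χ j k T ψ = 0 := by
    intro k hk
    have : SchwartzMap.smulLeftCLM ℂ (boxSymbol χ j k) (𝓕⁻ ψ) = 0 := by
      ext ξ
      rw [SchwartzMap.smulLeftCLM_apply_apply (hχ.boxSymbol_hasTemperateGrowth j k)]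
      by_cases h : (𝓕⁻ ψ : 𝓢(Eu d, ℂ)) ξ = 0
      · simp [h]
      · simp [hzero k hk ξ h]
    rw [hbox, this]
    simp
  have hsum : ∑ k ∈ S, SchwartzMap.smulLeftCLM ℂ (boxSymbol χ j k) (𝓕⁻ ψ) = 𝓕⁻ ψ := by
    ext ξ
    rw [_root_.sum_apply]
    simp_rw [SchwartzMap.smulLeftCLM_apply_apply (hχ.boxSymbol_hasTemperateGrowth j _)]
    by_cases h : (𝓕⁻ ψ : 𝓢(Eu d, ℂ)) ξ = 0
    · simp [h]
    · have h1 := Complex.hasSum_ofReal.2 (hχ.partition ((2 : ℝ) ^ (-j) • (2 * Real.pi) • ξ))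
      have h2 : HasSum (fun k => boxSymbol χ j k ξ) (∑ k ∈ S, boxSymbol χ j k ξ) :=
        hasSum_sum_of_ne_finset_zero fun k hk => hzero k hk ξ h
      have h3 : ∑ k ∈ S, boxSymbol χ j k ξ = 1 := by
        simpa using h2.unique h1
      rw [← Finset.sum_smul, h3, one_smul]
  have hval : ∑ k ∈ S, box χ j k T ψ = T ψ := by
    simp_rw [hbox]
    rw [← map_sum, ← FourierTransform.fourier_sum, hsum, FourierTransform.fourier_fourierInv_eq]
  rw [← hval]
  exact hasSum_sum_of_ne_finset_zero hout

/-- A bump function which is equal to one on the support of the cutoff functions. -/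
def fatBump (d : ℕ) : ContDiffBump (0 : Eu d) := ⟨d + 1, d + 2, by positivity, by linarith⟩

/-- The radius is not sharp: the factor `2π > 1` is simply discarded. -/
lemma fatBump_eq_zero {ξ : Eu d} (h : d + 2 ≤ ‖ξ‖) : fatBump d ((2 * Real.pi) • ξ) = 0 := by
  apply ContDiffBump.zero_of_le_dist
  rw [dist_zero_right, norm_smul, Real.norm_of_nonneg (by positivity)]
  have := Real.pi_gt_three
  change (d : ℝ) + 2 ≤ _
  nlinarith [norm_nonneg ξ]

lemma fatBump_hasCompactSupport :
    HasCompactSupport fun ξ : Eu d => (fatBump d ((2 * Real.pi) • ξ) : ℂ) := by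
  refine HasCompactSupport.of_support_subset_isCompact
    (isCompact_closedBall (0 : Eu d) (d + 2)) fun ξ hξ => ?_
  by_contra h
  rw [mem_closedBall_zero_iff, not_le] at h
  exact hξ (by simp only [fatBump_eq_zero h.le, Complex.ofReal_zero])

lemma fatBump_contDiff :
    ContDiff ℝ ∞ fun ξ : Eu d => (fatBump d ((2 * Real.pi) • ξ) : ℂ) :=
  Complex.ofRealCLM.contDiff.comp
    ((fatBump d).contDiff.comp (contDiff_id.const_smul (2 * Real.pi)))

/-- A Schwartz function which is equal to one on the support of the cutoff functions, for
Mathlib's normalization of the Fourier transform. -/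
def fatSymbol (d : ℕ) : 𝓢(Eu d, ℂ) :=
  (fatBump_hasCompactSupport (d := d)).toSchwartzMap fatBump_contDiff

lemma fatSymbol_apply (ξ : Eu d) : fatSymbol d ξ = (fatBump d ((2 * Real.pi) • ξ) : ℂ) := rfl

lemma fatSymbol_eq_one {ξ : Eu d} (h : ‖(2 * Real.pi) • ξ‖ ≤ d + 1) : fatSymbol d ξ = 1 := by
  rw [fatSymbol_apply, (fatBump d).one_of_mem_closedBall (mem_closedBall_zero_iff.2 h),
    Complex.ofReal_one]

lemma fatSymbol_eq_zero {ξ : Eu d} (h : d + 2 ≤ ‖ξ‖) : fatSymbol d ξ = 0 := by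
  rw [fatSymbol_apply, fatBump_eq_zero h, Complex.ofReal_zero]

lemma bandLimited_fourierInv_fatSymbol :
    BandLimited (d + 2) (𝓕⁻ (fatSymbol d) : 𝓢(Eu d, ℂ)) := by
  intro ξ hξ
  rw [SchwartzMap.fourierInv_apply_eq]
  simp only [FourierTransform.fourier_fourierInv_eq, SchwartzMap.compCLMOfContinuousLinearEquiv_apply]
  apply fatSymbol_eq_zero
  simpa using hξ

lemma fourierInv_fatSymbol_ne_zero : (𝓕⁻ (fatSymbol d) : 𝓢(Eu d, ℂ)) ≠ 0 := by
  intro h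
  have h1 : 𝓕 (𝓕⁻ (fatSymbol d) : 𝓢(Eu d, ℂ)) 0 = 1 := by
    rw [FourierTransform.fourier_fourierInv_eq]
    exact fatSymbol_eq_one (by simp; positivity)
  rw [h] at h1
  simp at h1

/-- The reproducing identity: the fat symbol is one wherever the symbol of the box is nonzero. The
centre carries `(2π)⁻¹` because of the change of Fourier convention. -/
lemma IsCubeCutoff.fourierMultiplierCLM_box (hχ : IsCubeCutoff χ) (j : ℤ) (k : Fin d → ℤ)
    (hl : (2 : ℝ) ^ j ≠ 0) (T : 𝓢'(Eu d, ℂ)) :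
    TemperedDistribution.fourierMultiplierCLM ℂ
      (dilateSymbol (fatSymbol d) hl ((2 * Real.pi)⁻¹ • lattice k) : Eu d → ℂ) (box χ j k T) =
      box χ j k T := by
  have h := TemperedDistribution.fourierMultiplierCLM_fourierMultiplierCLM_apply
    (hχ.boxSymbol_hasTemperateGrowth j k)
    (dilateSymbol (fatSymbol d) hl ((2 * Real.pi)⁻¹ • lattice k)).hasTemperateGrowth T
  refine h.trans ?_
  have h2 : boxSymbol χ j k * (dilateSymbol (fatSymbol d) hl ((2 * Real.pi)⁻¹ • lattice k) :
      Eu d → ℂ) = boxSymbol χ j k := by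
    ext ξ
    rw [Pi.mul_apply, dilateSymbol_apply]
    rcases lt_or_ge ((d : ℝ) + 1) ‖(2 : ℝ) ^ (-j) • (2 * Real.pi) • ξ - lattice k‖ with hlt | hge
    · rw [hχ.boxSymbol_eq_zero hlt, zero_mul]
    · rw [fatSymbol_eq_one, mul_one]
      rw [smul_sub, smul_inv_smul₀ (by positivity), smul_comm, ← zpow_neg]
      exact hge
  rw [h2]
  rfl

end Cutoff

end

/-! ### The estimate at each level, and sufficiency. -/

section

variable {d : ℕ} {χ : Eu d → ℝ}

/-- The fattened symbol of `□_{j,k}`. -/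
def fatBoxSymbol (j : ℤ) (k : Fin d → ℤ) : 𝓢(Eu d, ℂ) :=
  dilateSymbol (fatSymbol d) (zpow_pos (two_pos (α := ℝ)) j).ne' ((2 * Real.pi)⁻¹ • lattice k)

lemma IsCubeCutoff.fourierMultiplierCLM_fatBoxSymbol_box (hχ : IsCubeCutoff χ) (j : ℤ)
    (k : Fin d → ℤ) (T : 𝓢'(Eu d, ℂ)) :
    TemperedDistribution.fourierMultiplierCLM ℂ (fatBoxSymbol j k : Eu d → ℂ) (box χ j k T) =
      box χ j k T :=
  hχ.fourierMultiplierCLM_box j k _ T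

lemma exists_eLpNorm_sum_modConv_fatBoxSymbol_le {p q r : ℝ≥0∞} (hp : 1 ≤ p) (hq : 1 ≤ q)
    (hqt : q ≠ ⊤) (hr : 1 ≤ r) (hpr : p ≤ r) (hqr : q ≤ r) (hqr' : r ≤ ENNReal.conjExponent q) :
    ∃ C : ℝ≥0∞, C ≠ ⊤ ∧ ∀ (j : ℤ) (A : Finset (Fin d → ℤ)) (g : (Fin d → ℤ) → Eu d → ℂ),
      (∀ k, Measurable (g k)) → (∀ k, MemLp (g k) p volume) →
      eLpNorm (fun x => ∑ k ∈ A, modConv (𝓕⁻ (fatBoxSymbol j k)) 0 (g k) x) r volume ≤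
        C * ENNReal.ofReal (((2 : ℝ) ^ j) ^ (d * p⁻¹.toReal - d * r⁻¹.toReal)) *
          (∑ k ∈ A, eLpNorm (g k) p volume ^ q.toReal) ^ (1 / q.toReal) := by
  -- The frequencies are the points of `(2π)⁻¹ ℤ^d`, and `d + 2` is the spectral radius `R` of the
  -- kernel.
  obtain ⟨N, hN⟩ := exists_card_filter_lattice_le (d := d) (2 * Real.pi)⁻¹ (4 * (d + 2))
    (by positivity)
  obtain ⟨C, hC, hest⟩ := exists_eLpNorm_sum_modConv_le fourierInv_fatSymbol_ne_zero
    bandLimited_fourierInv_fatSymbol hN hp hq hr hpr hqr hqr'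
  have hq0 : 0 < q.toReal := ENNReal.toReal_pos (by positivity) hqt
  refine ⟨C, hC, fun j A g hgm hg => ?_⟩
  obtain ⟨l, hl⟩ : ∃ l : ℝ, l = 2 ^ j := ⟨_, rfl⟩
  have hl0 : 0 < l := hl ▸ zpow_pos two_pos j
  have hcm : ∀ k, Measurable fun z => g k (l⁻¹ • z) := fun k =>
    (hgm k).comp (measurable_const_smul l⁻¹)
  have hnorm : ∀ k, eLpNorm (fun z => g k (l⁻¹ • z)) p volume =
      ENNReal.ofReal (l ^ (d * p⁻¹.toReal)) * eLpNorm (g k) p volume := by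
    intro k
    rw [eLpNorm_comp_smul (hgm k) p (inv_pos.2 hl0), finrank_euclideanSpace_fin,
      Real.rpow_neg (by positivity), Real.inv_rpow hl0.le, inv_inv]
  obtain ⟨F, hF⟩ : ∃ F : Eu d → ℂ, F = fun y => ∑ k ∈ A,
    modConv (𝓕⁻ (fatSymbol d)) ((2 * Real.pi)⁻¹ • lattice k) (fun z => g k (l⁻¹ • z)) y := ⟨_, rfl⟩
  have hFm : Measurable F := by
    rw [hF]
    exact Finset.measurable_fun_sum _ fun k _ => measurable_modConv _ _ (hcm k)
  have h1 : (fun x => ∑ k ∈ A, modConv (𝓕⁻ (fatBoxSymbol j k)) 0 (g k) x) = fun x => F (l • x) := by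
    ext x
    rw [hF]
    refine Finset.sum_congr rfl fun k _ => ?_
    subst hl
    exact modConv_fourierInv_dilateSymbol _ hl0 _ _ _
  rw [h1, eLpNorm_comp_smul hFm r hl0, finrank_euclideanSpace_fin, ← hl]
  have h2 := hest A (fun k z => g k (l⁻¹ • z)) hcm fun k =>
    ⟨(hcm k).aestronglyMeasurable, by
      rw [hnorm]; exact ENNReal.mul_lt_top ENNReal.ofReal_lt_top (hg k).2⟩
  rw [hF]
  refine (mul_le_mul_right h2 _).trans (le_of_eq ?_)
  simp_rw [hnorm, ENNReal.mul_rpow_of_nonneg _ _ hq0.le]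
  rw [← Finset.mul_sum, ENNReal.mul_rpow_of_nonneg _ _ (by positivity), ← ENNReal.rpow_mul,
    mul_one_div_cancel hq0.ne', ENNReal.rpow_one, sub_eq_neg_add, Real.rpow_add hl0,
    ENNReal.ofReal_mul (by positivity)]
  ring

lemma modNorm_eq {p q : ℝ≥0∞} [Fact (1 ≤ p)] (hq0 : q ≠ 0) (hqt : q ≠ ⊤) (j : ℤ) (T : 𝓢'(Eu d, ℂ)) :
    modNorm χ p q j T =
      (∑' k, distLpNorm p (box χ j k T) ^ q.toReal) ^ (1 / q.toReal) := by
  rw [modNorm, eLpNorm_eq_lintegral_rpow_enorm_toReal hq0 hqt, lintegral_count]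
  simp

lemma tsum_distLpNorm_rpow {p q : ℝ≥0∞} [Fact (1 ≤ p)] (hq0 : q ≠ 0) (hqt : q ≠ ⊤) (j : ℤ)
    (T : 𝓢'(Eu d, ℂ)) : ∑' k, distLpNorm p (box χ j k T) ^ q.toReal =
      modNorm χ p q j T ^ q.toReal := by
  rw [modNorm_eq hq0 hqt, ← ENNReal.rpow_mul, one_div_mul_cancel, ENNReal.rpow_one]
  exact (ENNReal.toReal_pos hq0 hqt).ne'

/-- Elements of `M_{p,q}^{[j]}` are functions in `L^r`. -/
lemma IsCubeCutoff.exists_toTemperedDistribution_eq (hχ : IsCubeCutoff χ) {p q r : ℝ≥0∞}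
    [Fact (1 ≤ p)] [Fact (1 ≤ r)] (hq : 1 ≤ q) (hqt : q ≠ ⊤) (hpr : p ≤ r) (hqr : q ≤ r)
    (hqr' : r ≤ ENNReal.conjExponent q) :
    ∃ C : ℝ≥0∞, C ≠ ⊤ ∧ ∀ (j : ℤ) (T : 𝓢'(Eu d, ℂ)), modNorm χ p q j T < ⊤ →
      ∃ h : Lp ℂ r (volume : Measure (Eu d)), Lp.toTemperedDistribution h = T ∧
        ‖h‖ₑ ≤ C * ENNReal.ofReal (((2 : ℝ) ^ j) ^ (d * p⁻¹.toReal - d * r⁻¹.toReal)) *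
          modNorm χ p q j T := by
  obtain ⟨C, hC, hest⟩ := exists_eLpNorm_sum_modConv_fatBoxSymbol_le (d := d)
    (Fact.out : 1 ≤ p) hq hqt (Fact.out : 1 ≤ r) hpr hqr hqr'
  have hq0 : q ≠ 0 := by positivity
  have hqpos : 0 < q.toReal := ENNReal.toReal_pos hq0 hqt
  refine ⟨C, hC, fun j T hT => ?_⟩
  obtain ⟨M, hM⟩ : ∃ M, M = C * ENNReal.ofReal
    (((2 : ℝ) ^ j) ^ (d * p⁻¹.toReal - d * r⁻¹.toReal)) := ⟨_, rfl⟩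
  have hMt : M ≠ ⊤ := hM ▸ ENNReal.mul_ne_top hC ENNReal.ofReal_ne_top
  rw [← hM]
  have hsumT := tsum_distLpNorm_rpow (χ := χ) (p := p) hq0 hqt j T
  have hsumfin : ∑' k, distLpNorm p (box χ j k T) ^ q.toReal ≠ ⊤ := by
    rw [hsumT]
    exact ENNReal.rpow_ne_top_of_nonneg hqpos.le hT.ne
  have hk : ∀ k, ∃ g : Lp ℂ p (volume : Measure (Eu d)),
      Lp.toTemperedDistribution g = box χ j k T := fun k =>
    ScalingModulation.exists_toTemperedDistribution_eq (lt_top_iff_ne_top.2 fun h =>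
      ENNReal.ne_top_of_tsum_ne_top hsumfin k (by rw [h, ENNReal.top_rpow_of_pos hqpos]))
  choose g hg using hk
  have hgn : ∀ k, eLpNorm (g k) p volume = distLpNorm p (box χ j k T) := fun k => by
    rw [← hg, distLpNorm_toTemperedDistribution, Lp.enorm_def]
  have hgm : ∀ k, Measurable (g k) := fun k => (Lp.stronglyMeasurable (g k)).measurable
  obtain ⟨u, hu⟩ : ∃ u : (Fin d → ℤ) → Eu d → ℂ,
    u = fun k => modConv (𝓕⁻ (fatBoxSymbol j k)) 0 (g k) := ⟨_, rfl⟩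
  have hsum_le : ∀ A : Finset (Fin d → ℤ), eLpNorm (fun x => ∑ k ∈ A, u k x) r volume ≤
      M * (∑ k ∈ A, distLpNorm p (box χ j k T) ^ q.toReal) ^ (1 / q.toReal) := by
    intro A
    have := hest j A (fun k => g k) hgm (fun k => Lp.memLp (g k))
    simp_rw [hgn] at this
    rw [hu, hM]
    exact this
  have hum : ∀ k, MemLp (u k) r volume := by
    intro k
    refine ⟨by rw [hu]; exact (measurable_modConv _ _ (hgm k)).aestronglyMeasurable, ?_⟩
    have := hsum_le {k}
    simp only [Finset.sum_singleton] at this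
    refine this.trans_lt (ENNReal.mul_lt_top hMt.lt_top (ENNReal.rpow_lt_top_of_nonneg
      (by positivity) (ENNReal.ne_top_of_tsum_ne_top hsumfin k)))
  obtain ⟨H, hH⟩ : ∃ H : (Fin d → ℤ) → Lp ℂ r (volume : Measure (Eu d)),
    H = fun k => (hum k).toLp (u k) := ⟨_, rfl⟩
  have hHbox : ∀ k, Lp.toTemperedDistribution (H k) = box χ j k T := by
    intro k
    have h1 := toTemperedDistribution_eq_fourierMultiplierCLM (fatBoxSymbol j k) (g k)
      (r := r) (by have := hum k; rwa [hu] at this)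
    rw [hg, hχ.fourierMultiplierCLM_fatBoxSymbol_box] at h1
    rw [← h1, hH]
    congr 1
    subst hu
    rfl
  have hHnorm : ∀ A : Finset (Fin d → ℤ), ‖∑ k ∈ A, H k‖ₑ ≤
      M * (∑ k ∈ A, distLpNorm p (box χ j k T) ^ q.toReal) ^ (1 / q.toReal) := by
    intro A
    refine le_trans (le_of_eq ?_) (hsum_le A)
    have hmem : MemLp (fun x => ∑ k ∈ A, u k x) r volume := memLp_finsetSum A fun k _ => hum k
    rw [← Lp.enorm_toLp hmem]
    congr 1
    refine Lp.ext ((Lp.coeFn_finsetSum A H).trans ?_)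
    refine EventuallyEq.trans ?_ hmem.coeFn_toLp.symm
    have : ∀ᵐ x, ∀ k ∈ A, H k x = u k x := by
      rw [Filter.eventually_all_finset]
      intro k _
      rw [hH]
      exact (hum k).coeFn_toLp
    filter_upwards [this] with x hx
    rw [Finset.sum_apply]
    exact Finset.sum_congr rfl hx
  -- The bound for finite sums, applied to sets of indices far out, is a tail of a convergent
  -- series; this uses `q < ∞`.
  have hsummable : Summable H := by
    rw [summable_iff_vanishing_norm]
    intro ε hε
    have hlim : Tendsto (fun s : Finset (Fin d → ℤ) =>
        M * (∑' k : {k // k ∉ s}, distLpNorm p (box χ j k T) ^ q.toReal) ^ (1 / q.toReal))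
        atTop (𝓝 0) := by
      have h := ((ENNReal.continuous_rpow_const (y := 1 / q.toReal)).tendsto 0).comp
        (ENNReal.tendsto_tsum_compl_atTop_zero hsumfin)
      rw [ENNReal.zero_rpow_of_pos (by positivity)] at h
      simpa using ENNReal.Tendsto.const_mul h (Or.inr hMt)
    have hvan : ∃ s : Finset (Fin d → ℤ), ∀ A : Finset (Fin d → ℤ), Disjoint A s →
        M * (∑ k ∈ A, distLpNorm p (box χ j k T) ^ q.toReal) ^ (1 / q.toReal) <
          ENNReal.ofReal ε := by
      obtain ⟨s, hs⟩ := (hlim.eventually_lt_const (ENNReal.ofReal_pos.2 hε)).exists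
      refine ⟨s, fun A hA => lt_of_le_of_lt ?_ hs⟩
      gcongr
      have hsub : ∀ k ∈ A, k ∉ s := fun k hk => Finset.disjoint_left.1 hA hk
      rw [← Finset.tsum_subtype]
      exact ENNReal.tsum_mono_subtype (fun k => distLpNorm p (box χ j k T) ^ q.toReal)
        (s := ↑A) (t := {k | k ∉ s}) fun k hk => hsub k hk
    obtain ⟨s, hs⟩ := hvan
    refine ⟨s, fun A hA => ?_⟩
    have := (hHnorm A).trans_lt (hs A hA)
    rwa [← ofReal_norm, ENNReal.ofReal_lt_ofReal_iff hε] at this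
  refine ⟨∑' k, H k, ?_, ?_⟩
  -- The sum of the boxes is known to equal `T` only on test functions of compact spectrum, and
  -- these determine `T`.
  · refine eq_of_forall_hasCompactSupport fun ψ hψ => ?_
    have h1 := hsummable.hasSum.mapL (Lp.toTemperedDistributionCLM ℂ volume r)
    have h2 := h1.mapL (PointwiseConvergenceCLM.evalCLM (RingHom.id ℂ) ℂ ψ)
    refine HasSum.unique h2 ((hχ.hasSum_box_apply j T hψ).congr_fun fun k => ?_)
    rw [← hHbox k]
    rfl
  · refine le_of_tendsto ((continuous_enorm.tendsto _).comp hsummable.hasSum)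
      (Eventually.of_forall fun A => (hHnorm A).trans ?_)
    rw [modNorm_eq hq0 hqt]
    gcongr
    exact ENNReal.sum_le_tsum A

/-- At level `-n` the scaling constant is `2^{-n(d/p - d/r)} ≤ 2^{-nμ}`, so the `L^r` norms of the
terms are summable against the cost. Uniqueness of limits in the tempered distributions identifies
the sum. -/
lemma IsCubeCutoff.exists_toTemperedDistribution_eq_of_isDecomposition (hχ : IsCubeCutoff χ)
    {p q r : ℝ≥0∞} [Fact (1 ≤ p)] [Fact (1 ≤ r)] (hq : 1 ≤ q) (hqt : q ≠ ⊤) (hpr : p ≤ r)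
    (hqr : q ≤ r) (hqr' : r ≤ ENNReal.conjExponent q) {μ : ℝ}
    (hμ : μ - d * p⁻¹.toReal ≤ -(d * r⁻¹.toReal)) :
    ∃ C : ℝ≥0∞, C ≠ ⊤ ∧ ∀ (T : 𝓢'(Eu d, ℂ)) (F : ℕ → 𝓢'(Eu d, ℂ)), IsDecomposition T F →
      cost χ p q μ F < ⊤ → ∃ h : Lp ℂ r (volume : Measure (Eu d)),
        Lp.toTemperedDistribution h = T ∧ ‖h‖ₑ ≤ C * cost χ p q μ F := by
  obtain ⟨C, hC, hest⟩ := hχ.exists_toTemperedDistribution_eq (p := p) hq hqt hpr hqr hqr'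
  refine ⟨C, hC, fun T F hF hcost => ?_⟩
  have hw : ∀ n : ℕ, (((2 : ℝ) ^ (-(n : ℤ))) ^ (d * p⁻¹.toReal - d * r⁻¹.toReal)) ≤
      (2 : ℝ) ^ (-(n : ℝ) * μ) := by
    intro n
    rw [← Real.rpow_intCast, ← Real.rpow_mul two_pos.le]
    apply Real.rpow_le_rpow_of_exponent_le one_le_two
    push_cast
    nlinarith [Nat.cast_nonneg (α := ℝ) n]
  have hmod : ∀ n : ℕ, modNorm χ p q (-(n : ℤ)) (F n) < ⊤ := by
    intro n
    rw [lt_top_iff_ne_top]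
    intro h
    refine ENNReal.ne_top_of_tsum_ne_top hcost.ne n ?_
    rw [h, ENNReal.mul_top]
    exact (ENNReal.ofReal_pos.2 (by positivity)).ne'
  choose h hhF hhn using fun n : ℕ => hest (-(n : ℤ)) (F n) (hmod n)
  have hle : ∑' n, ‖h n‖ₑ ≤ C * cost χ p q μ F := by
    rw [cost, ← ENNReal.tsum_mul_left]
    refine ENNReal.tsum_le_tsum fun n => (hhn n).trans ?_
    rw [mul_assoc]
    gcongr
    exact hw n
  have hfin : ∑' n, ‖h n‖ₑ ≠ ⊤ := ne_top_of_le_ne_top (ENNReal.mul_ne_top hC hcost.ne) hle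
  have hsummable : Summable h := by
    refine Summable.of_norm ?_
    have := ENNReal.summable_toReal hfin
    simpa using this
  refine ⟨∑' n, h n, ?_, (enorm_tsum_le_tsum_enorm).trans hle⟩
  have h1 := (hsummable.hasSum.mapL (Lp.toTemperedDistributionCLM ℂ volume r)).tendsto_sum_nat
  refine tendsto_nhds_unique h1 (hF.congr fun n => Finset.sum_congr rfl fun k _ => ?_)
  exact (hhF k).symm

/-- Sufficiency of the conditions on the exponents. -/
theorem IsCubeCutoff.embedsInLp (hχ : IsCubeCutoff χ) {p q r : ℝ≥0∞} [Fact (1 ≤ p)]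
    [Fact (1 ≤ r)] (hq : 1 ≤ q) (hpqr : max p q ≤ r) (hqr' : r ≤ ENNReal.conjExponent q) {μ : ℝ}
    (hμ : μ - d * p⁻¹.toReal ≤ -(d * r⁻¹.toReal)) : EmbedsInLp χ p q μ r := by
  obtain ⟨hpr, hqr⟩ := max_le_iff.1 hpqr
  -- For `q = ∞` the dual exponent is `1`, which contradicts `q ≤ r ≤ q'`.
  have hqt : q ≠ ⊤ := by
    rintro rfl
    have := hqr.trans hqr'
    simp [ENNReal.conjExponent] at this
  obtain ⟨C, hC, hest⟩ := hχ.exists_toTemperedDistribution_eq_of_isDecomposition (p := p) hq hqt hpr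
    hqr hqr' hμ
  lift C to ℝ≥0 using hC
  have key : ∀ (T : 𝓢'(Eu d, ℂ)) (F : ℕ → 𝓢'(Eu d, ℂ)), IsDecomposition T F →
      cost χ p q μ F < ⊤ → distLpNorm r T ≤ C * cost χ p q μ F := by
    intro T F hF hcost
    obtain ⟨h, rfl, hh⟩ := hest T F hF hcost
    rwa [distLpNorm_toTemperedDistribution]
  -- The added `1` keeps the constant nonzero, so that it can be divided out of the infimum and
  -- decompositions of infinite cost give a trivial bound.
  refine ⟨C + 1, fun T ⟨F, hF, hcost⟩ => ⟨(key T F hF hcost).trans_lt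
    (ENNReal.mul_lt_top ENNReal.coe_lt_top hcost), ?_⟩⟩
  have hC0 : ((C + 1 : ℝ≥0) : ℝ≥0∞) ≠ 0 := by simp
  rw [mul_comm, ← ENNReal.div_le_iff_le_mul (Or.inl hC0) (Or.inl ENNReal.coe_ne_top)]
  refine le_iInf₂ fun G hG => ?_
  rw [ENNReal.div_le_iff_le_mul (Or.inl hC0) (Or.inl ENNReal.coe_ne_top), mul_comm]
  rcases eq_or_ne (cost χ p q μ G) ⊤ with htop | htop
  · rw [htop, ENNReal.mul_top hC0]
    exact le_top
  · refine (key T G hG htop.lt_top).trans ?_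
    gcongr
    exact le_self_add

end

/-! ### Test functions: localized spectra and wave packets. -/

section

variable {d : ℕ} {χ : Eu d → ℝ}

section Testing

/-- The tempered distribution given by a Schwartz function. -/
abbrev schwartzDist (f : 𝓢(Eu d, ℂ)) : 𝓢'(Eu d, ℂ) :=
  SchwartzMap.toTemperedDistributionCLM (Eu d) ℂ volume f

lemma distLpNorm_schwartzDist (p : ℝ≥0∞) [Fact (1 ≤ p)] (f : 𝓢(Eu d, ℂ)) :
    distLpNorm p (schwartzDist f) = eLpNorm f p volume := by
  rw [schwartzDist, ← Lp.toTemperedDistribution_toLp_eq (p := p), distLpNorm_toTemperedDistribution,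
    Lp.enorm_def]
  exact eLpNorm_congr_ae (f.coeFn_toLp p volume)

lemma modNorm_zero (p q : ℝ≥0∞) [Fact (1 ≤ p)] (j : ℤ) :
    modNorm χ p q j (0 : 𝓢'(Eu d, ℂ)) = 0 := by
  have h : distLpNorm p (0 : 𝓢'(Eu d, ℂ)) = 0 := by
    have := distLpNorm_schwartzDist p (0 : 𝓢(Eu d, ℂ))
    rw [schwartzDist, map_zero] at this
    rw [this]
    exact eLpNorm_zero
  simp only [modNorm, map_zero, h]
  exact eLpNorm_zero

/-- The decomposition with the single term `f` at level `-n` bounds the infimum. -/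
lemma EmbedsInLp.exists_eLpNorm_le {p q r : ℝ≥0∞} [Fact (1 ≤ p)] [Fact (1 ≤ r)] {μ : ℝ}
    (h : EmbedsInLp χ p q μ r) : ∃ C : ℝ≥0, ∀ (n : ℕ) (f : 𝓢(Eu d, ℂ)),
      modNorm χ p q (-(n : ℤ)) (schwartzDist f) < ⊤ →
      eLpNorm f r volume ≤
        C * (ENNReal.ofReal (2 ^ (-(n : ℝ) * μ)) * modNorm χ p q (-(n : ℤ)) (schwartzDist f)) := by
  obtain ⟨C, hC⟩ := h
  refine ⟨C, fun n f hf => ?_⟩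
  obtain ⟨F, hF⟩ : ∃ F : ℕ → 𝓢'(Eu d, ℂ), F = Pi.single n (schwartzDist f) := ⟨_, rfl⟩
  have hFn : F n = schwartzDist f := by rw [hF, Pi.single_eq_same]
  have hF0 : ∀ m, m ≠ n → F m = 0 := fun m hm => by rw [hF, Pi.single_eq_of_ne hm]
  have hdec : IsDecomposition (schwartzDist f) F := by
    rw [IsDecomposition]
    refine tendsto_const_nhds.congr' ?_
    filter_upwards [eventually_gt_atTop n] with N hN
    rw [Finset.sum_eq_single_of_mem n (Finset.mem_range.2 hN) fun m _ hm => hF0 m hm, hFn]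
  have hcost : cost χ p q μ F =
      ENNReal.ofReal (2 ^ (-(n : ℝ) * μ)) * modNorm χ p q (-(n : ℤ)) (schwartzDist f) := by
    rw [cost, tsum_eq_single n fun m hm => by rw [hF0 m hm, modNorm_zero, mul_zero], hFn]
  have hfin : cost χ p q μ F < ⊤ := by
    rw [hcost]
    exact ENNReal.mul_lt_top ENNReal.ofReal_lt_top hf
  rw [← distLpNorm_schwartzDist, ← hcost]
  refine ((hC _ ⟨F, hdec, hfin⟩).2).trans ?_
  gcongr
  exact iInf₂_le F hdec

end Testing

section Localized

lemma IsCubeCutoff.eq_zero_of_ne (hχ : IsCubeCutoff χ) {ξ : Eu d} (hξ : ∀ i, |ξ i| < 1 / 4)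
    {k : Fin d → ℤ} (hk : k ≠ 0) : χ (ξ - lattice k) = 0 := by
  obtain ⟨i, hi⟩ := Function.ne_iff.1 hk
  refine hχ.eq_zero _ ⟨i, ?_⟩
  have h1 : (1 : ℝ) ≤ |(k i : ℝ)| := by exact_mod_cast Int.one_le_abs hi
  have h2 := abs_sub_abs_le_abs_sub (k i : ℝ) (ξ i)
  have h3 : (ξ - lattice k) i = ξ i - k i := rfl
  rw [h3, abs_sub_comm]
  linarith [hξ i]

/-- Within distance `1/4` of the centre every other translate is more than `3/4` away in some
coordinate, so a single term of the partition survives. -/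
lemma IsCubeCutoff.eq_one (hχ : IsCubeCutoff χ) {ξ : Eu d} (hξ : ∀ i, |ξ i| < 1 / 4) :
    χ ξ = 1 := by
  have h := hasSum_single (f := fun k : Fin d → ℤ => χ (ξ - lattice k)) 0
    fun k hk => hχ.eq_zero_of_ne hξ hk
  have h0 : (lattice (0 : Fin d → ℤ)) = 0 := by ext i; simp [lattice]
  simpa [h0] using h.unique (hχ.partition ξ)

/-- The Fourier transform of `f` is supported in the set where the `k`-th cutoff function of level
`j` is equal to one. -/
def LocalizedAt (j : ℤ) (k : Fin d → ℤ) (f : 𝓢(Eu d, ℂ)) : Prop :=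
  ∀ ξ, (𝓕 f : 𝓢(Eu d, ℂ)) ξ ≠ 0 →
    ∀ i, |((2 : ℝ) ^ (-j) • (2 * Real.pi) • ξ - lattice k) i| < 1 / 4

lemma IsCubeCutoff.box_schwartzDist (hχ : IsCubeCutoff χ) {j : ℤ} {k : Fin d → ℤ}
    {f : 𝓢(Eu d, ℂ)} (hf : LocalizedAt j k f) (l : Fin d → ℤ) :
    box χ j l (schwartzDist f) = if l = k then schwartzDist f else 0 := by
  have h := TemperedDistribution.fourierMultiplierCLM_toTemperedDistributionCLM_eq
    (hχ.boxSymbol_hasTemperateGrowth j l) f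
  refine h.trans ?_
  have key : SchwartzMap.fourierMultiplierCLM ℂ (boxSymbol χ j l) f = if l = k then f else 0 := by
    have : SchwartzMap.smulLeftCLM ℂ (boxSymbol χ j l) (𝓕 f) = if l = k then 𝓕 f else 0 := by
      ext ξ
      rw [SchwartzMap.smulLeftCLM_apply_apply (hχ.boxSymbol_hasTemperateGrowth j l)]
      by_cases h0 : (𝓕 f : 𝓢(Eu d, ℂ)) ξ = 0
      · split_ifs <;> simp [h0]
      · have hloc := hf ξ h0
        split_ifs with hl
        · rw [boxSymbol, cutoff, hl, hχ.eq_one hloc, Complex.ofReal_one, one_smul]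
        · have h1 : (2 : ℝ) ^ (-j) • (2 * Real.pi) • ξ - lattice l =
              ((2 : ℝ) ^ (-j) • (2 * Real.pi) • ξ - lattice k) - lattice (l - k) := by
            rw [lattice_sub]; abel
          rw [boxSymbol, cutoff, h1, hχ.eq_zero_of_ne hloc (sub_ne_zero.2 hl), Complex.ofReal_zero,
            zero_smul]
          rfl
    rw [SchwartzMap.fourierMultiplierCLM_apply, this]
    split_ifs
    · exact FourierTransform.fourierInv_fourier_eq f
    · exact map_zero (FourierTransform.fourierInvCLM ℂ 𝓢(Eu d, ℂ))
  rw [key]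
  split_ifs
  · rfl
  · exact map_zero _

/-- Each box operator picks out exactly one summand, so the `ℓ^q` norm only counts the cubes in use.
-/
lemma IsCubeCutoff.modNorm_sum_le (hχ : IsCubeCutoff χ) (p q : ℝ≥0∞) [Fact (1 ≤ p)] {j : ℤ}
    {A : Finset (Fin d → ℤ)} {f : (Fin d → ℤ) → 𝓢(Eu d, ℂ)} (hf : ∀ k ∈ A, LocalizedAt j k (f k))
    {M : ℝ≥0∞} (hM : ∀ k ∈ A, eLpNorm (f k) p volume ≤ M) :
    modNorm χ p q j (schwartzDist (∑ k ∈ A, f k)) ≤ M * (A.card : ℝ≥0∞) ^ q⁻¹.toReal := by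
  have h1 : ∀ l, box χ j l (schwartzDist (∑ k ∈ A, f k)) =
      if l ∈ A then schwartzDist (f l) else 0 := by
    intro l
    simp_rw [schwartzDist, map_sum]
    rw [Finset.sum_congr rfl fun k hk => hχ.box_schwartzDist (hf k hk) l, Finset.sum_ite_eq]
  have h2 : ∀ l, distLpNorm p (box χ j l (schwartzDist (∑ k ∈ A, f k))) ≤
      (A : Set (Fin d → ℤ)).indicator (fun _ => M) l := by
    intro l
    rw [h1]
    by_cases hl : l ∈ A
    · rw [if_pos hl, Set.indicator_of_mem (Finset.mem_coe.2 hl), distLpNorm_schwartzDist]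
      exact hM l hl
    · rw [if_neg hl]
      have := distLpNorm_schwartzDist p (0 : 𝓢(Eu d, ℂ))
      rw [schwartzDist, map_zero] at this
      rw [this]
      refine (le_of_eq ?_).trans zero_le
      exact eLpNorm_zero
  refine (eLpNorm_mono_enorm (p := q) (μ := Measure.count) (g := (A : Set (Fin d → ℤ)).indicator
    (fun _ => M)) fun l => by simpa using h2 l).trans ?_
  refine (eLpNorm_indicator_const_le M q).trans (le_of_eq ?_)
  rw [Measure.count_apply_finset, enorm_eq_self, one_div, ENNReal.toReal_inv]

/-- The embedding tested on a sum of functions which are localized in different cubes. -/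
lemma EmbedsInLp.exists_eLpNorm_sum_le (hχ : IsCubeCutoff χ) {p q r : ℝ≥0∞} [Fact (1 ≤ p)]
    [Fact (1 ≤ r)] {μ : ℝ} (h : EmbedsInLp χ p q μ r) :
    ∃ C : ℝ≥0∞, C ≠ ⊤ ∧ ∀ (n : ℕ) (A : Finset (Fin d → ℤ)) (f : (Fin d → ℤ) → 𝓢(Eu d, ℂ))
      (M : ℝ≥0∞), (∀ k ∈ A, LocalizedAt (-(n : ℤ)) k (f k)) → (∀ k ∈ A, eLpNorm (f k) p volume ≤ M) →
      M ≠ ⊤ → eLpNorm (∑ k ∈ A, f k : 𝓢(Eu d, ℂ)) r volume ≤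
        C * ENNReal.ofReal (2 ^ (-(n : ℝ) * μ)) * (M * (A.card : ℝ≥0∞) ^ q⁻¹.toReal) := by
  obtain ⟨C, hC⟩ := h.exists_eLpNorm_le
  refine ⟨C, ENNReal.coe_ne_top, fun n A f M hf hM hMt => ?_⟩
  have hle := hχ.modNorm_sum_le p q (A := A) hf hM
  have hfin : M * (A.card : ℝ≥0∞) ^ q⁻¹.toReal < ⊤ := ENNReal.mul_lt_top hMt.lt_top
    (ENNReal.rpow_lt_top_of_nonneg ENNReal.toReal_nonneg (ENNReal.natCast_ne_top _))
  refine (hC n _ (hle.trans_lt hfin)).trans ?_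
  rw [← mul_assoc]
  gcongr

end Localized

section Packet

/-- A nonnegative bump function supported in a small ball. -/
def smallBump (d : ℕ) : ContDiffBump (0 : Eu d) :=
  -- Multiplied by `2π`, the outer radius becomes the `1/4` of `LocalizedAt`.
  ⟨(16 * Real.pi)⁻¹, (8 * Real.pi)⁻¹, by positivity, by
    have := Real.pi_pos
    gcongr
    norm_num⟩

/-- The bump function `smallBump` as a Schwartz function. -/
def smallSymbol (d : ℕ) : 𝓢(Eu d, ℂ) :=
  ((smallBump d).hasCompactSupport.comp_left (g := Complex.ofReal) Complex.ofReal_zero).toSchwartzMap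
    (Complex.ofRealCLM.contDiff.comp (smallBump d).contDiff)

lemma smallSymbol_apply (ξ : Eu d) : smallSymbol d ξ = (smallBump d ξ : ℂ) := rfl

lemma norm_lt_of_smallSymbol_ne_zero {ξ : Eu d} (h : smallSymbol d ξ ≠ 0) :
    ‖ξ‖ < (8 * Real.pi)⁻¹ := by
  by_contra hle
  refine h ?_
  rw [smallSymbol_apply, ContDiffBump.zero_of_le_dist, Complex.ofReal_zero]
  rw [dist_zero_right]
  exact not_lt.1 hle

/-- A Schwartz function with small Fourier support. -/
def profile (d : ℕ) : 𝓢(Eu d, ℂ) := 𝓕⁻ (smallSymbol d)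

lemma profile_zero_ne_zero : profile d 0 ≠ 0 := by
  have h : profile d 0 = ((∫ ξ, smallBump d ξ : ℝ) : ℂ) := by
    rw [profile, SchwartzMap.fourierInv_coe, Real.fourierInv_eq]
    simp only [smallSymbol_apply, inner_zero_right, AddChar.map_zero_eq_one, one_smul]
    exact integral_ofReal
  rw [h, Complex.ofReal_ne_zero]
  exact (smallBump d).integral_pos.ne'

/-- The profile dilated by `l`, modulated by `c` and translated by `a`. -/
def packet {l : ℝ} (hl : 0 < l) (c a : Eu d) : 𝓢(Eu d, ℂ) :=
  SchwartzMap.compSubConstCLM ℂ a (𝓕⁻ (dilateSymbol (smallSymbol d) hl.ne' c))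

lemma packet_apply {l : ℝ} (hl : 0 < l) (c a x : Eu d) :
    packet hl c a x = (l ^ d : ℝ) •
      (Real.fourierChar (inner ℝ c (l • (x - a))) • profile d (l • (x - a))) := by
  rw [packet, SchwartzMap.compSubConstCLM_apply, fourierInv_dilateSymbol _ hl,
    finrank_euclideanSpace_fin, profile]

lemma eLpNorm_packet {l : ℝ} (hl : 0 < l) (c a : Eu d) (p : ℝ≥0∞) :
    eLpNorm (packet hl c a) p volume =
      ENNReal.ofReal (l ^ d) * (ENNReal.ofReal (l ^ (-(d * p⁻¹.toReal))) *
        eLpNorm (profile d) p volume) := by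
  have h1 : eLpNorm (packet hl c a) p volume =
      eLpNorm ((fun x => (l ^ d : ℝ) • profile d (l • x)) ∘ fun x => x - a) p volume := by
    refine eLpNorm_congr_norm_ae (ae_of_all _ fun x => ?_)
    rw [packet_apply]
    simp
  have hcont : Continuous fun x => profile d (l • x) :=
    (profile d).continuous.comp (continuous_const_smul l)
  rw [h1, eLpNorm_comp_measurePreserving (g := fun x => (l ^ d : ℝ) • profile d (l • x))
    (hcont.const_smul (l ^ d : ℝ)).aestronglyMeasurable
    (measurePreserving_sub_right volume a)]
  have h2 := eLpNorm_const_smul (l ^ d : ℝ) (fun x => profile d (l • x)) p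
    (volume : Measure (Eu d))
  refine h2.trans ?_
  rw [eLpNorm_comp_smul (profile d).continuous.measurable p hl, finrank_euclideanSpace_fin,
    Real.enorm_of_nonneg (by positivity)]

lemma norm_lt_of_fourier_packet_ne_zero {l : ℝ} (hl : 0 < l) {c a ξ : Eu d}
    (h : (𝓕 (packet hl c a) : 𝓢(Eu d, ℂ)) ξ ≠ 0) : ‖l⁻¹ • ξ - c‖ < (8 * Real.pi)⁻¹ := by
  apply norm_lt_of_smallSymbol_ne_zero
  intro h0
  refine h ?_
  rw [packet, fourier_compSubConst, FourierTransform.fourier_fourierInv_eq, dilateSymbol_apply, h0,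
    smul_zero]

lemma localizedAt_packet {j : ℤ} (hl : (0 : ℝ) < 2 ^ j) (k : Fin d → ℤ) (a : Eu d) :
    LocalizedAt j k (packet hl ((2 * Real.pi)⁻¹ • lattice k) a) := by
  intro ξ hξ i
  have h1 := norm_lt_of_fourier_packet_ne_zero hl hξ
  have h2 : (2 : ℝ) ^ (-j) • (2 * Real.pi) • ξ - lattice k =
      (2 * Real.pi) • (((2 : ℝ) ^ j)⁻¹ • ξ - (2 * Real.pi)⁻¹ • lattice k) := by
    rw [smul_sub, smul_inv_smul₀ (by positivity), smul_comm, ← zpow_neg]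
  refine (PiLp.norm_apply_le ((2 : ℝ) ^ (-j) • (2 * Real.pi) • ξ - lattice k) i).trans_lt ?_
  rw [h2, norm_smul, Real.norm_of_nonneg (by positivity)]
  calc _ < 2 * Real.pi * (8 * Real.pi)⁻¹ := by gcongr
    _ = 1 / 4 := by field_simp; norm_num

/-- Stretching by `1/l ≥ 1` in space shrinks the spectrum, which stays in the central cube of level
`0`. -/
lemma localizedAt_zero_packet {l : ℝ} (hl : 0 < l) (hl1 : l ≤ 1) (a : Eu d) :
    LocalizedAt 0 0 (packet hl 0 a) := by
  intro ξ hξ i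
  have h1 := norm_lt_of_fourier_packet_ne_zero hl hξ
  rw [sub_zero, norm_smul, norm_inv, Real.norm_of_nonneg hl.le, inv_mul_lt_iff₀ hl] at h1
  refine (PiLp.norm_apply_le
    ((2 : ℝ) ^ (-(0 : ℤ)) • (2 * Real.pi) • ξ - lattice (0 : Fin d → ℤ)) i).trans_lt ?_
  have h0 : (lattice (0 : Fin d → ℤ)) = 0 := by ext i; simp [lattice]
  rw [h0, sub_zero, neg_zero, zpow_zero, one_smul, norm_smul, Real.norm_of_nonneg (by positivity)]
  calc _ < 2 * Real.pi * (l * (8 * Real.pi)⁻¹) := by gcongr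
    _ ≤ 2 * Real.pi * (1 * (8 * Real.pi)⁻¹) := by gcongr
    _ = 1 / 4 := by field_simp; norm_num

lemma eLpNorm_profile_ne_top (p : ℝ≥0∞) [Fact (1 ≤ p)] : eLpNorm (profile d) p volume ≠ ⊤ :=
  ((profile d).memLp p volume).2.ne

end Packet

end

/-! ### Necessity of the conditions on the exponents. -/

section

variable {d : ℕ} {χ : Eu d → ℝ}

lemma le_of_forall_two_pow_rpow_le {a b : ℝ} {c C : ℝ≥0∞} (hc : c ≠ 0) (hC : C ≠ ⊤)
    (h : ∀ n : ℕ, c * ENNReal.ofReal (((2 : ℝ) ^ n) ^ a) ≤ C * ENNReal.ofReal (((2 : ℝ) ^ n) ^ b)) :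
    a ≤ b := by
  by_contra! hab
  have hle : ∀ n : ℕ, ENNReal.ofReal (((2 : ℝ) ^ n) ^ (a - b)) ≤ C / c := by
    intro n
    have hpos : (0 : ℝ) < 2 ^ n := by positivity
    rw [ENNReal.le_div_iff_mul_le (Or.inl hc) (Or.inr hC), mul_comm]
    have hb : ENNReal.ofReal (((2 : ℝ) ^ n) ^ b) ≠ 0 :=
      (ENNReal.ofReal_pos.2 (by positivity)).ne'
    rw [← ENNReal.mul_le_mul_iff_left hb ENNReal.ofReal_ne_top, mul_assoc,
      ← ENNReal.ofReal_mul (by positivity), ← Real.rpow_add hpos, sub_add_cancel]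
    exact h n
  have hlim : Tendsto (fun n : ℕ => ENNReal.ofReal (((2 : ℝ) ^ n) ^ (a - b))) atTop (𝓝 ⊤) :=
    ENNReal.tendsto_ofReal_atTop.comp ((tendsto_rpow_atTop (sub_pos.2 hab)).comp
      (tendsto_pow_atTop_atTop_of_one_lt one_lt_two))
  exact (ENNReal.div_lt_top hC hc).ne (top_le_iff.1 (le_of_tendsto' hlim hle))

lemma ofReal_mul_volume_rpow_le_eLpNorm {f : Eu d → ℂ} {s : Set (Eu d)} (hs : MeasurableSet s)
    (hs0 : volume s ≠ 0) {r : ℝ≥0∞} (hr : r ≠ 0) {K : ℝ} (hK : 0 ≤ K) (h : ∀ x ∈ s, K ≤ ‖f x‖) :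
    ENNReal.ofReal K * volume s ^ r⁻¹.toReal ≤ eLpNorm f r volume := by
  have h1 := eLpNorm_indicator_const' (c := K) hs hs0 hr
  rw [Real.enorm_of_nonneg hK, one_div, ← ENNReal.toReal_inv] at h1
  rw [← h1]
  refine eLpNorm_mono_enorm fun x => ?_
  by_cases hx : x ∈ s
  · rw [Set.indicator_of_mem hx, Real.enorm_of_nonneg hK, ← ofReal_norm]
    exact ENNReal.ofReal_le_ofReal (h x hx)
  · rw [Set.indicator_of_notMem hx, enorm_zero]
    exact zero_le

lemma eLpNorm_profile_ne_zero {r : ℝ≥0∞} (hr : r ≠ 0) : eLpNorm (profile d) r volume ≠ 0 := by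
  rw [Ne, eLpNorm_eq_zero_iff (profile d).continuous.aestronglyMeasurable hr]
  intro h
  have := (profile d).continuous.ae_eq_iff_eq volume continuous_zero |>.1 h
  exact profile_zero_ne_zero (congrFun this 0)

lemma inv_two_pow_rpow_neg (n : ℕ) (s : ℝ) : (((2 : ℝ) ^ n)⁻¹) ^ (-s) = ((2 : ℝ) ^ n) ^ s := by
  rw [Real.rpow_neg (by positivity), Real.inv_rpow (by positivity), inv_inv]

/-- At level `0` a packet stretched by `2^n` stays in one cube, so the embedding compares its `L^r`
norm with its `L^p` norm, that is `2^{nd/r}` with `2^{nd/p}`. -/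
lemma EmbedsInLp.le_of_dilation (hχ : IsCubeCutoff χ) {p q r : ℝ≥0∞} [Fact (1 ≤ p)]
    [Fact (1 ≤ r)] {μ : ℝ} (h : EmbedsInLp χ p q μ r) :
    d * r⁻¹.toReal ≤ d * p⁻¹.toReal := by
  obtain ⟨C, hC, hle⟩ := h.exists_eLpNorm_sum_le hχ
  have hr0 : r ≠ 0 := (zero_lt_one.trans_le (Fact.out : 1 ≤ r)).ne'
  refine le_of_forall_two_pow_rpow_le (c := eLpNorm (profile d) r volume)
    (C := C * eLpNorm (profile d) p volume) (eLpNorm_profile_ne_zero hr0)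
    (ENNReal.mul_ne_top hC (eLpNorm_profile_ne_top p)) fun n => ?_
  have hl : (0 : ℝ) < (2 ^ n)⁻¹ := by positivity
  have hd : ENNReal.ofReal (((2 : ℝ) ^ n)⁻¹ ^ d) ≠ 0 := (ENNReal.ofReal_pos.2 (by positivity)).ne'
  have h1 := hle 0 {0} (fun _ => packet hl 0 0) _
    (fun k hk => by
      rw [Finset.mem_singleton.1 hk]
      simpa using localizedAt_zero_packet hl (inv_le_one_of_one_le₀ (one_le_pow₀ one_le_two)) 0)
    (fun k _ => (eLpNorm_packet hl 0 0 p).le)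
    (ENNReal.mul_ne_top ENNReal.ofReal_ne_top (ENNReal.mul_ne_top ENNReal.ofReal_ne_top
      (eLpNorm_profile_ne_top p)))
  rw [Finset.sum_singleton, eLpNorm_packet] at h1
  simp only [inv_two_pow_rpow_neg, CharP.cast_eq_zero, neg_zero, zero_mul, Real.rpow_zero,
    ENNReal.ofReal_one, mul_one, Finset.card_singleton, Nat.cast_one, ENNReal.one_rpow] at h1
  rw [mul_left_comm C, ENNReal.mul_le_mul_iff_right hd ENNReal.ofReal_ne_top] at h1
  calc _ = _ := mul_comm _ _
    _ ≤ _ := h1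
    _ = _ := by ring

/-- The same stretched packet is now charged to its own level `-n`, where the cost carries the
factor `2^{-nμ}`. -/
lemma EmbedsInLp.le_of_level (hχ : IsCubeCutoff χ) {p q r : ℝ≥0∞} [Fact (1 ≤ p)]
    [Fact (1 ≤ r)] {μ : ℝ} (h : EmbedsInLp χ p q μ r) :
    d * r⁻¹.toReal ≤ -μ + d * p⁻¹.toReal := by
  obtain ⟨C, hC, hle⟩ := h.exists_eLpNorm_sum_le hχ
  have hr0 : r ≠ 0 := (zero_lt_one.trans_le (Fact.out : 1 ≤ r)).ne'
  refine le_of_forall_two_pow_rpow_le (c := eLpNorm (profile d) r volume)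
    (C := C * eLpNorm (profile d) p volume) (eLpNorm_profile_ne_zero hr0)
    (ENNReal.mul_ne_top hC (eLpNorm_profile_ne_top p)) fun n => ?_
  have hl : (0 : ℝ) < 2 ^ (-(n : ℤ)) := by positivity
  have hln : (2 : ℝ) ^ (-(n : ℤ)) = (2 ^ n)⁻¹ := by rw [zpow_neg, zpow_natCast]
  have hd : ENNReal.ofReal (((2 : ℝ) ^ n)⁻¹ ^ d) ≠ 0 := (ENNReal.ofReal_pos.2 (by positivity)).ne'
  have h1 := hle n {0} (fun k => packet hl ((2 * Real.pi)⁻¹ • lattice k) 0) _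
    (fun k _ => localizedAt_packet hl k 0) (fun k _ => (eLpNorm_packet hl _ 0 p).le)
    (ENNReal.mul_ne_top ENNReal.ofReal_ne_top (ENNReal.mul_ne_top ENNReal.ofReal_ne_top
      (eLpNorm_profile_ne_top p)))
  have hμ : (2 : ℝ) ^ (-(n : ℝ) * μ) = (2 ^ n) ^ (-μ) := by
    rw [← Real.rpow_natCast, ← Real.rpow_mul two_pos.le]
    ring_nf
  rw [Finset.sum_singleton, eLpNorm_packet] at h1
  simp only [hln, hμ, inv_two_pow_rpow_neg, Finset.card_singleton, Nat.cast_one, ENNReal.one_rpow,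
    mul_one] at h1
  rw [mul_left_comm (C * _), ENNReal.mul_le_mul_iff_right hd ENNReal.ofReal_ne_top] at h1
  rw [Real.rpow_add (by positivity), ENNReal.ofReal_mul (by positivity)]
  calc _ = _ := mul_comm _ _
    _ ≤ _ := h1
    _ = _ := by ring

/-- A superposition of modulated and translated profiles. -/
def superposition (A : Finset (Fin d → ℤ)) (a : (Fin d → ℤ) → Eu d) (x : Eu d) : ℂ :=
  ∑ k ∈ A, Real.fourierChar (inner ℝ ((2 * Real.pi)⁻¹ • lattice k) (x - a k)) • profile d (x - a k)

lemma EmbedsInLp.exists_eLpNorm_superposition_le (hχ : IsCubeCutoff χ) {p q r : ℝ≥0∞} [Fact (1 ≤ p)]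
    [Fact (1 ≤ r)] {μ : ℝ} (h : EmbedsInLp χ p q μ r) :
    ∃ C : ℝ≥0∞, C ≠ ⊤ ∧ ∀ (A : Finset (Fin d → ℤ)) (a : (Fin d → ℤ) → Eu d),
      eLpNorm (superposition A a) r volume ≤ C * (A.card : ℝ≥0∞) ^ q⁻¹.toReal := by
  obtain ⟨C, hC, hle⟩ := h.exists_eLpNorm_sum_le hχ
  refine ⟨C * eLpNorm (profile d) p volume, ENNReal.mul_ne_top hC (eLpNorm_profile_ne_top p),
    fun A a => ?_⟩
  have hl : (0 : ℝ) < 2 ^ (0 : ℤ) := by positivity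
  have h1 := hle 0 A (fun k => packet hl ((2 * Real.pi)⁻¹ • lattice k) (a k))
    (eLpNorm (profile d) p volume) (fun k _ => by simpa using localizedAt_packet hl k (a k))
    (fun k _ => by simp [eLpNorm_packet]) (eLpNorm_profile_ne_top p)
  have h2 : ⇑(∑ k ∈ A, packet hl ((2 * Real.pi)⁻¹ • lattice k) (a k)) = superposition A a := by
    ext x
    simp [superposition, packet_apply, _root_.sum_apply]
  rw [h2] at h1
  simpa [mul_assoc] using h1

/-- The lattice points of the cube `[0, N)^d`. -/
def latticeCube (d N : ℕ) : Finset (Fin d → ℤ) := Fintype.piFinset fun _ => Finset.Ico 0 (N : ℤ)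

lemma card_latticeCube (d N : ℕ) : (latticeCube d N).card = N ^ d := by
  simp [latticeCube, Fintype.card_piFinset]

lemma norm_lattice_le_of_mem {N : ℕ} {k : Fin d → ℤ} (hk : k ∈ latticeCube d N) :
    ‖lattice k‖ ≤ d * N := by
  have h : ∀ i, ‖lattice k i‖ ≤ N := by
    intro i
    have := Finset.mem_Ico.1 (Fintype.mem_piFinset.1 hk i)
    change |(k i : ℝ)| ≤ N
    rw [abs_of_nonneg (by exact_mod_cast this.1)]
    exact_mod_cast this.2.le
  refine le_of_sq_le_sq ?_ (by positivity)
  rw [EuclideanSpace.norm_sq_eq]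
  calc ∑ i, ‖lattice k i‖ ^ 2 ≤ ∑ _i : Fin d, (N : ℝ) ^ 2 := by gcongr with i; exact h i
    _ = d * (N : ℝ) ^ 2 := by simp
    _ ≤ (d : ℝ) ^ 2 * (N : ℝ) ^ 2 := by
      gcongr
      exact_mod_cast Nat.le_self_pow two_ne_zero d
    _ = (d * N) ^ 2 := by ring

lemma card_latticeCube_two_pow_rpow (n : ℕ) (s : ℝ) :
    ((latticeCube d (2 ^ n)).card : ℝ≥0∞) ^ s = ENNReal.ofReal (((2 : ℝ) ^ n) ^ (d * s)) := by
  rw [card_latticeCube, Real.rpow_mul (by positivity), Real.rpow_natCast,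
    ← ENNReal.ofReal_rpow_of_pos (by positivity)]
  congr 1
  rw [← ENNReal.ofReal_natCast]
  push_cast
  rfl

lemma exists_norm_profile_ge (d : ℕ) : ∃ δ : ℝ, 0 < δ ∧ ∀ x : Eu d, ‖x‖ < δ →
    ‖profile d 0‖ / 2 ≤ ‖profile d x‖ := by
  have h0 : ‖profile d 0‖ / 2 < ‖profile d 0‖ := half_lt_self (norm_pos_iff.2 profile_zero_ne_zero)
  have h := ((profile d).continuous.norm.tendsto 0).eventually_const_lt h0
  obtain ⟨δ, hδ, hball⟩ := Metric.eventually_nhds_iff.1 h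
  exact ⟨δ, hδ, fun x hx => (hball (by rwa [dist_zero_right])).le⟩

lemma norm_fourierChar_sub_one_le (t : ℝ) : ‖(Real.fourierChar t : ℂ) - 1‖ ≤ 2 * Real.pi * |t| := by
  rw [Real.fourierChar_apply, mul_comm _ Complex.I]
  refine Real.norm_exp_I_mul_ofReal_sub_one_le.trans (le_of_eq ?_)
  rw [norm_mul, Real.norm_of_nonneg (by positivity), Real.norm_eq_abs]

/-- With `N = 2^n`, the `N^d` modulated profiles centred at `0` add coherently on a ball of radius
comparable to `1/N`. Their `L^r` norm is at least of order `N^{d - d/r}`, while the modulation norm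
is at most of order `N^{d/q}`. -/
lemma EmbedsInLp.le_of_concentration (hχ : IsCubeCutoff χ) {p q r : ℝ≥0∞} [Fact (1 ≤ p)]
    [Fact (1 ≤ r)] {μ : ℝ} (h : EmbedsInLp χ p q μ r) :
    d - d * r⁻¹.toReal ≤ d * q⁻¹.toReal := by
  obtain ⟨C, hC, hle⟩ := h.exists_eLpNorm_superposition_le hχ
  have hr0 : r ≠ 0 := (zero_lt_one.trans_le (Fact.out : 1 ≤ r)).ne'
  obtain ⟨δ, hδ, hball⟩ := exists_norm_profile_ge d
  -- Frequencies have `‖lattice k‖ ≤ d N`, so for `‖x‖ < ε/N` every phase is within `d ε ≤ 1/2` of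
  -- `1`, and the sum keeps half of its terms.
  obtain ⟨ε, hε, hεδ, hεd⟩ : ∃ ε : ℝ, 0 < ε ∧ ε ≤ δ ∧ d * ε ≤ 1 / 2 := by
    refine ⟨min δ (1 / (2 * (d + 1))), by positivity, min_le_left _ _, ?_⟩
    have : min δ (1 / (2 * (d + 1))) ≤ 1 / (2 * ((d : ℝ) + 1)) := min_le_right _ _
    have h1 : (d : ℝ) * min δ (1 / (2 * (d + 1))) ≤ d * (1 / (2 * ((d : ℝ) + 1))) := by gcongr
    refine h1.trans ?_
    rw [mul_one_div, div_le_div_iff₀ (by positivity) (by positivity)]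
    linarith
  have hφ : 0 < ‖profile d 0‖ := norm_pos_iff.2 profile_zero_ne_zero
  obtain ⟨V, hV⟩ : ∃ V : ℝ≥0∞, V = volume (Metric.ball (0 : Eu d) ε) := ⟨_, rfl⟩
  have hV0 : V ≠ 0 := hV ▸ (Metric.measure_ball_pos volume 0 hε).ne'
  have hVt : V ≠ ⊤ := hV ▸ measure_ball_lt_top.ne
  refine le_of_forall_two_pow_rpow_le
    (c := ENNReal.ofReal (‖profile d 0‖ / 4) * V ^ r⁻¹.toReal) (C := C) ?_ hC fun n => ?_
  · exact mul_ne_zero (ENNReal.ofReal_pos.2 (by positivity)).ne'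
      (ENNReal.rpow_pos (pos_iff_ne_zero.2 hV0) hVt).ne'
  have hN : (0 : ℝ) < 2 ^ n := by positivity
  have hball_vol : volume (Metric.ball (0 : Eu d) (ε / 2 ^ n)) =
      ENNReal.ofReal (((2 : ℝ) ^ n) ^ (-(d : ℝ))) * V := by
    rw [div_eq_inv_mul, Measure.addHaar_ball_mul_of_pos _ _ (by positivity), finrank_euclideanSpace_fin, hV,
      Real.rpow_neg hN.le, Real.rpow_natCast, inv_pow]
  have hlow : ∀ x ∈ Metric.ball (0 : Eu d) (ε / 2 ^ n),
      ((2 : ℝ) ^ n) ^ d * (‖profile d 0‖ / 4) ≤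
        ‖superposition (latticeCube d (2 ^ n)) (fun _ => 0) x‖ := by
    intro x hx
    rw [mem_ball_zero_iff, lt_div_iff₀ hN] at hx
    have hxδ : ‖x‖ < δ := by
      have : (1 : ℝ) ≤ 2 ^ n := one_le_pow₀ one_le_two
      nlinarith [norm_nonneg x]
    have hsup : superposition (latticeCube d (2 ^ n)) (fun _ => 0) x =
        (∑ k ∈ latticeCube d (2 ^ n),
          (Real.fourierChar (inner ℝ ((2 * Real.pi)⁻¹ • lattice k) x) : ℂ)) * profile d x := by
      simp [superposition, Finset.sum_mul, Circle.smul_def]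
    have hchar : ∀ k ∈ latticeCube d (2 ^ n),
        ‖(Real.fourierChar (inner ℝ ((2 * Real.pi)⁻¹ • lattice k) x) : ℂ) - 1‖ ≤ 1 / 2 := by
      intro k hk
      refine (norm_fourierChar_sub_one_le _).trans ?_
      rw [real_inner_smul_left, abs_mul, abs_of_pos (by positivity), ← mul_assoc,
        mul_inv_cancel₀ (by positivity), one_mul]
      have h1 := norm_lattice_le_of_mem hk
      push_cast at h1
      calc |inner ℝ (lattice k) x| ≤ ‖lattice k‖ * ‖x‖ := abs_real_inner_le_norm _ _
        _ ≤ d * 2 ^ n * ‖x‖ := by gcongr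
        _ = d * (‖x‖ * 2 ^ n) := by ring
        _ ≤ d * ε := by gcongr
        _ ≤ 1 / 2 := hεd
    have hsum : ((2 : ℝ) ^ n) ^ d / 2 ≤ ‖∑ k ∈ latticeCube d (2 ^ n),
        (Real.fourierChar (inner ℝ ((2 * Real.pi)⁻¹ • lattice k) x) : ℂ)‖ := by
      have h1 := norm_sum_le_of_le _ hchar
      rw [Finset.sum_sub_distrib, Finset.sum_const, Finset.sum_const, card_latticeCube] at h1
      have h2 := norm_sub_norm_le ((2 ^ n) ^ d • (1 : ℂ)) (∑ k ∈ latticeCube d (2 ^ n),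
        (Real.fourierChar (inner ℝ ((2 * Real.pi)⁻¹ • lattice k) x) : ℂ))
      rw [norm_sub_rev] at h2
      have h3 : ‖(2 ^ n) ^ d • (1 : ℂ)‖ = ((2 : ℝ) ^ n) ^ d := by simp
      have h4 : (2 ^ n) ^ d • (1 / 2 : ℝ) = ((2 : ℝ) ^ n) ^ d / 2 := by simp; ring
      rw [h3] at h2
      rw [h4] at h1
      linarith
    rw [hsup, norm_mul]
    calc ((2 : ℝ) ^ n) ^ d * (‖profile d 0‖ / 4) =
        ((2 : ℝ) ^ n) ^ d / 2 * (‖profile d 0‖ / 2) := by ring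
      _ ≤ _ := mul_le_mul hsum (hball x hxδ) (by positivity) (norm_nonneg _)
  have h1 := (ofReal_mul_volume_rpow_le_eLpNorm measurableSet_ball
    (Metric.measure_ball_pos volume 0 (by positivity)).ne' hr0 (by positivity) hlow).trans
    (hle _ _)
  rw [card_latticeCube_two_pow_rpow, hball_vol, ENNReal.mul_rpow_of_nonneg _ _ ENNReal.toReal_nonneg,
    ENNReal.ofReal_rpow_of_pos (by positivity), ← Real.rpow_mul hN.le,
    ENNReal.ofReal_mul (by positivity)] at h1
  refine le_trans (le_of_eq ?_) h1
  rw [sub_eq_add_neg, Real.rpow_add hN, Real.rpow_natCast, ENNReal.ofReal_mul (by positivity), neg_mul]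
  ring

lemma exists_forall_norm_profile_le {ε : ℝ} (hε : 0 < ε) :
    ∃ B : ℝ, ∀ x : Eu d, B < ‖x‖ → ‖profile d x‖ ≤ ε := by
  have h := ((profile d).tendsto_cocompact.norm).eventually_lt_const (by simpa using hε)
  rw [← Metric.cobounded_eq_cocompact, ← comap_norm_atTop, eventually_comap] at h
  obtain ⟨B, hB⟩ := eventually_atTop.1 h
  exact ⟨B, fun x hx => (hB _ hx.le x rfl).le⟩

lemma one_le_norm_lattice {k : Fin d → ℤ} (hk : k ≠ 0) : 1 ≤ ‖lattice k‖ := by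
  obtain ⟨i, hi⟩ := Function.ne_iff.1 hk
  refine le_trans ?_ (abs_le_norm_lattice k i)
  exact_mod_cast Int.one_le_abs hi

/-- Profiles moved far apart do not interact, so with `N = 2^n` the `L^r` norm of `N^d` of them is
at least of order `N^{d/r}`, against `N^{d/q}` for the modulation norm. -/
lemma EmbedsInLp.le_of_separation (hχ : IsCubeCutoff χ) {p q r : ℝ≥0∞} [Fact (1 ≤ p)]
    [Fact (1 ≤ r)] {μ : ℝ} (h : EmbedsInLp χ p q μ r) :
    d * r⁻¹.toReal ≤ d * q⁻¹.toReal := by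
  obtain ⟨C, hC, hle⟩ := h.exists_eLpNorm_superposition_le hχ
  have hr0 : r ≠ 0 := (zero_lt_one.trans_le (Fact.out : 1 ≤ r)).ne'
  obtain ⟨δ, hδ, hball⟩ := exists_norm_profile_ge d
  have hφ : 0 < ‖profile d 0‖ := norm_pos_iff.2 profile_zero_ne_zero
  obtain ⟨V, hV⟩ : ∃ V : ℝ≥0∞, V = volume (Metric.ball (0 : Eu d) δ) := ⟨_, rfl⟩
  have hV0 : V ≠ 0 := hV ▸ (Metric.measure_ball_pos volume 0 hδ).ne'
  have hVt : V ≠ ⊤ := hV ▸ measure_ball_lt_top.ne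
  refine le_of_forall_two_pow_rpow_le
    (c := ENNReal.ofReal (‖profile d 0‖ / 4) * V ^ r⁻¹.toReal) (C := C) ?_ hC fun n => ?_
  · exact mul_ne_zero (ENNReal.ofReal_pos.2 (by positivity)).ne'
      (ENNReal.rpow_pos (pos_iff_ne_zero.2 hV0) hVt).ne'
  obtain ⟨A, hA⟩ : ∃ A, A = latticeCube d (2 ^ n) := ⟨_, rfl⟩
  have hAcard : 0 < (A.card : ℝ) := by rw [hA, card_latticeCube]; positivity
  -- The threshold is divided by the number of packets, so that all the tails together cost at most
  -- half of the lower bound `‖profile d 0‖ / 2` near each centre.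
  obtain ⟨B, hB⟩ := exists_forall_norm_profile_le (d := d)
    (ε := ‖profile d 0‖ / 4 / A.card) (by positivity)
  obtain ⟨R, hRB, hRδ⟩ : ∃ R : ℝ, B + δ < R ∧ 2 * δ < R :=
    ⟨max (B + δ) (2 * δ) + 1, by linarith [le_max_left (B + δ) (2 * δ)],
      by linarith [le_max_right (B + δ) (2 * δ)]⟩
  have hR : 0 < R := by linarith
  have hsep : ∀ k l : Fin d → ℤ, k ≠ l → R ≤ ‖R • lattice k - R • lattice l‖ := by
    intro k l hkl
    rw [← smul_sub, ← lattice_sub, norm_smul, Real.norm_of_nonneg hR.le]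
    exact le_mul_of_one_le_right hR.le (one_le_norm_lattice (sub_ne_zero.2 hkl))
  obtain ⟨s, hs⟩ : ∃ s : Set (Eu d), s = ⋃ k ∈ A, Metric.ball (R • lattice k) δ := ⟨_, rfl⟩
  have hvol : volume s = A.card * V := by
    rw [hs, measure_biUnion_finset]
    · simp [Measure.addHaar_ball_center, hV]
    · intro k _ l _ hkl
      refine Metric.ball_disjoint_ball ?_
      rw [dist_eq_norm]
      linarith [hsep k l hkl]
    · exact fun k _ => measurableSet_ball
  have hlow : ∀ x ∈ s, ‖profile d 0‖ / 4 ≤ ‖superposition A (fun k => R • lattice k) x‖ := by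
    intro x hx
    rw [hs, Set.mem_iUnion₂] at hx
    obtain ⟨k, hk, hxk⟩ := hx
    rw [mem_ball_iff_norm] at hxk
    rw [superposition, ← Finset.add_sum_erase _ _ hk]
    have h1 := hball _ hxk
    have h2 : ‖∑ l ∈ A.erase k, Real.fourierChar (inner ℝ ((2 * Real.pi)⁻¹ • lattice l)
        (x - R • lattice l)) • profile d (x - R • lattice l)‖ ≤ ‖profile d 0‖ / 4 := by
      calc _ ≤ ∑ l ∈ A.erase k, ‖profile d 0‖ / 4 / A.card := by
            refine norm_sum_le_of_le _ fun l hl => ?_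
            rw [Circle.norm_smul]
            apply hB
            have h3 := hsep k l (Finset.ne_of_mem_erase hl).symm
            have h4 := norm_sub_le (R • lattice k - x) (R • lattice l - x)
            rw [sub_sub_sub_cancel_right, norm_sub_rev _ x, norm_sub_rev _ x] at h4
            linarith
        _ ≤ ∑ l ∈ A, ‖profile d 0‖ / 4 / A.card :=
            Finset.sum_le_sum_of_subset_of_nonneg (Finset.erase_subset k A)
              fun _ _ _ => by positivity
        _ = ‖profile d 0‖ / 4 := by
            rw [Finset.sum_const, nsmul_eq_mul]
            field_simp
    refine le_trans ?_ (norm_sub_le_norm_add _ _)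
    rw [Circle.norm_smul]
    linarith
  have h1 := (ofReal_mul_volume_rpow_le_eLpNorm (hs ▸ Finset.measurableSet_biUnion A fun k _ =>
    measurableSet_ball) (by rw [hvol]; exact mul_ne_zero (by exact_mod_cast hAcard.ne') hV0) hr0
    (by positivity) hlow).trans (hle _ _)
  rw [hvol, ENNReal.mul_rpow_of_nonneg _ _ ENNReal.toReal_nonneg, hA, card_latticeCube_two_pow_rpow,
    card_latticeCube_two_pow_rpow] at h1
  refine le_trans (le_of_eq ?_) h1
  ring

/-- The embedding into `L^r` holds exactly for the exponents in the stated range. -/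
theorem IsCubeCutoff.embedsInLp_iff (hd : 1 ≤ d) (hχ : IsCubeCutoff χ) {p q r : ℝ≥0∞}
    [Fact (1 ≤ p)] [Fact (1 ≤ q)] [Fact (1 ≤ r)] {μ : ℝ} :
    EmbedsInLp χ p q μ r ↔ (max p q ≤ r ∧ r ≤ ENNReal.conjExponent q) ∧
      μ - d * p⁻¹.toReal ≤ -(d * r⁻¹.toReal) := by
  have hp : 1 ≤ p := Fact.out
  have hq : 1 ≤ q := Fact.out
  have hr : 1 ≤ r := Fact.out
  have hd0 : (0 : ℝ) < d := by exact_mod_cast hd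
  refine ⟨fun h => ?_, fun h => hχ.embedsInLp hq h.1.1 h.1.2 h.2⟩
  refine ⟨⟨max_le ?_ ?_, ?_⟩, ?_⟩
  · exact (toReal_inv_le_toReal_inv_iff hp hr).1 (le_of_mul_le_mul_left (h.le_of_dilation hχ) hd0)
  · exact (toReal_inv_le_toReal_inv_iff hq hr).1 (le_of_mul_le_mul_left (h.le_of_separation hχ) hd0)
  · rw [le_conjExponent_iff hq hr]
    refine le_of_mul_le_mul_left ?_ hd0
    linarith [h.le_of_concentration hχ]
  · linarith [h.le_of_level hχ]

end

end ScalingModulation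

end

theorem proposition3p1 (d : ℕ) (hd : 1 ≤ d) (χ : ScalingModulation.Eu d → ℝ)
    (hχ : ScalingModulation.IsCubeCutoff χ) :
    (∀ (p q r : ℝ≥0∞) [Fact (1 ≤ p)] [Fact (1 ≤ q)] [Fact (1 ≤ r)] (μ : ℝ),
      ScalingModulation.sigmaExp d p q ≤ μ →
      μ ≤ ScalingModulation.aExp d p q →
      ScalingModulation.sigmaExp d p q < ScalingModulation.aExp d p q →
      (ScalingModulation.EmbedsInLp χ p q μ r ↔
        (max p q ≤ r ∧ r ≤ ENNReal.conjExponent q) ∧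
          μ - d * p⁻¹.toReal ≤ -(d * r⁻¹.toReal))) ∧
    (∀ μ : ℝ, 0 < μ → ¬ ScalingModulation.EmbedsInLp χ 2 1 μ 2) := by
  refine ⟨fun p q r _ _ _ μ _ _ _ => hχ.embedsInLp_iff hd, fun μ hμ h => ?_⟩
  have := ((hχ.embedsInLp_iff hd).1 h).2
  -- With `p = r = 2` the terms `d/p` and `d/r` cancel and leave `μ ≤ 0`.
  linarith
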